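/- Let $a<b$, $T>0$, $\alpha\in(0,1)$, $\nu_3>0$, let $V:[a,b]\to\mathbb R$, and put $\mu_l=\frac{2\pi l}{b-a}$ for $l\in\mathbb Z$. For $u\in L^2(a,b)$ let $\widehat u_l=\frac1{b-a}\int_a^b u(x)e^{-i\mu_l(x-a)}\,dx$. For an integer $m\ge 0$ let $H^m_{\rm per}=\{u\in H^m(a,b): \partial_x^k u(a)=\partial_x^k u(b),\ 0\le k\le m-1\}$ (continuous representatives for $m\ge1$), with norm $\|u\|_{H^m}=\big(\sum_{l\in\mathbb Z}(1+\mu_l^2)^m|\widehat u_l|^2\big)^{1/2}$. For $\varepsilon\in(0,1]$ let $\psi$ be a classical solution on $[0,T/\varepsilon]$ of $$i\partial_t\psi=-\partial_{xx}\psi+\varepsilon V\psi,\quad a<x<b,\qquad \psi(a,t)=\psi(b,t),\ \ \partial_x\psi(a,t)=\partial_x\psi(b,t),\qquad \psi(x,0)=\psi_0(x).$$ **Scheme.** For an even positive integer $N$ let $h=(b-a)/N$, $x_j=a+jh$ $(0\le j\le N)$, $\mathcal T_N=\{-\frac N2,\dots,\frac N2-1\}$, and for a grid function $u=(u_0,\dots,u_N)$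 let $\widetilde u_l=\frac1N\sum_{j=0}^{N-1}u_je^{-i\mu_l(x_j-a)}$ and $I_Nu(x)=\sum_{l\in\mathcal T_N}\widetilde u_le^{i\mu_l(x-a)}$. For a time step $\tau>0$ and $t_n=n\tau$ the TSFP approximation is $\psi^0_j=\psi_0(x_j)$ and, for $n\ge0$, $$\psi^{(1)}_j=\sum_{l\in\mathcal T_N}e^{-i\tau\mu_l^2/2}\,\widetilde{(\psi^n)}_l\,e^{i\mu_l(x_j-a)},\quad \psi^{(2)}_j=e^{-i\varepsilon\tau V(x_j)}\psi^{(1)}_j,\quad \psi^{n+1}_j=\sum_{l\in\mathcal T_N}e^{-i\tau\mu_l^2/2}\,\widetilde{(\psi^{(2)})}_l\,e^{i\mu_l(x_j-a)}.$$ **Assumptions.** For an integer $m\ge3$ and a number $M_m$ independent of $\varepsilon$: * $(A_m)$: $\psi(t)\in H^m_{\rm per}$ and $\|\psi(t)\|_{H^m}\le M_m$ for $0\le t\le T/\varepsilon$, and $\partial_t\psi(t)\in H^{m-2}_{\rm per}$ and $\|\partial_t\psi(t)\|_{H^{m-2}}\le M_m$ for $0<t<T/\varepsilon$; * $(B_m)$: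 $V\in H^{\max\{m,5\}}_{\rm per}$. **Step conditions.** For $\tau_0\in(0,1)$: * (S) $0<\tau<\alpha\,\dfrac{2\pi}{\mu_1^2(1+\tau_0)^2}\,\tau_0^2$; * (D) $\tau>0$ and $\Big|\tau-\dfrac{2l\pi}{\mu_1^2K}\Big|\ge\dfrac{\lambda}{|\mu_1^2K|^{2+\nu_3}}$ for all $K,l\in\mathbb Z$ with $0<|K|\le\lceil1/\tau_0\rceil^2$ and $l\ge0$, where $\lambda=\dfrac{\alpha\pi\mu_1^{2+2\nu_3}}{4\sum_{k\ge1}k^{-1-\nu_3}}$. **Theorem.** (1) Let $m\ge3$ and assume $(B_m)$. There is a constant $C>0$, depending only on $a,b,V,T,\alpha,\nu_3,m,M_m$, such that for every $\varepsilon\in(0,1]$, every solution $\psi$ satisfying $(A_m)$, every $\tau_0\in(0,1)$, every $\tau$ satisfying either (S), or (D) provided $m\ge5+2\nu_3$, every even $N\ge2$ and every integer $0\le n\le\frac{T/\varepsilon}{\tau}$, one has $\psi(\cdot,t_n)-I_N\psi^n\in H^1_{\rm per}$ and $$\|\psi(\cdot,t_n)-I_N\psi^n\|_{H^1}\le C\left(h^{m-1}+\varepsilon\tau^2+\tau_0^{m-1}\right).$$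 (2) Assume $(B_k)$ for every $k\geq 3$, let $(M_k)_k$ be given numbers and let $m\ge3$. Consider $\varepsilon\in(0,1]$ and smooth solutions $\psi$ satisfying $(A_k)$ for every $k\ge3$. Then: (a) for every integer $p\ge0$ there is $C>0$, depending only on $a,b,V,T,\alpha,\nu_3,m,p,(M_k)_k$, such that for all such $\varepsilon,\psi$, all $\tau_0\in(0,1)$, all $\tau$ satisfying (S) or (D), all even $N\ge2$ and all $0\le n\le\frac{T/\varepsilon}{\tau}$, $\psi(\cdot,t_n)-I_N\psi^n\in H^1_{\rm per}$ and $$\|\psi(\cdot,t_n)-I_N\psi^n\|_{H^1}\le C\left(h^{m-1}+\varepsilon\tau^2+\tau_0^{p}\right);$$ (b) there is $C>0$, depending only on $a,b,V,T,\alpha,\nu_3,m,(M_k)_k$, such that for every precision $\delta>0$ there is a fixed cut-off $\tau_0\in(0,1)$, depending only on $\delta$ and the same data, such that for all such $\varepsilon,\psi$, all $\tau$ satisfying (S) or (D) with this $\tau_0$, all even $N\ge2$ and all $0\le n\le\frac{T/\varepsilon}{\tau}$, $\psi(\cdot,t_n)-I_N\psi^n\in H^1_{\rm per}$ and $$\|\psi(\cdot,t_n)-I_N\psi^n\|_{H^1}\le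 C\left(h^{m-1}+\varepsilon\tau^2\right)+\delta.$$ -/

import Mathlib

open MeasureTheory Set

noncomputable section

/-- The frequency `μ_l = 2πl/(b-a)`. -/
def freq (a b : ℝ) (l : ℤ) : ℝ := 2 * Real.pi * l / (b - a)

/-- The Fourier mode `x ↦ exp(i μ_l (x - a))`. -/
def fourierMode (a b : ℝ) (l : ℤ) (x : ℝ) : ℂ :=
  Complex.exp (Complex.I * ((freq a b l * (x - a) : ℝ) : ℂ))

/-- The Fourier coefficient `û_l = (b-a)⁻¹ ∫_a^b u(x) exp(-i μ_l (x - a)) dx`. -/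
def fourierCoef (a b : ℝ) (u : ℝ → ℂ) (l : ℤ) : ℂ :=
  ((1 / (b - a) : ℝ) : ℂ) *
    ∫ x in a..b, u x * Complex.exp (-(Complex.I * ((freq a b l * (x - a) : ℝ) : ℂ)))

/-- Membership in `H^m_per(a,b)`, for the continuous representative when `m ≥ 1`: there are
functions `g 0 = u, g 1, …, g m` in `L²(a,b)` such that, for `k < m`, `g k` is absolutely
continuous on `[a,b]` with derivative `g (k+1)` (so `g k` is the `k`-th weak derivative of `u`)
and `g k` takes the same value at `a` and at `b`. -/
def MemHper (a b : ℝ) (m : ℕ) (u : ℝ → ℂ) : Prop :=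
  ∃ g : ℕ → ℝ → ℂ,
    (∀ x ∈ Icc a b, g 0 x = u x) ∧
    (∀ k ≤ m, MemLp (g k) 2 (volume.restrict (Ioc a b))) ∧
    (∀ k < m, ∀ x ∈ Icc a b, g k x = g k a + ∫ y in a..x, g (k + 1) y) ∧
    (∀ k < m, g k a = g k b)

/-- The norm `‖u‖_{H^m} = (∑_l (1 + μ_l²)^m |û_l|²)^{1/2}` of an element of `H^m_per(a,b)`. -/
def hperNorm (a b : ℝ) (m : ℕ) (u : ℝ → ℂ) : ℝ :=
  Real.sqrt (∑' l : ℤ, (1 + freq a b l ^ 2) ^ m * ‖fourierCoef a b u l‖ ^ 2)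

/-- `ψ` (written `ψ t x`) solves, on the time interval `[0, S]`, the periodic problem
`i ∂_t ψ = -∂_xx ψ + ε V ψ` on `(a,b)` with initial value `ψ₀`. -/
structure IsSchrodingerSolution (a b : ℝ) (V : ℝ → ℝ) (ε S : ℝ) (ψ₀ : ℝ → ℂ)
    (ψ : ℝ → ℝ → ℂ) : Prop where
  initial : ∀ x ∈ Icc a b, ψ 0 x = ψ₀ x
  regular_space : ∀ t ∈ Icc 0 S, ContDiffOn ℝ 2 (ψ t) (Icc a b)
  periodic : ∀ t ∈ Icc 0 S, ψ t a = ψ t b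
  periodic_deriv : ∀ t ∈ Icc 0 S,
    derivWithin (ψ t) (Icc a b) a = derivWithin (ψ t) (Icc a b) b
  continuous_time : ∀ x ∈ Icc a b, ContinuousOn (fun t => ψ t x) (Icc 0 S)
  differentiable_time : ∀ t ∈ Ioo 0 S, ∀ x ∈ Ioo a b, DifferentiableAt ℝ (fun s => ψ s x) t
  equation : ∀ t ∈ Ioo 0 S, ∀ x ∈ Ioo a b,
    Complex.I * deriv (fun s => ψ s x) t =
      -iteratedDeriv 2 (ψ t) x + (ε : ℂ) * (V x : ℂ) * ψ t x

/-- The regularity bounds on `[0, S]`: `‖ψ(t)‖_{H^m} ≤ M` and `‖∂_t ψ(t)‖_{H^{m-2}} ≤ M`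
(used for `m ≥ 2` only). -/
structure RegularityBound (a b S : ℝ) (m : ℕ) (M : ℝ) (ψ : ℝ → ℝ → ℂ) : Prop where
  mem : ∀ t ∈ Icc 0 S, MemHper a b m (ψ t)
  norm_le : ∀ t ∈ Icc 0 S, hperNorm a b m (ψ t) ≤ M
  mem_deriv : ∀ t ∈ Ioo 0 S, MemHper a b (m - 2) (fun x => deriv (fun s => ψ s x) t)
  norm_deriv_le : ∀ t ∈ Ioo 0 S,
    hperNorm a b (m - 2) (fun x => deriv (fun s => ψ s x) t) ≤ M

/-- The mesh size `h = (b-a)/N`. -/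
def meshSize (a b : ℝ) (N : ℕ) : ℝ := (b - a) / N

/-- The grid points `x_j = a + j h`, `j = 0, …, N`. -/
def gridPoint (a b : ℝ) (N : ℕ) (j : Fin (N + 1)) : ℝ := a + (j : ℕ) * meshSize a b N

/-- The index set `{-N/2, …, N/2 - 1}` (for even `N`). -/
def modeSet (N : ℕ) : Finset ℤ := Finset.Ico (-((N : ℤ) / 2)) ((N : ℤ) / 2)

/-- The discrete Fourier coefficient `ũ_l = N⁻¹ ∑_{j=0}^{N-1} u_j exp(-i μ_l (x_j - a))`. -/
def discreteCoef (a b : ℝ) (N : ℕ) (u : Fin (N + 1) → ℂ) (l : ℤ) : ℂ :=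
  (1 / (N : ℂ)) * ∑ j : Fin N, u j.castSucc *
    Complex.exp (-(Complex.I * ((freq a b l * (gridPoint a b N j.castSucc - a) : ℝ) : ℂ)))

/-- The trigonometric interpolation `I_N u` of a grid function `u`. -/
def trigInterp (a b : ℝ) (N : ℕ) (u : Fin (N + 1) → ℂ) (x : ℝ) : ℂ :=
  ∑ l ∈ modeSet N, discreteCoef a b N u l * fourierMode a b l x

/-- The half step of the free flow,
`u ↦ (∑_l exp(-i τ μ_l² / 2) ũ_l exp(i μ_l (x_j - a)))_j`. -/
def halfFreeStep (a b : ℝ) (N : ℕ) (τ : ℝ) (u : Fin (N + 1) → ℂ) : Fin (N + 1) → ℂ :=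
  fun j => ∑ l ∈ modeSet N,
    Complex.exp (-(Complex.I * ((τ * freq a b l ^ 2 / 2 : ℝ) : ℂ))) *
      discreteCoef a b N u l * fourierMode a b l (gridPoint a b N j)

/-- The full step of the potential flow, `u_j ↦ exp(-i ε τ V(x_j)) u_j`. -/
def potentialStep (a b : ℝ) (V : ℝ → ℝ) (ε : ℝ) (N : ℕ) (τ : ℝ) (u : Fin (N + 1) → ℂ) :
    Fin (N + 1) → ℂ :=
  fun j => Complex.exp (-(Complex.I * ((ε * τ * V (gridPoint a b N j) : ℝ) : ℂ))) * u j

/-- The time-splitting Fourier pseudospectral approximation `ψ^n` at `t_n = nτ`. -/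
def tsfp (a b : ℝ) (V : ℝ → ℝ) (ε : ℝ) (ψ₀ : ℝ → ℂ) (N : ℕ) (τ : ℝ) : ℕ → Fin (N + 1) → ℂ
  | 0 => fun j => ψ₀ (gridPoint a b N j)
  | n + 1 => halfFreeStep a b N τ
      (potentialStep a b V ε N τ (halfFreeStep a b N τ (tsfp a b V ε ψ₀ N τ n)))

/-- The error function `ψ(·, t_n) - I_N ψ^n`. -/
def tsfpError (a b : ℝ) (V : ℝ → ℝ) (ε : ℝ) (ψ₀ : ℝ → ℂ) (ψ : ℝ → ℝ → ℂ) (N : ℕ) (τ : ℝ)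
    (n : ℕ) : ℝ → ℂ :=
  fun x => ψ (n * τ) x - trigInterp a b N (tsfp a b V ε ψ₀ N τ n) x

/-- The small-step condition `0 < τ < α · 2π τ₀² / (μ₁² (1 + τ₀)²)`. -/
def SmallStep (a b α τ₀ τ : ℝ) : Prop :=
  0 < τ ∧ τ < α * (2 * Real.pi / (freq a b 1 ^ 2 * (1 + τ₀) ^ 2)) * τ₀ ^ 2

/-- The constant `λ = α π μ₁^{2+2ν} / (4 ∑_{k ≥ 1} k^{-(1+ν)})`. -/
def diophantineConst (a b α ν : ℝ) : ℝ :=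
  α * Real.pi * freq a b 1 ^ (2 + 2 * ν) / (4 * ∑' k : ℕ, 1 / ((k : ℝ) + 1) ^ (1 + ν))

/-- The Diophantine step condition: `τ > 0` and `|τ - 2lπ/(μ₁² K)| ≥ λ / |μ₁² K|^{2+ν}` for all
integers `l ≥ 0` and `K` with `0 < |K| ≤ ⌈1/τ₀⌉²`. -/
def DiophantineStep (a b α ν τ₀ τ : ℝ) : Prop :=
  0 < τ ∧ ∀ K l : ℤ, 0 < |K| → |K| ≤ ⌈1 / τ₀⌉ ^ 2 → 0 ≤ l →
    diophantineConst a b α ν / |freq a b 1 ^ 2 * (K : ℝ)| ^ (2 + ν) ≤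
      |τ - 2 * l * Real.pi / (freq a b 1 ^ 2 * (K : ℝ))|

end

/-! Pass to Fourier coefficients and undo the free flow: `φ_l(t) = exp(i t μ_l²) ψ̂_l(t)` solves `φ'
= -iε A(t) φ`, where `A(t)` is multiplication by `V` conjugated with the free flow (`twist`). Hence
`φ` varies slowly, with increments of size `ε` times the elapsed time (`InteractionFlow.increment`).
In the same variables a step of the scheme is multiplication by `exp(-iετV)`, conjugated at the
midpoint time and followed by aliasing (`discreteInteraction_succ`).

Expanding the flow over one step leaves, besides a remainder `O(ε²τ³)`, the midpoint quadrature
error `-iε ∫ (A(r) - A(mid)) φ(p) dr` (`InteractionFlow.local_error`). Over at most `T/(ετ)` steps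
the remainders add up to `O(ετ²)`, but quadrature errors estimated one at a time would not gain the
factor `ε`. That factor comes from cancellation between steps: the `(l,k)` entry of the error at
time `iτ` carries `z^i` with `z = exp(iτ(μ_l² - μ_k²))`, so summation by parts against the slow
sequence `φ(iτ)` bounds the whole sum by endpoint values plus total variation, both `O(1)`, over `|z
- 1|` (`norm_geom_sum_mul_le`, `HBound.low_sum`).

With `x = τ(μ_l² - μ_k²)/2`, the single quadrature error over `|z - 1|` has modulus `|sin x - x| /
(|μ_l² - μ_k²| |sin x|)`. For frequencies up to `1/τ₀` the step conditions bound it by `τ²` times a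
power of the Sobolev weights (`midPhase_kernel`): (S) keeps `|x|` below `απ`, while (D) keeps `x`
away from all multiples of `π` at the price of more derivatives. Frequencies beyond the cut-off
contribute `τ₀^(m-1)` by regularity alone (`HBound.tail`).

In space, sampling is aliasing, which is bounded on `H¹` uniformly in `N` and differs from
truncation by `O(h^(m-1))` (`HBound.aliasOp_bound`, `HBound.aliasOp_sub_modeProj`). A discrete
Gronwall argument with growth `1 + O(ετ)` per step joins everything
(`InteractionFlow.scheme_error`). For smooth solutions the same bound is used at a high Sobolev
index.

Norm bounds are phrased through `L2Bound`, that is, through finite partial sums, so a bound never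
relies on the default value of a divergent sum. -/

noncomputable section

/-! ### Square-summable families with explicit bounds -/

/-- `f` has `ℓ²` norm at most `B`. -/
def L2Bound {ι : Type*} (f : ι → ℝ) (B : ℝ) : Prop :=
  0 ≤ B ∧ ∀ F : Finset ι, ∑ l ∈ F, f l ^ 2 ≤ B ^ 2

namespace L2Bound

variable {ι : Type*} {f g : ι → ℝ} {A B : ℝ}

theorem of_abs_le (hg : L2Bound g B) (h : ∀ l, |f l| ≤ g l) : L2Bound f B :=
  ⟨hg.1, fun F => (Finset.sum_le_sum fun l _ => by
    rw [← sq_abs]; exact pow_le_pow_left₀ (abs_nonneg _) (h l) 2).trans (hg.2 F)⟩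

theorem mono (hg : L2Bound g B) (h0 : ∀ l, 0 ≤ f l) (h : ∀ l, f l ≤ g l) : L2Bound f B :=
  hg.of_abs_le fun l => by rw [abs_of_nonneg (h0 l)]; exact h l

theorem weaken (hf : L2Bound f A) (h : A ≤ B) : L2Bound f B :=
  ⟨hf.1.trans h, fun F => (hf.2 F).trans (pow_le_pow_left₀ hf.1 h 2)⟩

theorem zero : L2Bound (fun _ : ι => (0 : ℝ)) 0 := ⟨le_rfl, fun F => by simp⟩

theorem const_mul (hf : L2Bound f B) {c : ℝ} (hc : 0 ≤ c) : L2Bound (fun l => c * f l) (c * B) :=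
  ⟨mul_nonneg hc hf.1, fun F => by
    simp only [mul_pow]; rw [← Finset.mul_sum]
    exact mul_le_mul_of_nonneg_left (hf.2 F) (sq_nonneg c)⟩

theorem add (hf : L2Bound f A) (hg : L2Bound g B) : L2Bound (fun l => f l + g l) (A + B) := by
  refine ⟨add_nonneg hf.1 hg.1, fun F => ?_⟩
  have h1 := hf.2 F
  have h2 := hg.2 F
  have h3 := Finset.sum_mul_sq_le_sq_mul_sq F f g
  have h4 : ∑ l ∈ F, f l * g l ≤ A * B := by
    refine le_of_sq_le_sq ?_ (mul_nonneg hf.1 hg.1)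
    refine h3.trans ?_
    rw [mul_pow]
    exact mul_le_mul h1 h2 (Finset.sum_nonneg fun _ _ => sq_nonneg _) (sq_nonneg _)
  have : ∑ l ∈ F, (f l + g l) ^ 2
      = ∑ l ∈ F, f l ^ 2 + 2 * ∑ l ∈ F, f l * g l + ∑ l ∈ F, g l ^ 2 := by
    rw [Finset.mul_sum, ← Finset.sum_add_distrib, ← Finset.sum_add_distrib]
    exact Finset.sum_congr rfl fun _ _ => by ring
  rw [this]; nlinarith

theorem finset_sum {κ : Type*} (s : Finset κ) {f : κ → ι → ℝ} {B : κ → ℝ}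
    (h : ∀ i ∈ s, L2Bound (f i) (B i)) :
    L2Bound (fun l => ∑ i ∈ s, f i l) (∑ i ∈ s, B i) := by
  classical
  induction s using Finset.induction_on with
  | empty => simpa using zero
  | insert i s hi ih =>
    simp only [Finset.sum_insert hi]
    exact (h i (Finset.mem_insert_self _ _)).add
      (ih fun j hj => h j (Finset.mem_insert_of_mem hj))

theorem abs_le (hf : L2Bound f B) (l : ι) : |f l| ≤ B := by
  have := hf.2 {l}
  rw [Finset.sum_singleton] at this
  exact abs_le_of_sq_le_sq this hf.1

theorem of_tendsto {κ : Type*} {l' : Filter κ} [l'.NeBot] {f : κ → ι → ℝ} {g : ι → ℝ}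
    (h : ∀ i, L2Bound (f i) B) (hl : ∀ l, Filter.Tendsto (fun i => f i l) l' (nhds (g l))) :
    L2Bound g B := by
  obtain ⟨i⟩ := l'.nonempty_of_neBot
  refine ⟨(h i).1, fun F => ?_⟩
  exact le_of_tendsto (tendsto_finsetSum F fun l _ => (hl l).pow 2)
    (Filter.Eventually.of_forall fun i => (h i).2 F)

/-- A family of nonnegative double sums is controlled by its finite truncations. -/
theorem tsum {κ : Type*} {f : ι → κ → ℝ} (h0 : ∀ l k, 0 ≤ f l k)
    (h : ∀ G : Finset κ, L2Bound (fun l => ∑ k ∈ G, f l k) B) :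
    (∀ l, Summable (f l)) ∧ L2Bound (fun l => ∑' k, f l k) B := by
  have hs : ∀ l, Summable (f l) := fun l =>
    summable_of_sum_le (c := B) (h0 l) fun G => (le_abs_self _).trans ((h G).abs_le l)
  exact ⟨hs, of_tendsto h fun l => (hs l).hasSum⟩

end L2Bound

/-! ### Weights and Sobolev bounds for sequences -/

/-- The weight `(1 + (κ l)²)^{1/2}`. -/
def wt (κ : ℝ) (l : ℤ) : ℝ := Real.sqrt (1 + (κ * l) ^ 2)

theorem one_le_wt (κ : ℝ) (l : ℤ) : 1 ≤ wt κ l := by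
  unfold wt; rw [Real.one_le_sqrt]; nlinarith [sq_nonneg (κ * l)]

theorem wt_pos (κ : ℝ) (l : ℤ) : 0 < wt κ l := one_pos.trans_le (one_le_wt κ l)

theorem wt_sq (κ : ℝ) (l : ℤ) : wt κ l ^ 2 = 1 + (κ * l) ^ 2 := Real.sq_sqrt (by positivity)

theorem abs_le_wt (κ : ℝ) (l : ℤ) : |κ * l| ≤ wt κ l := by
  unfold wt; exact Real.abs_le_sqrt (by linarith)

theorem wt_add_le (κ : ℝ) (l k : ℤ) : wt κ (l + k) ≤ wt κ l + wt κ k := by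
  refine le_of_sq_le_sq ?_ (add_pos (wt_pos κ l) (wt_pos κ k)).le
  have h1 := wt_sq κ l
  have h2 := wt_sq κ k
  have h3 : κ * l * (κ * k) ≤ wt κ l * wt κ k := by
    refine (le_abs_self _).trans ?_
    rw [abs_mul]
    exact mul_le_mul (abs_le_wt _ _) (abs_le_wt _ _) (abs_nonneg _) (wt_pos _ _).le
  rw [wt_sq]; push_cast; nlinarith

theorem wt_le_sub_add (κ : ℝ) (l k : ℤ) : wt κ l ≤ wt κ (l - k) + wt κ k := by
  simpa using wt_add_le κ (l - k) k

theorem summable_inv_wt_sq {κ : ℝ} (hκ : 0 < κ) : Summable fun l : ℤ => (wt κ l ^ 2)⁻¹ := by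
  have h1 : Summable fun l : ℤ => (κ ^ 2)⁻¹ * (1 / (l : ℝ) ^ 2) :=
    (Real.summable_one_div_int_pow.2 one_lt_two).mul_left _
  refine Summable.of_norm_bounded_eventually h1 ?_
  have : ∀ᶠ l : ℤ in Filter.cofinite, l ≠ 0 := by
    simpa using (Set.finite_singleton (0 : ℤ)).compl_mem_cofinite
  filter_upwards [this] with l hl
  have hl' : (l : ℝ) ≠ 0 := by exact_mod_cast hl
  have h2 : 0 < κ ^ 2 * (l : ℝ) ^ 2 := by positivity
  rw [Real.norm_of_nonneg (by positivity), one_div, ← mul_inv, wt_sq]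
  exact inv_anti₀ h2 (by nlinarith)

/-- The embedding constant of `H¹` into `ℓ¹`. -/
def embConst (κ : ℝ) : ℝ := Real.sqrt (∑' l : ℤ, (wt κ l ^ 2)⁻¹)

theorem embConst_nonneg (κ : ℝ) : 0 ≤ embConst κ := Real.sqrt_nonneg _

/-- `u` has `H^s` norm at most `B`. -/
def HBound (κ : ℝ) (s : ℕ) (u : ℤ → ℂ) (B : ℝ) : Prop :=
  L2Bound (fun l => wt κ l ^ s * ‖u l‖) B

/-- Cauchy-Schwarz against the square-summable inverse weights: the embedding of `H¹` into `ℓ¹`,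
hence into bounded functions. -/
theorem L2Bound.sum_le {κ : ℝ} (hκ : 0 < κ) {f : ℤ → ℝ} {B : ℝ}
    (hf : L2Bound (fun l => wt κ l * f l) B) (F : Finset ℤ) :
    ∑ l ∈ F, f l ≤ embConst κ * B := by
  refine le_of_sq_le_sq ?_ (mul_nonneg (embConst_nonneg _) hf.1)
  have h := Finset.sum_mul_sq_le_sq_mul_sq F (fun l => (wt κ l)⁻¹) (fun l => wt κ l * f l)
  have h1 : ∀ l ∈ F, (wt κ l)⁻¹ * (wt κ l * f l) = f l := fun l _ =>
    inv_mul_cancel_left₀ (wt_pos κ l).ne' _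
  rw [Finset.sum_congr rfl h1] at h
  refine h.trans ?_
  rw [mul_pow]
  refine mul_le_mul ?_ (hf.2 F) (Finset.sum_nonneg fun _ _ => sq_nonneg _) (sq_nonneg _)
  rw [embConst, Real.sq_sqrt (tsum_nonneg fun l => by positivity)]
  simp only [inv_pow]
  exact (summable_inv_wt_sq hκ).sum_le_tsum F fun l _ => by positivity

namespace HBound

variable {κ : ℝ} {s : ℕ} {u v : ℤ → ℂ} {A B : ℝ}

theorem nonneg (h : HBound κ s u B) : 0 ≤ B := h.1

theorem of_norm_le (hv : HBound κ s v B) (h : ∀ l, ‖u l‖ ≤ ‖v l‖) : HBound κ s u B :=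
  L2Bound.mono hv (fun l => mul_nonneg (pow_nonneg (wt_pos κ l).le _) (norm_nonneg _))
    fun l => mul_le_mul_of_nonneg_left (h l) (pow_nonneg (wt_pos κ l).le _)

theorem of_le {f : ℤ → ℝ} (hf : L2Bound f B) (h : ∀ l, wt κ l ^ s * ‖u l‖ ≤ f l) :
    HBound κ s u B :=
  L2Bound.mono hf (fun l => mul_nonneg (pow_nonneg (wt_pos κ l).le _) (norm_nonneg _)) h

theorem weaken (h : HBound κ s u A) (hAB : A ≤ B) : HBound κ s u B := L2Bound.weaken h hAB

theorem mono_index {t : ℕ} (h : HBound κ s u B) (hts : t ≤ s) : HBound κ t u B :=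
  of_le h fun l =>
    mul_le_mul_of_nonneg_right (pow_le_pow_right₀ (one_le_wt κ l) hts) (norm_nonneg _)

theorem add (hu : HBound κ s u A) (hv : HBound κ s v B) : HBound κ s (fun l => u l + v l) (A + B) :=
  of_le (L2Bound.add hu hv) fun l => by
    rw [← mul_add]
    exact mul_le_mul_of_nonneg_left (norm_add_le _ _) (pow_nonneg (wt_pos κ l).le _)

theorem const_mul (hu : HBound κ s u A) (c : ℂ) : HBound κ s (fun l => c * u l) (‖c‖ * A) :=
  of_le (L2Bound.const_mul hu (norm_nonneg c)) fun l => by rw [norm_mul]; exact le_of_eq (by ring)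

theorem sub (hu : HBound κ s u A) (hv : HBound κ s v B) : HBound κ s (fun l => u l - v l) (A + B) :=
  of_le (L2Bound.add hu hv) fun l => by
    rw [← mul_add]
    exact mul_le_mul_of_nonneg_left (norm_sub_le _ _) (pow_nonneg (wt_pos κ l).le _)

theorem finset_sum {ι : Type*} (S : Finset ι) {u : ι → ℤ → ℂ} {B : ι → ℝ}
    (h : ∀ i ∈ S, HBound κ s (u i) (B i)) :
    HBound κ s (fun l => ∑ i ∈ S, u i l) (∑ i ∈ S, B i) :=
  of_le (L2Bound.finset_sum S h) fun l => by
    rw [← Finset.mul_sum]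
    exact mul_le_mul_of_nonneg_left (norm_sum_le _ _) (pow_nonneg (wt_pos κ l).le _)

theorem finset_sum_norm {ι : Type*} (S : Finset ι) {u : ι → ℤ → ℂ} {B : ι → ℝ}
    (h : ∀ i ∈ S, HBound κ s (u i) (B i)) :
    L2Bound (fun l => wt κ l ^ s * ∑ i ∈ S, ‖u i l‖) (∑ i ∈ S, B i) := by
  simp only [Finset.mul_sum]
  exact L2Bound.finset_sum S h

theorem norm_le (h : HBound κ s u B) (l : ℤ) : ‖u l‖ ≤ B := by
  have h1 := (le_abs_self _).trans (L2Bound.abs_le h l)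
  refine le_trans ?_ h1
  exact le_mul_of_one_le_left (norm_nonneg _) (one_le_pow₀ (one_le_wt κ l))

theorem summable (hκ : 0 < κ) (hs : 1 ≤ s) (h : HBound κ s u B) : Summable fun l => ‖u l‖ := by
  have h1 : HBound κ 1 u B := h.mono_index hs
  simp only [HBound, pow_one] at h1
  exact summable_of_sum_le (fun _ => norm_nonneg _) (L2Bound.sum_le hκ h1)

theorem tsum_norm_le (hκ : 0 < κ) (hs : 1 ≤ s) (h : HBound κ s u B) :
    ∑' l, ‖u l‖ ≤ embConst κ * B := by
  have h1 : HBound κ 1 u B := h.mono_index hs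
  simp only [HBound, pow_one] at h1
  exact Real.tsum_le_of_sum_le (fun _ => norm_nonneg _) (L2Bound.sum_le hκ h1)

theorem of_tendsto {ι : Type*} {l' : Filter ι} [l'.NeBot] {f : ι → ℤ → ℂ}
    (h : ∀ i, HBound κ s (f i) B) (hl : ∀ l, Filter.Tendsto (fun i => f i l) l' (nhds (u l))) :
    HBound κ s u B :=
  L2Bound.of_tendsto h fun l => ((hl l).norm).const_mul _

/-- Minkowski's inequality for interval integrals. -/
theorem intervalIntegral {f : ℝ → ℤ → ℂ} {p q : ℝ} (hpq : p ≤ q)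
    (hc : ∀ l, ContinuousOn (fun r => f r l) (Icc p q))
    (h : ∀ r ∈ Icc p q, HBound κ s (f r) B) :
    HBound κ s (fun l => ∫ r in p..q, f r l) ((q - p) * B) := by
  have hB : 0 ≤ B := (h p (left_mem_Icc.2 hpq)).1
  refine ⟨mul_nonneg (sub_nonneg.2 hpq) hB, fun F => ?_⟩
  -- For a finite set of frequencies the weighted `ℓ²` norm is a Euclidean norm, so Minkowski
  -- reduces to the norm inequality for a vector-valued integral.
  let v : ℝ → EuclideanSpace ℂ F :=
    fun r => WithLp.toLp 2 fun l : F => ((wt κ l ^ s : ℝ) : ℂ) * f r l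
  have hv : ∀ r ∈ Icc p q, ‖v r‖ ≤ B := by
    intro r hr
    rw [EuclideanSpace.norm_eq]
    refine Real.sqrt_le_iff.2 ⟨hB, ?_⟩
    have := (h r hr).2 F
    rw [← Finset.sum_coe_sort] at this
    refine le_trans (le_of_eq (Finset.sum_congr rfl fun l _ => ?_)) this
    simp only [v, norm_mul, Complex.norm_real]
    rw [Real.norm_of_nonneg (pow_nonneg (wt_pos κ l).le _)]
  have hvc : ContinuousOn v (Icc p q) := by
    refine (PiLp.continuous_toLp 2 _).comp_continuousOn (continuousOn_pi.2 fun l => ?_)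
    exact continuousOn_const.mul (hc l)
  have hvi : IntervalIntegrable v volume p q := by
    apply ContinuousOn.intervalIntegrable
    rwa [uIcc_of_le hpq]
  have h1 : ‖∫ r in p..q, v r‖ ≤ B * |q - p| :=
    intervalIntegral.norm_integral_le_of_norm_le_const fun r hr => by
      rw [uIoc_of_le hpq] at hr
      exact hv r (Ioc_subset_Icc_self hr)
  have h2 : ∀ l : F, (∫ r in p..q, v r) l = ((wt κ l ^ s : ℝ) : ℂ) * ∫ r in p..q, f r l := by
    intro l
    have := (EuclideanSpace.proj (𝕜 := ℂ) l).intervalIntegral_comp_comm hvi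
    rw [← intervalIntegral.integral_const_mul]
    exact this.symm
  rw [abs_of_nonneg (sub_nonneg.2 hpq), mul_comm] at h1
  rw [EuclideanSpace.norm_eq] at h1
  have h3 := (Real.sqrt_le_left (mul_nonneg (sub_nonneg.2 hpq) hB)).1 h1
  rw [← Finset.sum_coe_sort]
  refine le_trans (le_of_eq (Finset.sum_congr rfl fun l _ => ?_)) h3
  rw [h2, norm_mul, Complex.norm_real, Real.norm_of_nonneg (pow_nonneg (wt_pos κ l).le _)]

end HBound

/-! ### Convolution estimates -/

/-- Young's inequality for `ℓ² * ℓ¹`: Cauchy-Schwarz with `u k` split as `√(u k) · √(u k)`, then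
translation invariance of the `ℓ²` sum. Truncating to a finite `G` avoids summability questions. -/
theorem L2Bound.young_left {a u : ℤ → ℝ} {A U : ℝ} (hU : 0 ≤ U)
    (hu0 : ∀ k, 0 ≤ u k) (ha : L2Bound a A) (hu : ∀ G : Finset ℤ, ∑ k ∈ G, u k ≤ U)
    (G : Finset ℤ) : L2Bound (fun l => ∑ k ∈ G, a (l - k) * u k) (A * U) := by
  refine ⟨mul_nonneg ha.1 hU, fun F => ?_⟩
  have h1 : ∀ l, (∑ k ∈ G, a (l - k) * u k) ^ 2 ≤ U * ∑ k ∈ G, a (l - k) ^ 2 * u k := by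
    intro l
    have := Finset.sum_mul_sq_le_sq_mul_sq G (fun k => Real.sqrt (u k))
      (fun k => a (l - k) * Real.sqrt (u k))
    simp only [mul_pow, Real.sq_sqrt (hu0 _)] at this
    have h2 : ∀ k ∈ G, Real.sqrt (u k) * (a (l - k) * Real.sqrt (u k)) = a (l - k) * u k :=
      fun k _ => by
        rw [mul_left_comm, Real.mul_self_sqrt (hu0 k)]
    rw [Finset.sum_congr rfl h2] at this
    exact this.trans (mul_le_mul_of_nonneg_right (hu G)
      (Finset.sum_nonneg fun k _ => mul_nonneg (sq_nonneg _) (hu0 k)))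
  calc ∑ l ∈ F, (∑ k ∈ G, a (l - k) * u k) ^ 2
      ≤ ∑ l ∈ F, U * ∑ k ∈ G, a (l - k) ^ 2 * u k := Finset.sum_le_sum fun l _ => h1 l
    _ = U * ∑ k ∈ G, (∑ l ∈ F, a (l - k) ^ 2) * u k := by
        rw [← Finset.mul_sum, Finset.sum_comm]; simp only [Finset.sum_mul]
    _ ≤ U * ∑ k ∈ G, A ^ 2 * u k := by
        refine mul_le_mul_of_nonneg_left (Finset.sum_le_sum fun k _ =>
          mul_le_mul_of_nonneg_right ?_ (hu0 k)) hU
        have := ha.2 (F.map (Equiv.subRight k).toEmbedding)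
        simpa using this
    _ ≤ U * (A ^ 2 * U) := by
        rw [← Finset.mul_sum]
        exact mul_le_mul_of_nonneg_left (mul_le_mul_of_nonneg_left (hu G) (sq_nonneg _)) hU
    _ = (A * U) ^ 2 := by ring

theorem L2Bound.young_right {a u : ℤ → ℝ} {A U : ℝ} (hA : 0 ≤ A)
    (ha0 : ∀ k, 0 ≤ a k) (hu : L2Bound u U) (ha : ∀ G : Finset ℤ, ∑ k ∈ G, a k ≤ A)
    (G : Finset ℤ) : L2Bound (fun l => ∑ k ∈ G, a (l - k) * u k) (A * U) := by
  refine ⟨mul_nonneg hA hu.1, fun F => ?_⟩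
  have ha1 : ∀ l : ℤ, ∑ k ∈ G, a (l - k) ≤ A := fun l => by
    have := ha (G.map (Equiv.subLeft l).toEmbedding)
    simpa using this
  have h1 : ∀ l, (∑ k ∈ G, a (l - k) * u k) ^ 2 ≤ A * ∑ k ∈ G, a (l - k) * u k ^ 2 := by
    intro l
    have := Finset.sum_mul_sq_le_sq_mul_sq G (fun k => Real.sqrt (a (l - k)))
      (fun k => Real.sqrt (a (l - k)) * u k)
    simp only [mul_pow, Real.sq_sqrt (ha0 _)] at this
    have h2 : ∀ k ∈ G, Real.sqrt (a (l - k)) * (Real.sqrt (a (l - k)) * u k) = a (l - k) * u k :=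
      fun k _ => by
        rw [← mul_assoc, Real.mul_self_sqrt (ha0 _)]
    rw [Finset.sum_congr rfl h2] at this
    exact this.trans (mul_le_mul_of_nonneg_right (ha1 l)
      (Finset.sum_nonneg fun k _ => mul_nonneg (ha0 _) (sq_nonneg _)))
  calc ∑ l ∈ F, (∑ k ∈ G, a (l - k) * u k) ^ 2
      ≤ ∑ l ∈ F, A * ∑ k ∈ G, a (l - k) * u k ^ 2 := Finset.sum_le_sum fun l _ => h1 l
    _ = A * ∑ k ∈ G, (∑ l ∈ F, a (l - k)) * u k ^ 2 := by
        rw [← Finset.mul_sum, Finset.sum_comm]; simp only [Finset.sum_mul]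
    _ ≤ A * ∑ k ∈ G, A * u k ^ 2 := by
        refine mul_le_mul_of_nonneg_left (Finset.sum_le_sum fun k _ =>
          mul_le_mul_of_nonneg_right ?_ (sq_nonneg _)) hA
        have := ha (F.map (Equiv.subRight k).toEmbedding)
        simpa using this
    _ ≤ A * (A * U ^ 2) := by
        rw [← Finset.mul_sum]
        exact mul_le_mul_of_nonneg_left (mul_le_mul_of_nonneg_left (hu.2 G) hA) hA
    _ = (A * U) ^ 2 := by ring

/-- The constant of the tame product estimate in `H^s`. -/
def convConst (κ : ℝ) (s : ℕ) : ℝ := 2 ^ s * (2 * embConst κ)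

theorem convConst_nonneg (κ : ℝ) (s : ℕ) : 0 ≤ convConst κ s :=
  mul_nonneg (by positivity) (mul_nonneg zero_le_two (embConst_nonneg κ))

theorem add_pow_le_two_pow_mul {x y : ℝ} (hx : 0 ≤ x) (hy : 0 ≤ y) (s : ℕ) :
    (x + y) ^ s ≤ 2 ^ s * (x ^ s + y ^ s) := by
  have h1 : x + y ≤ 2 * max x y := by linarith [le_max_left x y, le_max_right x y]
  refine (pow_le_pow_left₀ (add_nonneg hx hy) h1 s).trans ?_
  rw [mul_pow]
  refine mul_le_mul_of_nonneg_left ?_ (by positivity)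
  rcases max_choice x y with h | h <;> rw [h]
  · linarith [pow_nonneg hy s]
  · linarith [pow_nonneg hx s]

/-- The tame convolution estimate. -/
theorem L2Bound.conv {κ : ℝ} (hκ : 0 < κ) {s : ℕ} (hs : 1 ≤ s) {v u : ℤ → ℝ} {A B : ℝ}
    (hv0 : ∀ k, 0 ≤ v k) (hu0 : ∀ k, 0 ≤ u k)
    (hv : L2Bound (fun l => wt κ l ^ s * v l) A) (hu : L2Bound (fun l => wt κ l ^ s * u l) B) :
    (∀ l, Summable fun k => (wt κ (l - k) + wt κ k) ^ s * (v (l - k) * u k)) ∧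
    L2Bound (fun l => ∑' k, (wt κ (l - k) + wt κ k) ^ s * (v (l - k) * u k))
      (convConst κ s * (A * B)) := by
  have hw : ∀ l, 0 ≤ wt κ l := fun l => (wt_pos κ l).le
  have hone : ∀ {f : ℤ → ℝ} {D : ℝ}, (∀ k, 0 ≤ f k) → L2Bound (fun l => wt κ l ^ s * f l) D →
      L2Bound (fun l => wt κ l * f l) D := fun {f D} hf h => h.mono
    (fun l => mul_nonneg (hw l) (hf l)) fun l =>
      mul_le_mul_of_nonneg_right (le_self_pow₀ (one_le_wt κ l) (by omega)) (hf l)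
  have hv1 := (hone hv0 hv).sum_le hκ
  have hu1 := (hone hu0 hu).sum_le hκ
  have hE := embConst_nonneg κ
  refine L2Bound.tsum (fun l k => mul_nonneg (pow_nonneg (add_nonneg (hw _) (hw _)) _)
    (mul_nonneg (hv0 _) (hu0 _))) fun G => ?_
  -- After the weight is split between the two factors, the one carrying all the weight lies in `ℓ²`
  -- and the other in `ℓ¹`.
  have h1 := L2Bound.young_left (mul_nonneg hE hu.1) hu0 hv hu1 G
  have h2 := L2Bound.young_right (mul_nonneg hE hv.1) hv0 hu hv1 G
  have h3 := (h1.add h2).const_mul (c := 2 ^ s) (by positivity)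
  refine (h3.weaken (le_of_eq ?_)).mono (fun l => Finset.sum_nonneg fun k _ =>
    mul_nonneg (pow_nonneg (add_nonneg (hw _) (hw _)) _) (mul_nonneg (hv0 _) (hu0 _))) fun l => ?_
  · unfold convConst; ring
  · rw [← Finset.sum_add_distrib, Finset.mul_sum]
    refine Finset.sum_le_sum fun k _ => ?_
    refine (mul_le_mul_of_nonneg_right (add_pow_le_two_pow_mul (hw _) (hw _) s)
      (mul_nonneg (hv0 _) (hu0 _))).trans (le_of_eq (by ring))

/-- A kernel operator dominated by a tame convolution. -/
theorem HBound.kernel {κ : ℝ} (hκ : 0 < κ) {s : ℕ} (hs : 1 ≤ s) {r : ℕ} {v u : ℤ → ℂ} {A B c : ℝ}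
    (hc : 0 ≤ c) (hv : HBound κ s v A) (hu : HBound κ s u B) {K : ℤ → ℤ → ℂ}
    (hK : ∀ l k, wt κ l ^ r * ‖K l k‖ ≤ c * (wt κ (l - k) + wt κ k) ^ s) :
    (∀ l, Summable fun k => ‖K l k * (v (l - k) * u k)‖) ∧
    HBound κ r (fun l => ∑' k, K l k * (v (l - k) * u k)) (c * (convConst κ s * (A * B))) := by
  obtain ⟨h1, h2⟩ := L2Bound.conv hκ hs (fun _ => norm_nonneg _) (fun _ => norm_nonneg _) hv hu
  have hle : ∀ l k, wt κ l ^ r * ‖K l k * (v (l - k) * u k)‖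
      ≤ c * ((wt κ (l - k) + wt κ k) ^ s * (‖v (l - k)‖ * ‖u k‖)) := fun l k => by
    rw [norm_mul, norm_mul, ← mul_assoc, ← mul_assoc c]
    exact mul_le_mul_of_nonneg_right (hK l k) (mul_nonneg (norm_nonneg _) (norm_nonneg _))
  have hs' : ∀ l, Summable fun k => ‖K l k * (v (l - k) * u k)‖ := fun l => by
    refine Summable.of_nonneg_of_le (fun _ => norm_nonneg _) (fun k => ?_) ((h1 l).mul_left c)
    exact (le_mul_of_one_le_left (norm_nonneg _) (one_le_pow₀ (one_le_wt κ l))).trans (hle l k)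
  refine ⟨hs', HBound.of_le (h2.const_mul hc) fun l => ?_⟩
  calc wt κ l ^ r * ‖∑' k, K l k * (v (l - k) * u k)‖
      ≤ wt κ l ^ r * ∑' k, ‖K l k * (v (l - k) * u k)‖ :=
        mul_le_mul_of_nonneg_left (norm_tsum_le_tsum_norm (hs' l)) (pow_nonneg (wt_pos κ l).le _)
    _ = ∑' k, wt κ l ^ r * ‖K l k * (v (l - k) * u k)‖ := tsum_mul_left.symm
    _ ≤ ∑' k, c * ((wt κ (l - k) + wt κ k) ^ s * (‖v (l - k)‖ * ‖u k‖)) :=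
        ((hs' l).mul_left _).tsum_le_tsum (hle l) ((h1 l).mul_left c)
    _ = _ := tsum_mul_left

/-! ### Convolution of summable sequences -/

/-- Convolution of sequences on `ℤ`. -/
def seqConv (v u : ℤ → ℂ) (l : ℤ) : ℂ := ∑' k, v (l - k) * u k

theorem HBound.conv {κ : ℝ} (hκ : 0 < κ) {s : ℕ} (hs : 1 ≤ s) {v u : ℤ → ℂ} {A B : ℝ}
    (hv : HBound κ s v A) (hu : HBound κ s u B) :
    HBound κ s (seqConv v u) (convConst κ s * (A * B)) := by
  have h := (HBound.kernel hκ hs (r := s) zero_le_one hv hu (K := fun _ _ => 1) fun l k => by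
    rw [norm_one, mul_one, one_mul]
    exact pow_le_pow_left₀ (wt_pos κ l).le (wt_le_sub_add κ l k) s).2
  simp only [one_mul] at h
  exact h

theorem summable_prod_conv {v u : ℤ → ℂ} (hv : Summable fun l => ‖v l‖)
    (hu : Summable fun l => ‖u l‖) {G : ℤ → ℂ} {C : ℝ} (hG : ∀ l, ‖G l‖ ≤ C) :
    Summable fun p : ℤ × ℤ => G p.1 * (v (p.1 - p.2) * u p.2) := by
  have h1 : Summable fun p : ℤ × ℤ => v p.1 * u p.2 := summable_mul_of_summable_norm hv hu
  let e : ℤ × ℤ ≃ ℤ × ℤ :=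
    ⟨fun p => (p.1 - p.2, p.2), fun p => (p.1 + p.2, p.2), fun p => by simp, fun p => by simp⟩
  have h2 : Summable fun p : ℤ × ℤ => v (p.1 - p.2) * u p.2 := (e.summable_iff).2 h1
  refine Summable.of_norm_bounded (h2.norm.mul_left C) fun p => ?_
  rw [norm_mul]
  exact mul_le_mul_of_nonneg_right (hG _) (norm_nonneg _)

theorem summable_mul_seqConv {v u : ℤ → ℂ} (hv : Summable fun l => ‖v l‖)
    (hu : Summable fun l => ‖u l‖) {G : ℤ → ℂ} {C : ℝ} (hG : ∀ l, ‖G l‖ ≤ C) :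
    Summable fun p => G p * seqConv v u p := by
  have h := (summable_prod_conv hv hu hG).prod
  simpa only [seqConv, tsum_mul_left] using h

theorem tsum_mul_seqConv {v u : ℤ → ℂ} (hv : Summable fun l => ‖v l‖)
    (hu : Summable fun l => ‖u l‖) {G : ℤ → ℂ} {C : ℝ} (hG : ∀ l, ‖G l‖ ≤ C) :
    ∑' p, G p * seqConv v u p = ∑' k, (∑' j, G (j + k) * v j) * u k := by
  have h := summable_prod_conv hv hu hG
  calc ∑' p, G p * seqConv v u p = ∑' p, ∑' k, G p * (v (p - k) * u k) := by
        simp only [seqConv, tsum_mul_left]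
    _ = ∑' k, ∑' p, G p * (v (p - k) * u k) := (Summable.tsum_comm (f := fun p k => G p * (v (p - k) * u k)) h).symm
    _ = _ := tsum_congr fun k => by
        rw [← tsum_mul_right, ← (Equiv.addRight k).tsum_eq]
        exact tsum_congr fun j => by simp [mul_assoc]

theorem seqConv_assoc {κ : ℝ} (hκ : 0 < κ) {v v' u : ℤ → ℂ} {A A' B : ℝ}
    (hv : HBound κ 1 v A) (hv' : HBound κ 1 v' A') (hu : HBound κ 1 u B) :
    seqConv v (seqConv v' u) = seqConv (seqConv v v') u := by
  funext l
  have h := tsum_mul_seqConv (hv'.summable hκ le_rfl) (hu.summable hκ le_rfl)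
    (G := fun p => v (l - p)) fun p => hv.norm_le _
  unfold seqConv at h ⊢
  rw [h]
  refine tsum_congr fun k => ?_
  congr 1
  exact tsum_congr fun j => by rw [sub_add_eq_sub_sub, sub_right_comm]

/-- Evaluating at a character turns convolution into a product. -/
theorem tsum_character_seqConv {v u χ : ℤ → ℂ} (hv : Summable fun l => ‖v l‖)
    (hu : Summable fun l => ‖u l‖) (hχ : ∀ l, ‖χ l‖ ≤ 1) (hχm : ∀ j k, χ (j + k) = χ j * χ k) :
    ∑' p, χ p * seqConv v u p = (∑' j, χ j * v j) * ∑' k, χ k * u k := by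
  rw [tsum_mul_seqConv hv hu hχ, ← tsum_mul_left]
  refine tsum_congr fun k => ?_
  rw [← mul_assoc]
  congr 1
  rw [← tsum_mul_right]
  exact tsum_congr fun j => by rw [hχm]; ring

/-! ### Exponential series for convolution -/

/-- The convolution power `v^{*(n+1)}`. -/
def convPow (v : ℤ → ℂ) : ℕ → ℤ → ℂ
  | 0 => v
  | n + 1 => seqConv v (convPow v n)

/-- A bound for the growth rate of the convolution powers. -/
def powRate (κ : ℝ) (s : ℕ) (A : ℝ) : ℝ := (convConst κ s + 1) * A

theorem powRate_nonneg (κ : ℝ) (s : ℕ) {A : ℝ} (hA : 0 ≤ A) : 0 ≤ powRate κ s A :=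
  mul_nonneg (add_nonneg (convConst_nonneg κ s) zero_le_one) hA

theorem HBound.convPow_bound {κ : ℝ} (hκ : 0 < κ) {s : ℕ} (hs : 1 ≤ s) {v : ℤ → ℂ} {A : ℝ}
    (hv : HBound κ s v A) (n : ℕ) : HBound κ s (convPow v n) (powRate κ s A ^ (n + 1)) := by
  have hA := hv.nonneg
  have hK := convConst_nonneg κ s
  induction n with
  -- The `+ 1` in `powRate` makes the rate dominate both `A`, needed here, and `convConst κ s * A`,
  -- needed in the inductive step.
  | zero => exact hv.weaken (by rw [zero_add, pow_one]; unfold powRate; nlinarith)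
  | succ n ih =>
    refine (hv.conv hκ hs ih).weaken ?_
    rw [pow_succ _ (n + 1), ← mul_assoc, mul_comm]
    refine mul_le_mul_of_nonneg_left ?_ (pow_nonneg (powRate_nonneg κ s hA) _)
    unfold powRate; nlinarith

/-- The tail `∑_{n > J} z^n v^{*n} / n!` of the exponential series. -/
def expTail (v : ℤ → ℂ) (z : ℂ) (J : ℕ) (l : ℤ) : ℂ :=
  ∑' n : ℕ, z ^ (n + 1 + J) / ((n + 1 + J).factorial : ℂ) * convPow v (n + J) l

/-- Since `(n+1+J)! ≥ n!`, a factor of degree `J + 1` comes out of each term and an ordinary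
exponential series remains. With `‖z‖ = ετ` this yields size `ετ` for `J = 0` and `(ετ)³` for `J =
2`. -/
theorem HBound.expTail_term {κ : ℝ} (hκ : 0 < κ) {s : ℕ} (hs : 1 ≤ s) {v : ℤ → ℂ} {A : ℝ}
    (hv : HBound κ s v A) (z : ℂ) (J n : ℕ) :
    HBound κ s (fun l => z ^ (n + 1 + J) / ((n + 1 + J).factorial : ℂ) * convPow v (n + J) l)
      ((‖z‖ * powRate κ s A) ^ (J + 1) * ((‖z‖ * powRate κ s A) ^ n / (n.factorial : ℝ))) := by
  have hR := powRate_nonneg κ s hv.nonneg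
  refine ((hv.convPow_bound hκ hs (n + J)).const_mul _).weaken ?_
  rw [norm_div, norm_pow, Complex.norm_natCast]
  have h1 : ‖z‖ ^ (n + 1 + J) / ((n + 1 + J).factorial : ℝ) * powRate κ s A ^ (n + J + 1)
      = (‖z‖ * powRate κ s A) ^ (n + 1 + J) / ((n + 1 + J).factorial : ℝ) := by
    rw [mul_pow, show n + J + 1 = n + 1 + J by ring]; ring
  rw [h1, ← mul_div_assoc, ← pow_add, show J + 1 + n = n + 1 + J by ring]
  refine div_le_div_of_nonneg_left (by positivity) (by positivity) ?_
  exact_mod_cast Nat.factorial_le (by omega)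

theorem summable_expTail {κ : ℝ} (hκ : 0 < κ) {s : ℕ} (hs : 1 ≤ s) {v : ℤ → ℂ} {A : ℝ}
    (hv : HBound κ s v A) (z : ℂ) (J : ℕ) (l : ℤ) :
    Summable fun n : ℕ =>
      z ^ (n + 1 + J) / ((n + 1 + J).factorial : ℂ) * convPow v (n + J) l :=
  Summable.of_norm_bounded ((Real.summable_pow_div_factorial _).mul_left _)
    fun n => (hv.expTail_term hκ hs z J n).norm_le l

theorem HBound.expTail_bound {κ : ℝ} (hκ : 0 < κ) {s : ℕ} (hs : 1 ≤ s) {v : ℤ → ℂ} {A : ℝ}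
    (hv : HBound κ s v A) (z : ℂ) (J : ℕ) :
    HBound κ s (expTail v z J)
      ((‖z‖ * powRate κ s A) ^ (J + 1) * Real.exp (‖z‖ * powRate κ s A)) := by
  have hx : 0 ≤ ‖z‖ * powRate κ s A := mul_nonneg (norm_nonneg z) (powRate_nonneg κ s hv.nonneg)
  refine HBound.of_tendsto (l' := Filter.atTop) (fun N : ℕ =>
    (HBound.finset_sum (Finset.range N) fun n _ => hv.expTail_term hκ hs z J n).weaken ?_)
    fun l => (summable_expTail hκ hs hv z J l).hasSum.tendsto_sum_nat
  rw [← Finset.mul_sum]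
  exact mul_le_mul_of_nonneg_left (Real.sum_le_exp_of_nonneg hx N) (pow_nonneg hx _)

theorem expTail_eq {κ : ℝ} (hκ : 0 < κ) {v : ℤ → ℂ} {A : ℝ} (hv : HBound κ 1 v A) (z : ℂ) (l : ℤ) :
    expTail v z 0 l = z * v l + z ^ 2 / 2 * seqConv v v l + expTail v z 2 l := by
  have h := (summable_expTail hκ le_rfl hv z 0 l).sum_add_tsum_nat_add 2
  unfold expTail
  rw [← h]
  simp [Finset.sum_range_succ, convPow, add_assoc, add_comm, add_left_comm]

theorem tsum_character_convPow {κ : ℝ} (hκ : 0 < κ) {v χ : ℤ → ℂ} {A : ℝ} (hv : HBound κ 1 v A)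
    (hχ : ∀ l, ‖χ l‖ ≤ 1) (hχm : ∀ j k, χ (j + k) = χ j * χ k) (n : ℕ) :
    ∑' p, χ p * convPow v n p = (∑' p, χ p * v p) ^ (n + 1) := by
  induction n with
  | zero => simp [convPow]
  | succ n ih =>
    rw [convPow, tsum_character_seqConv (hv.summable hκ le_rfl)
      ((hv.convPow_bound hκ le_rfl n).summable hκ le_rfl) hχ hχm, ih, pow_succ' _ (n + 1)]

/-- Evaluation at a character is multiplicative on convolutions, so convolution powers become
powers. Taking for `χ` the Fourier modes at a point `x` identifies `expTail v z 0` as the Fourier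
sequence of `exp(zV) - 1`. -/
theorem tsum_character_expTail {κ : ℝ} (hκ : 0 < κ) {v χ : ℤ → ℂ} {A : ℝ} (hv : HBound κ 1 v A)
    (hχ : ∀ l, ‖χ l‖ ≤ 1) (hχm : ∀ j k, χ (j + k) = χ j * χ k) (z : ℂ) :
    1 + ∑' p, χ p * expTail v z 0 p = Complex.exp (z * ∑' p, χ p * v p) := by
  have hpow := tsum_character_convPow hκ hv hχ hχm
  generalize (∑' p, χ p * v p) = X at hpow ⊢
  set R := powRate κ 1 A
  have hR : 0 ≤ R := powRate_nonneg κ 1 hv.nonneg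
  have hterm : ∀ n : ℕ, ∀ F : Finset ℤ, ∑ p ∈ F,
      ‖χ p * (z ^ (n + 1 + 0) / ((n + 1 + 0).factorial : ℂ) * convPow v (n + 0) p)‖
      ≤ embConst κ * ((‖z‖ * R) ^ (0 + 1) * ((‖z‖ * R) ^ n / (n.factorial : ℝ))) := by
    intro n F
    have h := hv.expTail_term hκ le_rfl z 0 n
    simp only [HBound, pow_one] at h
    refine le_trans (Finset.sum_le_sum fun p _ => ?_) (L2Bound.sum_le hκ h F)
    rw [norm_mul]
    refine (mul_le_of_le_one_left (norm_nonneg _) (hχ p)).trans (le_of_eq ?_)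
    rfl
  have hs1 : ∀ n : ℕ, Summable fun p => 
      ‖χ p * (z ^ (n + 1 + 0) / ((n + 1 + 0).factorial : ℂ) * convPow v (n + 0) p)‖ := fun n =>
    summable_of_sum_le (fun _ => norm_nonneg _) (hterm n)
  have hs : Summable fun q : ℕ × ℤ => 
      χ q.2 * (z ^ (q.1 + 1 + 0) / ((q.1 + 1 + 0).factorial : ℂ) * convPow v (q.1 + 0) q.2) := by
    apply Summable.of_norm
    refine (summable_prod_of_nonneg fun _ => norm_nonneg _).2 ⟨hs1, ?_⟩
    refine Summable.of_nonneg_of_le (fun n => tsum_nonneg fun _ => norm_nonneg _)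
      (fun n => Real.tsum_le_of_sum_le (fun _ => norm_nonneg _) (hterm n)) ?_
    exact ((Real.summable_pow_div_factorial _).mul_left _).mul_left _
  have h1 : ∑' p, χ p * expTail v z 0 p
      = ∑' n : ℕ, (z * X) ^ (n + 1) / ((n + 1).factorial : ℂ) := by
    simp only [expTail, ← tsum_mul_left]
    rw [Summable.tsum_comm (f := fun n p =>
      χ p * (z ^ (n + 1 + 0) / ((n + 1 + 0).factorial : ℂ) * convPow v (n + 0) p)) hs]
    refine tsum_congr fun n => ?_
    rw [mul_pow, ← hpow n, mul_div_right_comm, ← tsum_mul_left]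
    exact tsum_congr fun p => by simp only [add_zero]; ring
  have h3 := NormedSpace.expSeries_div_hasSum_exp (z * X)
  rw [h1, Complex.exp_eq_exp_ℂ, ← h3.tsum_eq, h3.summable.tsum_eq_zero_add]
  simp

/-! ### The potential in the interaction picture -/

/-- The frequency mismatch `μ_l² - μ_k²`. -/
def mismatch (κ : ℝ) (l k : ℤ) : ℝ := (κ * l) ^ 2 - (κ * k) ^ 2

/-- This is the source of the derivative losses: each factor of the mismatch costs two weights,
which are then shared between the potential and the solution. -/
theorem abs_mismatch_le (κ : ℝ) (l k : ℤ) : |mismatch κ l k| ≤ (wt κ (l - k) + wt κ k) ^ 2 := by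
  have h1 := wt_sq κ l
  have h2 := wt_sq κ k
  have h3 := wt_le_sub_add κ l k
  have h4 := wt_pos κ (l - k)
  have h5 := wt_pos κ k
  have h6 := wt_pos κ l
  have h7 : wt κ l ^ 2 ≤ (wt κ (l - k) + wt κ k) ^ 2 := pow_le_pow_left₀ h6.le h3 2
  unfold mismatch
  rw [abs_le]
  constructor <;> nlinarith [sq_nonneg (κ * l), sq_nonneg (κ * k)]

/-- The unimodular factor `exp(i t (μ_l² - μ_k²))`. -/
def phase (κ t : ℝ) (l k : ℤ) : ℂ := Complex.exp (Complex.I * ((t * mismatch κ l k : ℝ) : ℂ))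

@[simp] theorem norm_phase (κ t : ℝ) (l k : ℤ) : ‖phase κ t l k‖ = 1 :=
  Complex.norm_exp_I_mul_ofReal _

theorem continuous_phase (κ : ℝ) (l k : ℤ) : Continuous fun t => phase κ t l k := by
  unfold phase; fun_prop

theorem norm_exp_I_sub_le (x y : ℝ) :
    ‖Complex.exp (Complex.I * (x : ℂ)) - Complex.exp (Complex.I * (y : ℂ))‖ ≤ |x - y| := by
  have h : Complex.exp (Complex.I * (x : ℂ)) - Complex.exp (Complex.I * (y : ℂ))
      = Complex.exp (Complex.I * (y : ℂ)) * (Complex.exp (Complex.I * ((x - y : ℝ) : ℂ)) - 1) := by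
    rw [mul_sub, ← Complex.exp_add, mul_one]
    congr 2
    push_cast; ring
  rw [h, norm_mul, Complex.norm_exp_I_mul_ofReal, one_mul]
  exact Real.norm_exp_I_mul_ofReal_sub_one_le

theorem norm_phase_sub_le (κ t r : ℝ) (l k : ℤ) :
    ‖phase κ t l k - phase κ r l k‖ ≤ |t - r| * |mismatch κ l k| := by
  refine (norm_exp_I_sub_le _ _).trans (le_of_eq ?_)
  rw [← sub_mul, abs_mul]

/-- Multiplication by `v`, conjugated with the free flow at time `t`. -/
def twist (κ : ℝ) (v : ℤ → ℂ) (t : ℝ) (u : ℤ → ℂ) (l : ℤ) : ℂ :=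
  ∑' k, phase κ t l k * (v (l - k) * u k)

section twist

variable {κ : ℝ} {s : ℕ} {v v' u u' : ℤ → ℂ} {A A' B B' : ℝ}

theorem phase_kernel_le (κ t : ℝ) (s : ℕ) (l k : ℤ) :
    wt κ l ^ s * ‖phase κ t l k‖ ≤ 1 * (wt κ (l - k) + wt κ k) ^ s := by
  rw [norm_phase, mul_one, one_mul]
  exact pow_le_pow_left₀ (wt_pos κ l).le (wt_le_sub_add κ l k) s

theorem HBound.twist_bound (hκ : 0 < κ) (hs : 1 ≤ s) (hv : HBound κ s v A) (hu : HBound κ s u B) (t : ℝ) :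
    HBound κ s (twist κ v t u) (convConst κ s * (A * B)) := by
  have h := (HBound.kernel hκ hs zero_le_one hv hu (phase_kernel_le κ t s)).2
  rw [one_mul] at h
  exact h

theorem summable_twist (hκ : 0 < κ) (hv : HBound κ 1 v A) (hu : HBound κ 1 u B) (t : ℝ) (l : ℤ) :
    Summable fun k => phase κ t l k * (v (l - k) * u k) :=
  ((HBound.kernel hκ le_rfl zero_le_one hv hu (phase_kernel_le κ t 1)).1 l).of_norm

theorem twist_sub (hκ : 0 < κ) (hv : HBound κ 1 v A) (hu : HBound κ 1 u B) (hu' : HBound κ 1 u' B')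
    (t : ℝ) (l : ℤ) :
    twist κ v t (fun k => u k - u' k) l = twist κ v t u l - twist κ v t u' l := by
  unfold twist
  rw [← (summable_twist hκ hv hu t l).tsum_sub (summable_twist hκ hv hu' t l)]
  exact tsum_congr fun k => by ring

theorem twist_add (hκ : 0 < κ) (hv : HBound κ 1 v A) (hu : HBound κ 1 u B) (hu' : HBound κ 1 u' B')
    (t : ℝ) (l : ℤ) :
    twist κ v t (fun k => u k + u' k) l = twist κ v t u l + twist κ v t u' l := by
  unfold twist
  rw [← (summable_twist hκ hv hu t l).tsum_add (summable_twist hκ hv hu' t l)]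
  exact tsum_congr fun k => by ring

theorem twist_const_mul (c : ℂ) (t : ℝ) (l : ℤ) :
    twist κ v t (fun k => c * u k) l = c * twist κ v t u l := by
  unfold twist
  rw [← tsum_mul_left]
  exact tsum_congr fun k => by ring

theorem twist_add_potential (hκ : 0 < κ) (hv : HBound κ 1 v A) (hv' : HBound κ 1 v' A')
    (hu : HBound κ 1 u B) (t : ℝ) (l : ℤ) :
    twist κ (fun k => v k + v' k) t u l = twist κ v t u l + twist κ v' t u l := by
  unfold twist
  rw [← (summable_twist hκ hv hu t l).tsum_add (summable_twist hκ hv' hu t l)]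
  exact tsum_congr fun k => by ring

theorem twist_const_mul_potential (c : ℂ) (t : ℝ) (l : ℤ) :
    twist κ (fun k => c * v k) t u l = c * twist κ v t u l := by
  unfold twist
  rw [← tsum_mul_left]
  exact tsum_congr fun k => by ring

theorem phase_eq (κ t : ℝ) (l k : ℤ) : phase κ t l k = phase κ t l 0 * phase κ (-t) k 0 := by
  unfold phase mismatch
  rw [← Complex.exp_add]
  congr 1
  push_cast
  ring

/-- The mismatch is a function of `l` minus a function of `k`, so its phase factors. The kernel form
serves the oscillation estimates, and the conjugated form serves the comparison with the scheme. -/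
theorem twist_eq_conv (κ : ℝ) (v : ℤ → ℂ) (t : ℝ) (u : ℤ → ℂ) (l : ℤ) :
    twist κ v t u l = phase κ t l 0 * seqConv v (fun k => phase κ (-t) k 0 * u k) l := by
  unfold twist seqConv
  rw [← tsum_mul_left]
  exact tsum_congr fun k => by rw [phase_eq]; ring

theorem phase_mul_neg (κ t : ℝ) (k : ℤ) : phase κ (-t) k 0 * phase κ t k 0 = 1 := by
  unfold phase
  rw [← Complex.exp_add, ← Complex.exp_zero]
  congr 1
  push_cast
  ring

/-- At equal times the inner conjugations cancel. Thus the second-order term of the exact flow,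
frozen at the midpoint, is the quadratic term of the exponential of the potential. -/
theorem twist_twist (hκ : 0 < κ) (hv : HBound κ 1 v A) (hv' : HBound κ 1 v' A')
    (hu : HBound κ 1 u B) (t : ℝ) (l : ℤ) :
    twist κ v t (twist κ v' t u) l = twist κ (seqConv v v') t u l := by
  have hpu : HBound κ 1 (fun k => phase κ (-t) k 0 * u k) B := hu.of_norm_le fun l => by simp
  rw [twist_eq_conv, twist_eq_conv, ← seqConv_assoc hκ hv hv' hpu]
  congr 2
  funext k
  rw [twist_eq_conv, ← mul_assoc, phase_mul_neg, one_mul]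

/-- The twisted potential is Lipschitz in time, with a loss of derivatives. -/
theorem HBound.twist_sub_time (hκ : 0 < κ) (hs : 3 ≤ s) (hv : HBound κ s v A) (hu : HBound κ s u B)
    (t r : ℝ) :
    HBound κ 1 (fun l => twist κ v t u l - twist κ v r u l)
      (|t - r| * (convConst κ s * (A * B))) := by
  have h := (HBound.kernel hκ (by omega : 1 ≤ s) (r := 1) (abs_nonneg (t - r)) hv hu
    (K := fun l k => phase κ t l k - phase κ r l k) fun l k => ?_).2
  · refine h.of_norm_le fun l => le_of_eq ?_
    have h1 : (1 : ℕ) ≤ s := by omega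
    unfold twist
    rw [← (summable_twist hκ (hv.mono_index h1) (hu.mono_index h1) t l).tsum_sub
      (summable_twist hκ (hv.mono_index h1) (hu.mono_index h1) r l)]
    congr 1
    exact tsum_congr fun k => by ring
  · have h1 := norm_phase_sub_le κ t r l k
    have h2 := abs_mismatch_le κ l k
    have h3 := wt_le_sub_add κ l k
    have h4 := (wt_pos κ l).le
    have h5 : 1 ≤ wt κ (l - k) + wt κ k := by linarith [one_le_wt κ (l - k), wt_pos κ k]
    rw [pow_one]
    -- One weight for the `H¹` norm and two for the mismatch: this explains `3 ≤ s`.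
    calc wt κ l * ‖phase κ t l k - phase κ r l k‖
        ≤ (wt κ (l - k) + wt κ k) * (|t - r| * (wt κ (l - k) + wt κ k) ^ 2) :=
          mul_le_mul h3 (h1.trans (mul_le_mul_of_nonneg_left h2 (abs_nonneg _))) (norm_nonneg _)
            (by linarith)
      _ = |t - r| * (wt κ (l - k) + wt κ k) ^ 3 := by ring
      _ ≤ _ := mul_le_mul_of_nonneg_left (pow_le_pow_right₀ h5 hs) (abs_nonneg _)

theorem continuousOn_twist (hκ : 0 < κ) (hv : HBound κ 1 v A) {S : Set ℝ} {φ : ℝ → ℤ → ℂ}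
    (hφ : ∀ r ∈ S, HBound κ 1 (φ r) B) (hc : ∀ l, ContinuousOn (fun r => φ r l) S) (l : ℤ) :
    ContinuousOn (fun r => twist κ v r (φ r) l) S := by
  have hsum : Summable fun k => ‖v (l - k)‖ * B :=
    ((Equiv.subLeft l).summable_iff.2 (hv.summable hκ le_rfl)).mul_right B
  refine continuousOn_tsum (fun k => ?_) hsum fun k r hr => ?_
  · exact ((continuous_phase κ l k).continuousOn).mul (continuousOn_const.mul (hc k))
  · rw [norm_mul, norm_mul, norm_phase, one_mul]
    exact mul_le_mul_of_nonneg_left ((hφ r hr).norm_le k) (norm_nonneg _)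

end twist

/-! ### The flow in the interaction picture and its increments -/

/-- `φ` solves `∂_t φ = -iε A(t) φ` on `[0, S]`, with `A` the twisted potential, and is bounded
by `M` in `H^s`. -/
structure InteractionFlow (κ : ℝ) (s : ℕ) (ε S M : ℝ) (v : ℤ → ℂ) (φ : ℝ → ℤ → ℂ) : Prop where
  bound : ∀ t ∈ Icc 0 S, HBound κ s (φ t) M
  cont : ∀ l, ContinuousOn (fun t => φ t l) (Icc 0 S)
  integral_eq : ∀ p q : ℝ, 0 ≤ p → p ≤ q → q ≤ S → ∀ l,
    φ q l - φ p l = -(Complex.I * ε) * ∫ r in p..q, twist κ v r (φ r) l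

theorem norm_neg_I_mul {ε : ℝ} (hε : 0 ≤ ε) : ‖-(Complex.I * (ε : ℂ))‖ = ε := by
  simp [abs_of_nonneg hε]

section flow

variable {κ : ℝ} {s : ℕ} {ε S M A : ℝ} {v : ℤ → ℂ} {φ : ℝ → ℤ → ℂ}

/-- The stiff free part has been removed, so increments are of size `ε (q - p)` with no loss of
derivatives. This is the bounded variation that the summation by parts consumes. -/
theorem InteractionFlow.increment (h : InteractionFlow κ s ε S M v φ) (hκ : 0 < κ) (hs : 1 ≤ s)
    (hε : 0 ≤ ε) (hv : HBound κ s v A) {p q : ℝ} (hp : 0 ≤ p) (hpq : p ≤ q) (hq : q ≤ S) :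
    HBound κ s (fun l => φ q l - φ p l) (ε * ((q - p) * (convConst κ s * (A * M)))) := by
  have hsub : Icc p q ⊆ Icc 0 S := Icc_subset_Icc hp hq
  have h1 := (HBound.intervalIntegral (f := fun r => twist κ v r (φ r)) hpq
    (continuousOn_twist hκ (hv.mono_index hs) (fun r hr => (h.bound r (hsub hr)).mono_index hs)
      fun l => (h.cont l).mono hsub)
    fun r hr => hv.twist_bound hκ hs (h.bound r (hsub hr)) r).const_mul (-(Complex.I * ε))
  rw [norm_neg_I_mul hε] at h1
  exact h1.of_norm_le fun l => le_of_eq (by rw [h.integral_eq p q hp hpq hq l])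

/-- The first order midpoint quadrature error over a step. -/
def midError (κ ε τ : ℝ) (v : ℤ → ℂ) (p : ℝ) (u : ℤ → ℂ) (l : ℤ) : ℂ :=
  -(Complex.I * ε) * ∫ r in p..(p + τ), (twist κ v r u l - twist κ v (p + τ / 2) u l)

/-- The constant of the second order remainder of a step. -/
def stepConst (κ : ℝ) (s : ℕ) (A M T : ℝ) : ℝ :=
  (convConst κ s * (A * (convConst κ s * (A * M)))
    + convConst κ 1 * (A * (convConst κ s * (A * (convConst κ s * (A * M)))
      + convConst κ s * (A * M))))
  + convConst κ 1 * (powRate κ s A ^ 3 * Real.exp (T * powRate κ s A) * M)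

theorem stepConst_nonneg {T : ℝ} (hA : 0 ≤ A) (hM : 0 ≤ M) : 0 ≤ stepConst κ s A M T := by
  have h1 := convConst_nonneg κ s
  have h2 := convConst_nonneg κ 1
  have h3 := powRate_nonneg κ s hA
  unfold stepConst; positivity

/-- The replacement is made in two moves: `A(r)` by `A(p + τ/2)` in front of `φ r - φ p`, which is
already `O(ετ)`, and `φ r - φ p` by its first-order term, with error `O(ετ²)`. The outer factor `ε`
and the integration over the step later turn the bound into `ε²τ³`. -/
theorem InteractionFlow.second_order (h : InteractionFlow κ s ε S M v φ) (hκ : 0 < κ) (hs : 3 ≤ s)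
    (hε : 0 ≤ ε) (hε1 : ε ≤ 1) (hv : HBound κ s v A) {p τ : ℝ} (hp : 0 ≤ p) (hτ : 0 ≤ τ)
    (hq : p + τ ≤ S) {r : ℝ} (hr : r ∈ Icc p (p + τ)) :
    HBound κ 1 (fun l => twist κ v r (φ r) l - twist κ v r (φ p) l
        - (-(Complex.I * ε)) * ((r - p : ℝ) : ℂ) * twist κ v (p + τ / 2)
          (twist κ v (p + τ / 2) (φ p)) l)
      (ε * τ ^ 2 * (convConst κ s * (A * (convConst κ s * (A * M)))
        + convConst κ 1 * (A * (convConst κ s * (A * (convConst κ s * (A * M)))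
          + convConst κ s * (A * M))))) := by
  have hs1 : 1 ≤ s := by omega
  have hK := convConst_nonneg κ s
  have hK1 := convConst_nonneg κ 1
  have hA := hv.nonneg
  have hv1 := hv.mono_index hs1
  have hpS : p ∈ Icc 0 S := ⟨hp, by linarith⟩
  have hP := h.bound p hpS
  have hM := hP.nonneg
  have hP1 := hP.mono_index hs1
  set c := p + τ / 2 with hc
  have hX := hv.twist_bound hκ hs1 hP c
  have hinc : ∀ x ∈ Icc p (p + τ), HBound κ s (fun l => φ x l - φ p l)
      (ε * (τ * (convConst κ s * (A * M)))) := fun x hx =>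
    (h.increment hκ hs1 hε hv hp hx.1 (hx.2.trans hq)).weaken (by
      have : x - p ≤ τ := by linarith [hx.2]
      gcongr)
  have htime : ∀ x ∈ Icc p (p + τ), |x - c| ≤ τ := fun x hx => by
    rw [abs_le]; constructor <;> linarith [hx.1, hx.2]
  have hmem : ∀ x ∈ Icc p (p + τ), x ∈ Icc 0 S := fun x hx => ⟨hp.trans hx.1, hx.2.trans hq⟩
  -- the inner remainder
  have hρ : HBound κ 1 (fun l => φ r l - φ p l
      - (-(Complex.I * ε)) * ((r - p : ℝ) : ℂ) * twist κ v c (φ p) l)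
      (ε * (τ * (τ * (convConst κ s * (A * (convConst κ s * (A * M)))
          + convConst κ s * (A * M))))) := by
    have hsub : Icc p r ⊆ Icc p (p + τ) := Icc_subset_Icc_right hr.2
    have hcont : ∀ l, ContinuousOn (fun x => twist κ v x (φ x) l) (Icc p r) :=
      continuousOn_twist hκ hv1 (fun x hx => (h.bound x (hmem x (hsub hx))).mono_index hs1)
        fun l => (h.cont l).mono fun x hx => hmem x (hsub hx)
    have h1 := (HBound.intervalIntegral (κ := κ) (s := 1)
      (f := fun x l => twist κ v x (φ x) l - twist κ v c (φ p) l)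
      (B := τ * (convConst κ s * (A * (convConst κ s * (A * M))) + convConst κ s * (A * M)))
      hr.1 (fun l => (hcont l).sub continuousOn_const) fun x hx => ?_).const_mul
        (-(Complex.I * ε))
    · rw [norm_neg_I_mul hε] at h1
      refine (h1.weaken ?_).of_norm_le fun l => le_of_eq ?_
      · have : r - p ≤ τ := by linarith [hr.2]
        gcongr
      · congr 1
        rw [h.integral_eq p r hp hr.1 (hr.2.trans hq) l, intervalIntegral.integral_sub
          ((hcont l).intervalIntegrable_of_Icc hr.1) intervalIntegrable_const,
          intervalIntegral.integral_const, Complex.real_smul]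
        ring
    -- Here `A(x)φ(x) - A(c)φ(p)` is split as `A(x)(φ(x) - φ(p)) + (A(x) - A(c))φ(p)`. The extra `ε`
    -- of the first term is given away using `ε ≤ 1`.
    · have h2 := ((hv.twist_bound hκ hs1 (hinc x (hsub hx)) x).mono_index hs1).add
        (hv.twist_sub_time hκ hs hP x c)
      refine (h2.weaken ?_).of_norm_le fun l => le_of_eq ?_
      · have h3 := htime x (hsub hx)
        have : convConst κ s * (A * (ε * (τ * (convConst κ s * (A * M)))))
            ≤ τ * (convConst κ s * (A * (convConst κ s * (A * M)))) := by
          have h4 : 0 ≤ τ * (convConst κ s * (A * (convConst κ s * (A * M)))) := by positivity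
          nlinarith
        have h5 : |x - c| * (convConst κ s * (A * M)) ≤ τ * (convConst κ s * (A * M)) := by gcongr
        linarith
      · rw [twist_sub hκ hv1 ((h.bound x (hmem x (hsub hx))).mono_index hs1) hP1]
        congr 1; ring
  have h1 := (hv.twist_sub_time hκ hs (hinc r hr) r c).add (hv1.twist_bound hκ le_rfl hρ c)
  refine (h1.weaken ?_).of_norm_le fun l => le_of_eq ?_
  · have h2 : |r - c| * (convConst κ s * (A * (ε * (τ * (convConst κ s * (A * M))))))
        ≤ τ * (convConst κ s * (A * (ε * (τ * (convConst κ s * (A * M)))))) := by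
      have := htime r hr
      gcongr
    refine (add_le_add_left h2 _).trans (le_of_eq ?_)
    ring
  · have hR1 := (h.bound r (hmem r hr)).mono_index hs1
    rw [twist_sub hκ hv1 hR1 hP1, twist_sub hκ hv1 hR1 hP1,
      twist_sub hκ hv1 (hR1.sub hP1) ((hX.mono_index hs1).const_mul _), twist_const_mul,
      twist_sub hκ hv1 hR1 hP1]
    congr 1; ring

theorem integral_sub_left (p τ : ℝ) : ∫ r in p..(p + τ), ((r - p : ℝ) : ℂ) = (τ : ℂ) ^ 2 / 2 := by
  rw [intervalIntegral.integral_ofReal]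
  have : ∫ r in p..(p + τ), (r - p) = τ ^ 2 / 2 := by
    rw [intervalIntegral.integral_sub intervalIntegral.intervalIntegrable_id
      intervalIntegrable_const, integral_id, intervalIntegral.integral_const]
    simp only [smul_eq_mul]; ring
  rw [this]; push_cast; rfl

/-- A step of the flow agrees with a step of the splitting up to the midpoint quadrature error
and a remainder of order `ε² τ³`. -/
theorem InteractionFlow.local_error (h : InteractionFlow κ s ε S M v φ) (hκ : 0 < κ) (hs : 3 ≤ s)
    (hε : 0 ≤ ε) (hε1 : ε ≤ 1) (hv : HBound κ s v A) {p τ T : ℝ} (hp : 0 ≤ p) (hτ : 0 ≤ τ)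
    (hq : p + τ ≤ S) (hT : ε * τ ≤ T) :
    HBound κ 1 (fun l => φ (p + τ) l - φ p l
        - twist κ (expTail v (-(Complex.I * ε) * τ) 0) (p + τ / 2) (φ p) l
        - midError κ ε τ v p (φ p) l)
      (ε ^ 2 * τ ^ 3 * stepConst κ s A M T) := by
  have hs1 : 1 ≤ s := by omega
  have hA := hv.nonneg
  have hv1 := hv.mono_index hs1
  have hpS : p ∈ Icc 0 S := ⟨hp, by linarith⟩
  have hP := h.bound p hpS
  have hM := hP.nonneg
  have hP1 := hP.mono_index hs1
  have hR := powRate_nonneg κ s hA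
  set c := p + τ / 2 with hc
  set z : ℂ := -(Complex.I * ε) * τ with hz
  have hzn : ‖z‖ = ε * τ := by
    rw [hz, norm_mul, norm_neg_I_mul hε, Complex.norm_real, Real.norm_of_nonneg hτ]
  have hmem : ∀ x ∈ Icc p (p + τ), x ∈ Icc 0 S := fun x hx => ⟨hp.trans hx.1, hx.2.trans hq⟩
  have hle : p ≤ p + τ := by linarith
  have hc1 : ∀ l, ContinuousOn (fun x => twist κ v x (φ x) l) (Icc p (p + τ)) :=
    continuousOn_twist hκ hv1 (fun x hx => (h.bound x (hmem x hx)).mono_index hs1)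
      fun l => (h.cont l).mono hmem
  have hc2 : ∀ l, ContinuousOn (fun x => twist κ v x (φ p) l) (Icc p (p + τ)) :=
    continuousOn_twist hκ hv1 (fun _ _ => hP1) fun l => continuousOn_const
  have hc3 : ∀ l, ContinuousOn (fun r : ℝ => (-(Complex.I * ε)) * ((r - p : ℝ) : ℂ)
      * twist κ v c (twist κ v c (φ p)) l) (Icc p (p + τ)) := fun l => by fun_prop
  have h1 := (HBound.intervalIntegral (κ := κ) (s := 1) (f := fun r l =>
      twist κ v r (φ r) l - twist κ v r (φ p) l
        - (-(Complex.I * ε)) * ((r - p : ℝ) : ℂ) * twist κ v c (twist κ v c (φ p)) l)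
      hle (fun l => ((hc1 l).sub (hc2 l)).sub (hc3 l))
      fun r hr => h.second_order hκ hs hε hε1 hv hp hτ hq hr).const_mul (-(Complex.I * ε))
  have h2 : HBound κ 1 (expTail v z 2)
      ((‖z‖ * powRate κ s A) ^ (2 + 1) * Real.exp (‖z‖ * powRate κ s A)) :=
    (hv.expTail_bound hκ hs1 z 2).mono_index hs1
  have h3 := h2.twist_bound hκ le_rfl hP1 c
  refine ((h1.sub h3).weaken ?_).of_norm_le fun l => le_of_eq ?_
  · rw [norm_neg_I_mul hε, hzn]
    have hK1 := convConst_nonneg κ 1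
    have h4 : (ε * τ * powRate κ s A) ^ (2 + 1) * Real.exp (ε * τ * powRate κ s A)
        ≤ ε ^ 2 * τ ^ 3 * (powRate κ s A ^ 3 * Real.exp (T * powRate κ s A)) := by
      have h5 : (ε * τ * powRate κ s A) ^ (2 + 1) ≤ ε ^ 2 * τ ^ 3 * powRate κ s A ^ 3 := by
        have : ε ^ 3 ≤ ε ^ 2 := pow_le_pow_of_le_one hε hε1 (by norm_num)
        calc (ε * τ * powRate κ s A) ^ (2 + 1) = ε ^ 3 * (τ ^ 3 * powRate κ s A ^ 3) := by ring
          _ ≤ ε ^ 2 * (τ ^ 3 * powRate κ s A ^ 3) := by gcongr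
          _ = _ := by ring
      calc _ ≤ ε ^ 2 * τ ^ 3 * powRate κ s A ^ 3 * Real.exp (T * powRate κ s A) := by gcongr
        _ = _ := by ring
    have h6 : convConst κ 1 * ((ε * τ * powRate κ s A) ^ (2 + 1)
          * Real.exp (ε * τ * powRate κ s A) * M)
        ≤ convConst κ 1 * (ε ^ 2 * τ ^ 3 * (powRate κ s A ^ 3 * Real.exp (T * powRate κ s A)) * M) := by
      gcongr
    refine (add_le_add_right h6 _).trans (le_of_eq ?_)
    unfold stepConst
    ring
  · congr 1
    -- In the expansion of the exponential, the linear term is the midpoint rule and the quadratic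
    -- term equals the integrated correction `(-iε)² (τ²/2) A(c)²`. Both cancel exactly, so only the
    -- cubic tail and the integral bounded in `h1` survive.
    have hvv := hv1.conv hκ le_rfl hv1
    have hW : expTail v z 0 = fun l => (z * v l + z ^ 2 / 2 * seqConv v v l) + expTail v z 2 l :=
      funext fun l => expTail_eq hκ hv1 z l
    rw [hW, twist_add_potential hκ ((hv1.const_mul _).add (hvv.const_mul _)) h2 hP1,
      twist_add_potential hκ (hv1.const_mul _) (hvv.const_mul _) hP1,
      twist_const_mul_potential, twist_const_mul_potential,
      ← twist_twist hκ hv1 hv1 hP1, h.integral_eq p (p + τ) hp hle hq l]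
    have hi : IntervalIntegrable (fun x => twist κ v x (φ x) l - twist κ v x (φ p) l) volume
        p (p + τ) := ((hc1 l).sub (hc2 l)).intervalIntegrable_of_Icc hle
    unfold midError
    rw [intervalIntegral.integral_sub hi
        ((hc3 l).intervalIntegrable_of_Icc hle),
      intervalIntegral.integral_sub ((hc1 l).intervalIntegrable_of_Icc hle)
        ((hc2 l).intervalIntegrable_of_Icc hle),
      intervalIntegral.integral_sub ((hc2 l).intervalIntegrable_of_Icc hle)
        intervalIntegrable_const,
      intervalIntegral.integral_mul_const, intervalIntegral.integral_const_mul,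
      integral_sub_left, intervalIntegral.integral_const, Complex.real_smul, hz]
    push_cast
    ring

end flow

/-! ### Cancellation of the oscillating quadrature errors -/

section oscillation

variable {κ : ℝ} {s : ℕ} {ε τ A B : ℝ} {v u u' : ℤ → ℂ}

/-- A crude bound of order `ετ`, without quadrature gain. After at most `T/(ετ)` steps it gives
`O(1)`, which is enough where the high-frequency cut-off supplies the smallness. -/
theorem HBound.midError_bound (hκ : 0 < κ) (hs : 1 ≤ s) (hε : 0 ≤ ε) (hτ : 0 ≤ τ)
    (hv : HBound κ s v A) (hu : HBound κ s u B) (p : ℝ) :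
    HBound κ s (midError κ ε τ v p u) (ε * τ * (2 * (convConst κ s * (A * B)))) := by
  have hc : ∀ l, ContinuousOn (fun x => twist κ v x u l) (Icc p (p + τ)) :=
    continuousOn_twist hκ (hv.mono_index hs) (fun _ _ => hu.mono_index hs)
      fun l => continuousOn_const
  have h1 := (HBound.intervalIntegral (κ := κ) (s := s)
    (f := fun r l => twist κ v r u l - twist κ v (p + τ / 2) u l)
    (by linarith : p ≤ p + τ) (fun l => (hc l).sub continuousOn_const)
    fun r _ => (hv.twist_bound hκ hs hu r).sub (hv.twist_bound hκ hs hu (p + τ / 2))).const_mul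
      (-(Complex.I * ε))
  rw [norm_neg_I_mul hε] at h1
  exact h1.weaken (le_of_eq (by ring))

theorem midError_add (hκ : 0 < κ) {B' : ℝ} (hτ : 0 ≤ τ) (hv : HBound κ 1 v A)
    (hu : HBound κ 1 u B) (hu' : HBound κ 1 u' B') (p : ℝ) (l : ℤ) :
    midError κ ε τ v p (fun k => u k + u' k) l
      = midError κ ε τ v p u l + midError κ ε τ v p u' l := by
  have hc : ∀ {w : ℤ → ℂ} {D : ℝ}, HBound κ 1 w D → IntervalIntegrable
      (fun x => twist κ v x w l - twist κ v (p + τ / 2) w l) volume p (p + τ) := fun {w D} hw =>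
    ((continuousOn_twist hκ hv (fun _ _ => hw) (fun l => continuousOn_const) l).sub
      continuousOn_const).intervalIntegrable_of_Icc (by linarith)
  unfold midError
  rw [← mul_add, ← intervalIntegral.integral_add (hc hu) (hc hu')]
  congr 2
  funext r
  rw [twist_add hκ hv hu hu', twist_add hκ hv hu hu']
  ring

/-- The midpoint quadrature error of a single phase. -/
def midPhase (κ τ : ℝ) (l k : ℤ) : ℂ :=
  ∫ r in (0 : ℝ)..τ, (phase κ r l k - phase κ (τ / 2) l k)

theorem phase_add (κ p r : ℝ) (l k : ℤ) : phase κ (p + r) l k = phase κ p l k * phase κ r l k := by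
  unfold phase
  rw [← Complex.exp_add]
  congr 1
  push_cast
  ring

theorem phase_nat_mul (κ : ℝ) (n : ℕ) (l k : ℤ) : phase κ (n * τ) l k = phase κ τ l k ^ n := by
  unfold phase
  rw [← Complex.exp_nat_mul]
  congr 1
  push_cast
  ring

/-- Translating the step to `[0, τ]` isolates all dependence on the starting time in `phase κ p l
k`. At `p = iτ` this is a power of `phase κ τ l k`, so the sum over steps is a geometric sum with
slowly varying coefficients. -/
theorem midError_of_support (Λ : Finset ℤ) (hu : ∀ k, k ∉ Λ → u k = 0) (p : ℝ) (l : ℤ) :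
    midError κ ε τ v p u l = -(Complex.I * ε) *
      ∑ k ∈ Λ, midPhase κ τ l k * (phase κ p l k * (v (l - k) * u k)) := by
  have h1 : ∀ r, twist κ v r u l = ∑ k ∈ Λ, phase κ r l k * (v (l - k) * u k) := fun r =>
    tsum_eq_sum fun k hk => by rw [hu k hk]; ring
  unfold midError
  congr 1
  simp only [h1, ← Finset.sum_sub_distrib, ← sub_mul]
  have hi : ∀ k ∈ Λ, IntervalIntegrable
      (fun r => (phase κ r l k - phase κ (p + τ / 2) l k) * (v (l - k) * u k)) volume p (p + τ) :=
    fun k _ => (((continuous_phase κ l k).sub continuous_const).mul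
      continuous_const).intervalIntegrable _ _
  rw [intervalIntegral.integral_finsetSum hi]
  refine Finset.sum_congr rfl fun k _ => ?_
  rw [intervalIntegral.integral_mul_const, ← mul_assoc (midPhase κ τ l k)]
  congr 1
  have h2 := intervalIntegral.integral_comp_add_left (a := 0) (b := τ)
    (fun r => phase κ r l k - phase κ (p + τ / 2) l k) p
  rw [add_zero] at h2
  rw [← h2]
  simp only [phase_add, ← mul_sub]
  rw [intervalIntegral.integral_const_mul, midPhase, mul_comm]

/-- Summation by parts against a geometric sequence. -/
theorem norm_geom_sum_mul_le (z : ℂ) (hz : ‖z‖ = 1) (f : ℕ → ℂ) (n : ℕ) :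
    ‖z - 1‖ * ‖∑ i ∈ Finset.range (n + 1), z ^ i * f i‖
      ≤ ‖f n‖ + (‖f 0‖ + ∑ i ∈ Finset.range n, ‖f (i + 1) - f i‖) := by
  have h : (z - 1) * ∑ i ∈ Finset.range (n + 1), z ^ i * f i
      = z ^ (n + 1) * f n - (f 0 + ∑ i ∈ Finset.range n, z ^ (i + 1) * (f (i + 1) - f i)) := by
    induction n with
    | zero => simp; ring
    | succ n ih =>
      rw [Finset.sum_range_succ, mul_add, ih, Finset.sum_range_succ _ n]
      ring
  rw [← norm_mul, h]
  refine (norm_sub_le _ _).trans (add_le_add ?_ ((norm_add_le _ _).trans (add_le_add_right ?_ _)))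
  · rw [norm_mul, norm_pow, hz, one_pow, one_mul]
  · refine (norm_sum_le _ _).trans (Finset.sum_le_sum fun i _ => ?_)
    rw [norm_mul, norm_pow, hz, one_pow, one_mul]

/-- High frequencies gain powers of the cut-off. -/
theorem HBound.tail {r : ℕ} {θ : ℝ} (h : HBound κ (r + 1) u B)
    (hθ : ∀ l, u l ≠ 0 → 1 ≤ θ * wt κ l) (hθ0 : 0 ≤ θ) : HBound κ 1 u (θ ^ r * B) := by
  refine HBound.of_le (L2Bound.const_mul h (pow_nonneg hθ0 r)) fun l => ?_
  by_cases hl : u l = 0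
  · simp [hl]
  · rw [pow_one, pow_succ, ← mul_assoc, ← mul_assoc, ← mul_pow]
    refine mul_le_mul_of_nonneg_right ?_ (norm_nonneg _)
    exact le_mul_of_one_le_left (wt_pos κ l).le (one_le_pow₀ (hθ l hl))

/-- After exchanging the sums over steps and frequencies, summation by parts replaces the `n + 1`
terms by endpoint values plus total variation. The resulting bound has no explicit factor `n`; the
number of steps enters only through `D`. -/
theorem HBound.low_sum (hκ : 0 < κ) (hs : 1 ≤ s) (hε : 0 ≤ ε) (hv : HBound κ s v A)
    {Λ : Finset ℤ} {Γ : ℝ} (hΓ : 0 ≤ Γ)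
    (hΛ : ∀ l ∈ Λ, ∀ k ∈ Λ, wt κ l * ‖midPhase κ τ l k‖
      ≤ Γ * (wt κ (l - k) + wt κ k) ^ s * ‖phase κ τ l k - 1‖)
    {w : ℕ → ℤ → ℂ} {n : ℕ} {D : ℝ} (hw : ∀ i, ∀ k, k ∉ Λ → w i k = 0)
    (hD : L2Bound (fun k => wt κ k ^ s *
      (‖w n k‖ + (‖w 0 k‖ + ∑ i ∈ Finset.range n, ‖w (i + 1) k - w i k‖))) D) :
    HBound κ 1 (fun l => if l ∈ Λ then
        ∑ i ∈ Finset.range (n + 1), midError κ ε τ v (i * τ) (w i) l else 0)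
      (ε * Γ * (convConst κ s * (A * D))) := by
  set g : ℤ → ℝ := fun k =>
    ‖w n k‖ + (‖w 0 k‖ + ∑ i ∈ Finset.range n, ‖w (i + 1) k - w i k‖) with hg
  have hg0 : ∀ k, 0 ≤ g k := fun k => by simp only [hg]; positivity
  obtain ⟨hsum, hL⟩ := L2Bound.conv hκ hs (fun _ => norm_nonneg _) hg0 hv hD
  refine HBound.of_le (hL.const_mul (mul_nonneg hε hΓ)) fun l => ?_
  have hterm0 : ∀ k, 0 ≤ (wt κ (l - k) + wt κ k) ^ s * (‖v (l - k)‖ * g k) := fun k =>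
    mul_nonneg (pow_nonneg (add_pos (wt_pos _ _) (wt_pos _ _)).le _)
      (mul_nonneg (norm_nonneg _) (hg0 k))
  by_cases hl : l ∈ Λ
  swap
  · rw [if_neg hl, norm_zero, mul_zero]
    exact mul_nonneg (mul_nonneg hε hΓ) (tsum_nonneg hterm0)
  rw [if_pos hl, pow_one]
  have h1 : ∑ i ∈ Finset.range (n + 1), midError κ ε τ v (i * τ) (w i) l
      = -(Complex.I * ε) * ∑ k ∈ Λ, midPhase κ τ l k * (v (l - k) *
        ∑ i ∈ Finset.range (n + 1), phase κ τ l k ^ i * w i k) := by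
    simp only [midError_of_support Λ (hw _)]
    rw [← Finset.mul_sum, Finset.sum_comm]
    congr 1
    refine Finset.sum_congr rfl fun k _ => ?_
    rw [Finset.mul_sum, Finset.mul_sum]
    exact Finset.sum_congr rfl fun i _ => by rw [phase_nat_mul]; ring
  have h2 : ∀ k ∈ Λ, wt κ l * ‖midPhase κ τ l k * (v (l - k) *
        ∑ i ∈ Finset.range (n + 1), phase κ τ l k ^ i * w i k)‖
      ≤ Γ * ((wt κ (l - k) + wt κ k) ^ s * (‖v (l - k)‖ * g k)) := by
    intro k hk
    have h3 := hΛ l hl k hk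
    have h4 := norm_geom_sum_mul_le (phase κ τ l k) (norm_phase κ τ l k) (fun i => w i k) n
    set G := ∑ i ∈ Finset.range (n + 1), phase κ τ l k ^ i * w i k
    have hpos : 0 ≤ Γ * (wt κ (l - k) + wt κ k) ^ s :=
      mul_nonneg hΓ (pow_nonneg (add_pos (wt_pos _ _) (wt_pos _ _)).le _)
    rw [norm_mul, norm_mul]
    calc wt κ l * (‖midPhase κ τ l k‖ * (‖v (l - k)‖ * ‖G‖))
        = (wt κ l * ‖midPhase κ τ l k‖) * (‖v (l - k)‖ * ‖G‖) := by ring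
      -- The factor `‖phase - 1‖` is kept as a product, without division. At an exact resonance the
      -- hypothesis forces `midPhase` to vanish, so no separate case is needed.
      _ ≤ (Γ * (wt κ (l - k) + wt κ k) ^ s * ‖phase κ τ l k - 1‖) * (‖v (l - k)‖ * ‖G‖) := by
          gcongr
      _ = Γ * (wt κ (l - k) + wt κ k) ^ s * (‖v (l - k)‖ * (‖phase κ τ l k - 1‖ * ‖G‖)) := by ring
      _ ≤ Γ * (wt κ (l - k) + wt κ k) ^ s * (‖v (l - k)‖ * g k) := by gcongr
      _ = _ := by ring
  rw [h1, norm_mul, norm_neg_I_mul hε]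
  calc wt κ l * (ε * ‖∑ k ∈ Λ, midPhase κ τ l k * (v (l - k) *
        ∑ i ∈ Finset.range (n + 1), phase κ τ l k ^ i * w i k)‖)
      ≤ wt κ l * (ε * ∑ k ∈ Λ, ‖midPhase κ τ l k * (v (l - k) *
        ∑ i ∈ Finset.range (n + 1), phase κ τ l k ^ i * w i k)‖) := by
        have := (wt_pos κ l).le
        gcongr
        exact norm_sum_le _ _
    _ = ε * ∑ k ∈ Λ, wt κ l * ‖midPhase κ τ l k * (v (l - k) *
        ∑ i ∈ Finset.range (n + 1), phase κ τ l k ^ i * w i k)‖ := by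
        rw [← Finset.mul_sum]; ring
    _ ≤ ε * ∑ k ∈ Λ, Γ * ((wt κ (l - k) + wt κ k) ^ s * (‖v (l - k)‖ * g k)) := by
        exact mul_le_mul_of_nonneg_left (Finset.sum_le_sum h2) hε
    _ = ε * Γ * ∑ k ∈ Λ, (wt κ (l - k) + wt κ k) ^ s * (‖v (l - k)‖ * g k) := by
        rw [← Finset.mul_sum]; ring
    _ ≤ _ := by
        gcongr
        exact (hsum l).sum_le_tsum _ fun k _ => hterm0 k

/-- The constant in the bound for the accumulated quadrature errors. -/
def oscConst (κ : ℝ) (s : ℕ) (A M T : ℝ) : ℝ :=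
  convConst κ s * (A * (2 * M + T * (convConst κ s * (A * M))))
    + T * (2 * (convConst κ s * (A * M))) + T * (2 * (convConst κ 1 * (A * M)))

theorem oscConst_nonneg {M T : ℝ} (hA : 0 ≤ A) (hM : 0 ≤ M) (hT : 0 ≤ T) :
    0 ≤ oscConst κ s A M T := by
  have h1 := convConst_nonneg κ s
  have h2 := convConst_nonneg κ 1
  unfold oscConst; positivity

/-- The midpoint quadrature errors do not accumulate below the cut-off. -/
theorem InteractionFlow.sum_midError {S M T Γ θ : ℝ} {r : ℕ} {φ : ℝ → ℤ → ℂ}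
    (h : InteractionFlow κ (r + 1) ε S M v φ) (hκ : 0 < κ) (hε : 0 ≤ ε) (hτ : 0 ≤ τ)
    (hv : HBound κ (r + 1) v A) {Λ : Finset ℤ} (hΓ : 0 ≤ Γ) (hθ : 0 ≤ θ)
    (hΛ : ∀ l ∈ Λ, ∀ k ∈ Λ, wt κ l * ‖midPhase κ τ l k‖
      ≤ Γ * (wt κ (l - k) + wt κ k) ^ (r + 1) * ‖phase κ τ l k - 1‖)
    (hΛθ : ∀ l, l ∉ Λ → 1 ≤ θ * wt κ l) {n : ℕ} (hnS : n * τ ≤ S) (hnT : n * (ε * τ) ≤ T) :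
    HBound κ 1 (fun l => ∑ i ∈ Finset.range n, midError κ ε τ v (i * τ) (φ (i * τ)) l)
      (oscConst κ (r + 1) A M T * (ε * Γ + θ ^ r)) := by
  have hA := hv.nonneg
  have hS : 0 ≤ S := (mul_nonneg n.cast_nonneg hτ).trans hnS
  have hM := (h.bound 0 ⟨le_rfl, hS⟩).nonneg
  have hT : 0 ≤ T := (mul_nonneg n.cast_nonneg (mul_nonneg hε hτ)).trans hnT
  have hK := convConst_nonneg κ (r + 1)
  have hK1 := convConst_nonneg κ 1
  have hs : 1 ≤ r + 1 := by omega
  -- Summation by parts is stated for `n + 1` terms, so the empty sum is treated apart.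
  rcases n with _ | n
  · simp only [Finset.range_zero, Finset.sum_empty]
    have : 0 ≤ oscConst κ (r + 1) A M T * (ε * Γ + θ ^ r) :=
      mul_nonneg (oscConst_nonneg hA hM hT) (by positivity)
    exact HBound.of_le (L2Bound.zero.weaken this) fun l => by simp
  have hmem : ∀ i : ℕ, i ≤ n + 1 → (i * τ) ∈ Icc 0 S := fun i hi =>
    ⟨by positivity, le_trans (by gcongr) hnS⟩
  have hb : ∀ i ∈ Finset.range (n + 1), HBound κ (r + 1) (φ (i * τ)) M := fun i hi =>
    h.bound _ (hmem i (Finset.mem_range.1 hi).le)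
  set lo : ℕ → ℤ → ℂ := fun i k => if k ∈ Λ then φ (i * τ) k else 0 with hlo
  set hi : ℕ → ℤ → ℂ := fun i k => if k ∈ Λ then 0 else φ (i * τ) k with hhi
  have hlob : ∀ i ∈ Finset.range (n + 1), HBound κ (r + 1) (lo i) M := fun i hin =>
    (hb i hin).of_norm_le fun l => by simp only [hlo]; split_ifs <;> simp
  have hhib : ∀ i ∈ Finset.range (n + 1), HBound κ 1 (hi i) (θ ^ r * M) := fun i hin => by
    refine HBound.tail (r := r) ((hb i hin).of_norm_le fun l => ?_) (fun l hl => hΛθ l ?_) hθ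
    · simp only [hhi]; split_ifs <;> simp
    · intro hl'; exact hl (by simp [hhi, hl'])
  -- low frequencies
  have h1 := HBound.low_sum hκ hs hε hv hΓ hΛ (w := lo) (n := n)
    -- The two endpoint values give `2 * M`. The `n` increments, each of size `ετ`, give the other
    -- term because `n (ετ) ≤ T`.
    (D := 2 * M + T * (convConst κ (r + 1) * (A * M))) (fun i k hk => by simp [hlo, hk]) (by
      have hinc : ∀ i ∈ Finset.range n, HBound κ (r + 1) (fun k => lo (i + 1) k - lo i k)
          (ε * (τ * (convConst κ (r + 1) * (A * M)))) := fun i hin => by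
        have hin' := Finset.mem_range.1 hin
        have h2 := h.increment hκ hs hε hv (p := i * τ) (q := (i + 1 : ℕ) * τ) (by positivity)
          (by gcongr; omega) (hmem (i + 1) (by omega)).2
        refine (h2.weaken (le_of_eq ?_)).of_norm_le fun l => ?_
        · push_cast; ring
        · simp only [hlo]; split_ifs <;> simp
      have h3 := (L2Bound.add (hlob n (by simp)) (L2Bound.add (hlob 0 (by simp))
        (HBound.finset_sum_norm _ hinc)))
      refine (h3.weaken ?_).of_abs_le fun k => ?_
      · rw [Finset.sum_const, Finset.card_range, nsmul_eq_mul]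
        have : (n : ℝ) * (ε * τ) ≤ T := le_trans (by gcongr; omega) hnT
        have h4 : (n : ℝ) * (ε * τ) * (convConst κ (r + 1) * (A * M))
          ≤ T * (convConst κ (r + 1) * (A * M)) := by gcongr
        linarith
      · rw [abs_of_nonneg (mul_nonneg (pow_nonneg (wt_pos κ k).le _) (by positivity))]
        exact le_of_eq (by ring))
  -- high frequencies
  have h2 : HBound κ 1 (fun l => if l ∈ Λ then
      ∑ i ∈ Finset.range (n + 1), midError κ ε τ v (i * τ) (hi i) l else 0)
      (T * (2 * (convConst κ 1 * (A * (θ ^ r * M))))) := by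
    have h3 := HBound.finset_sum (Finset.range (n + 1)) fun i hin =>
      HBound.midError_bound hκ le_rfl hε hτ (hv.mono_index hs) (hhib i hin) (i * τ)
    refine (h3.weaken ?_).of_norm_le fun l => by split_ifs <;> simp
    rw [Finset.sum_const, Finset.card_range, nsmul_eq_mul, ← mul_assoc]
    gcongr
  -- For high output frequencies the sum is bounded in `H^(r+1)` first and the cut-off is applied
  -- afterwards. For high input frequencies, treated in `h2`, the cut-off was already used on the
  -- input.
  have h3 : HBound κ 1 (fun l => if l ∈ Λ then 0 else
      ∑ i ∈ Finset.range (n + 1), midError κ ε τ v (i * τ) (φ (i * τ)) l)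
      (θ ^ r * (T * (2 * (convConst κ (r + 1) * (A * M))))) := by
    have h4 := HBound.finset_sum (Finset.range (n + 1)) fun i hin =>
      HBound.midError_bound hκ hs hε hτ hv (hb i hin) (i * τ)
    refine HBound.tail ((h4.weaken ?_).of_norm_le fun l => ?_) (fun l hl => hΛθ l ?_) hθ
    · rw [Finset.sum_const, Finset.card_range, nsmul_eq_mul, ← mul_assoc]
      gcongr
    · split_ifs <;> simp
    · intro hl'; exact hl (by simp [hl'])
  refine (((h1.add h2).add h3).weaken ?_).of_norm_le fun l => le_of_eq ?_
  · have hθr : 0 ≤ θ ^ r := by positivity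
    have hεΓ : 0 ≤ ε * Γ := mul_nonneg hε hΓ
    have e1 : 0 ≤ convConst κ (r + 1) * (A * (2 * M + T * (convConst κ (r + 1) * (A * M)))) := by
      positivity
    have e2 : 0 ≤ T * (2 * (convConst κ (r + 1) * (A * M))) := by positivity
    have e3 : 0 ≤ T * (2 * (convConst κ 1 * (A * M))) := by positivity
    unfold oscConst
    nlinarith [mul_nonneg e1 hθr, mul_nonneg e2 hεΓ, mul_nonneg e3 hεΓ]
  · congr 1
    by_cases hl : l ∈ Λ
    · simp only [hl, if_true, add_zero]
      rw [← Finset.sum_add_distrib]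
      refine Finset.sum_congr rfl fun i hin => ?_
      rw [← midError_add hκ hτ (hv.mono_index hs) ((hlob i hin).mono_index hs) (hhib i hin)]
      congr 1
      funext k
      simp only [hlo, hhi]
      split_ifs <;> simp
    · simp [hl]

end oscillation

/-! ### Small divisors -/

theorem abs_sin_sub_self_le_cube (x : ℝ) : |Real.sin x - x| ≤ 2 * |x| ^ 3 := by
  rcases le_or_gt |x| 1 with h | h
  · have h1 := Real.sin_bound h
    have h2 : |Real.sin x - x| ≤ |Real.sin x - (x - x ^ 3 / 6)| + |x ^ 3 / 6| := by
      have := abs_sub (Real.sin x - (x - x ^ 3 / 6)) (x ^ 3 / 6)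
      rwa [show Real.sin x - (x - x ^ 3 / 6) - x ^ 3 / 6 = Real.sin x - x by ring] at this
    rw [abs_div, abs_pow] at h2
    norm_num at h2
    have h3 : |x| ^ 5 ≤ |x| ^ 3 := pow_le_pow_of_le_one (abs_nonneg _) h (by norm_num)
    have h4 : 0 ≤ |x| ^ 3 := by positivity
    linarith
  · have h1 := abs_sub (Real.sin x) x
    have h2 := Real.abs_sin_le_one x
    have h3 : |x| ≤ |x| ^ 3 := le_self_pow₀ h.le (by norm_num)
    linarith

/-- The cubic bound suits small steps, where one factor `|x|` is exchanged for `|sin x|`. Near a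
nonzero multiple of `π` no such exchange is possible, and the quadratic bound already supplies the
required `τ²`. -/
theorem abs_sin_sub_self_le_sq (x : ℝ) : |Real.sin x - x| ≤ 2 * |x| ^ 2 := by
  rcases le_or_gt |x| 1 with h | h
  · have h3 : |x| ^ 3 ≤ |x| ^ 2 := pow_le_pow_of_le_one (abs_nonneg _) h (by norm_num)
    linarith [abs_sin_sub_self_le_cube x]
  · have h1 := abs_sub (Real.sin x) x
    have h2 := Real.abs_sin_le_one x
    have h3 : |x| ≤ |x| ^ 2 := le_self_pow₀ h.le (by norm_num)
    linarith

theorem norm_phase_sub_one (κ τ : ℝ) (l k : ℤ) :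
    ‖phase κ τ l k - 1‖ = 2 * |Real.sin (τ * mismatch κ l k / 2)| := by
  unfold phase
  rw [Complex.norm_exp_I_mul_ofReal_sub_one, Real.norm_eq_abs, abs_mul]
  norm_num

theorem midPhase_of_mismatch_eq_zero {κ : ℝ} (τ : ℝ) {l k : ℤ} (h : mismatch κ l k = 0) :
    midPhase κ τ l k = 0 := by
  simp [midPhase, phase, h]

/-- With `x = τδ/2`, the value `exp(ix)` of the phase at the midpoint factors out of the integral
and leaves the real number `2(sin x - x)/δ`. -/
theorem norm_midPhase {κ : ℝ} (τ : ℝ) {l k : ℤ} (h : mismatch κ l k ≠ 0) :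
    ‖midPhase κ τ l k‖ = 2 * |Real.sin (τ * mismatch κ l k / 2) - τ * mismatch κ l k / 2|
      / |mismatch κ l k| := by
  set δ := mismatch κ l k with hδ
  set x := τ * δ / 2 with hx
  have hδC : (δ : ℂ) ≠ 0 := by exact_mod_cast h
  have hc : Complex.I * (δ : ℂ) ≠ 0 := mul_ne_zero Complex.I_ne_zero hδC
  have h1 : midPhase κ τ l k
      = Complex.exp (Complex.I * x) * ((2 * (Real.sin x - x) / δ : ℝ) : ℂ) := by
    have hp : ∀ r : ℝ, phase κ r l k = Complex.exp (Complex.I * δ * r) := fun r => by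
      unfold phase; congr 1; push_cast; ring
    unfold midPhase
    rw [intervalIntegral.integral_sub ((continuous_phase κ l k).intervalIntegrable _ _)
      intervalIntegrable_const, intervalIntegral.integral_const, Complex.real_smul, sub_zero]
    simp only [hp]
    rw [integral_exp_mul_complex hc]
    have e1 : Complex.exp (Complex.I * δ * τ)
        = Complex.exp (Complex.I * x) * Complex.exp (Complex.I * x) := by
      rw [← Complex.exp_add, hx]; congr 1; push_cast; ring
    have e2 : Complex.exp (Complex.I * δ * ((τ / 2 : ℝ) : ℂ)) = Complex.exp (Complex.I * x) := by
      rw [hx]; congr 1; push_cast; ring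
    have e3 : (τ : ℂ) = 2 * x / δ := by
      rw [eq_div_iff hδC, hx]; push_cast; ring
    have e4 : ((Real.sin x : ℝ) : ℂ)
        = (Complex.exp (Complex.I * x) - Complex.exp (-(Complex.I * x))) / (2 * Complex.I) := by
      rw [Complex.ofReal_sin, Complex.sin, mul_comm (x : ℂ) Complex.I, neg_mul,
        mul_comm (x : ℂ) Complex.I, div_eq_div_iff two_ne_zero
        (mul_ne_zero two_ne_zero Complex.I_ne_zero)]
      linear_combination (2 * (Complex.exp (-(Complex.I * x)) - Complex.exp (Complex.I * x)))
        * Complex.I_mul_I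
    have e5 : Complex.exp (Complex.I * x) * Complex.exp (-(Complex.I * x)) = 1 := by
      rw [← Complex.exp_add, add_neg_cancel, Complex.exp_zero]
    rw [e1, e2, e3]
    push_cast
    rw [← Complex.ofReal_sin, e4]
    have hI := Complex.I_ne_zero
    simp only [mul_zero, Complex.exp_zero]
    field_simp
    linear_combination e5
  rw [h1, norm_mul, Complex.norm_exp_I_mul_ofReal, one_mul, Complex.norm_real, Real.norm_eq_abs,
    abs_div, abs_mul]
  norm_num

/-- The cut-off set of low frequencies. -/
def lowModes (τ₀ : ℝ) : Finset ℤ := Finset.Icc (-⌊1 / τ₀⌋) ⌊1 / τ₀⌋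

theorem abs_le_of_mem_lowModes {τ₀ : ℝ} {l : ℤ} (h : l ∈ lowModes τ₀) : |l| ≤ ⌊1 / τ₀⌋ :=
  abs_le.2 (Finset.mem_Icc.1 h)

theorem one_le_mul_wt_of_not_mem_lowModes {κ τ₀ : ℝ} (hκ : 0 < κ) (hτ₀ : 0 < τ₀) {l : ℤ}
    (h : l ∉ lowModes τ₀) : 1 ≤ τ₀ / κ * wt κ l := by
  have h1 : ⌊1 / τ₀⌋ < |l| := by
    by_contra hc
    exact h (Finset.mem_Icc.2 (abs_le.1 (not_lt.1 hc)))
  have h2 : 1 / τ₀ < (|l| : ℤ) := Int.floor_lt.1 h1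
  have h3 := abs_le_wt κ l
  rw [abs_mul, abs_of_pos hκ] at h3
  rw [Int.cast_abs, div_lt_iff₀ hτ₀] at h2
  calc (1 : ℝ) ≤ |(l : ℝ)| * τ₀ := h2.le
    _ = τ₀ / κ * (κ * |(l : ℝ)|) := by field_simp
    _ ≤ _ := by gcongr

theorem abs_sq_sub_sq_le {x y z : ℤ} (hx : |x| ≤ z) (hy : |y| ≤ z) : |x ^ 2 - y ^ 2| ≤ z ^ 2 := by
  have h1 : x ^ 2 ≤ z ^ 2 := sq_le_sq' (by linarith [neg_abs_le x]) (by linarith [le_abs_self x])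
  have h2 : y ^ 2 ≤ z ^ 2 := sq_le_sq' (by linarith [neg_abs_le y]) (by linarith [le_abs_self y])
  rw [abs_le]; constructor <;> nlinarith [sq_nonneg x, sq_nonneg y]

theorem abs_mismatch_eq (κ : ℝ) (l k : ℤ) :
    |mismatch κ l k| = κ ^ 2 * ((|l ^ 2 - k ^ 2| : ℤ) : ℝ) := by
  have : mismatch κ l k = κ ^ 2 * ((l : ℝ) ^ 2 - (k : ℝ) ^ 2) := by unfold mismatch; ring
  rw [this, abs_mul, abs_of_nonneg (sq_nonneg κ)]
  push_cast; rfl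

theorem abs_sin_abs (x : ℝ) : |Real.sin (|x|)| = |Real.sin x| := by
  rcases abs_choice x with h | h <;> rw [h]
  rw [Real.sin_neg, abs_neg]

/-- Jordan's inequality is used at `y` up to `π/2` and at `π - y` beyond. There `(1 - α)y ≤ π - y`
follows from `y ≤ απ` and `α(2 - α) ≤ 1`. -/
theorem mul_abs_le_abs_sin_of_abs_le {α x : ℝ} (hα : α ∈ Ioo (0 : ℝ) 1)
    (hx : |x| ≤ α * Real.pi) : 2 * (1 - α) / Real.pi * |x| ≤ |Real.sin x| := by
  have hπ := Real.pi_pos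
  obtain ⟨hα0, hα1⟩ := hα
  rw [← abs_sin_abs]
  set y := |x|
  have hy0 : 0 ≤ y := abs_nonneg x
  refine le_trans ?_ (le_abs_self _)
  rcases le_total y (Real.pi / 2) with h | h
  · refine le_trans ?_ (Real.mul_le_sin hy0 h)
    gcongr; linarith
  · have h1 := Real.mul_le_sin (x := Real.pi - y) (by nlinarith) (by linarith)
    rw [Real.sin_pi_sub] at h1
    refine le_trans ?_ h1
    have h2 : (1 - α) * y ≤ Real.pi - y := by
      nlinarith [mul_le_mul_of_nonneg_left hx (by linarith : 0 ≤ 2 - α),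
        mul_nonneg hπ.le (sq_nonneg (1 - α))]
    calc 2 * (1 - α) / Real.pi * y = 2 / Real.pi * ((1 - α) * y) := by ring
      _ ≤ _ := by gcongr

/-- Jordan's inequality after subtracting the nearest multiple of `π`: the sine is controlled from
below by the distance to `πℤ`. -/
theorem mul_abs_sub_round_le_abs_sin (y : ℝ) :
    2 / Real.pi * |y - (round (y / Real.pi) : ℤ) * Real.pi| ≤ |Real.sin y| := by
  have hπ := Real.pi_pos
  set q := round (y / Real.pi)
  have h1 : |y - q * Real.pi| ≤ Real.pi / 2 := by
    have h2 := abs_sub_round (y / Real.pi)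
    have h3 : y - q * Real.pi = (y / Real.pi - q) * Real.pi := by field_simp
    rw [h3, abs_mul, abs_of_pos hπ]
    nlinarith
  have h4 := Real.mul_abs_le_abs_sin h1
  rwa [Real.sin_sub_int_mul_pi, abs_mul, abs_zpow, abs_neg, abs_one, one_zpow, one_mul] at h4

/-- Low modes have mismatch at most `κ²/τ₀²`, so (S) forces `|x| ≤ απ` and the only zero of the sine
in reach is `0`. One `|x|` of the cubic bound is paid by `|sin x|`. The rest, `4x²/|δ| = τ²|δ|`,
costs two weights, and the `H¹` weight is the third. -/
theorem midPhase_kernel_of_small {κ α τ₀ τ : ℝ} (hκ : 0 < κ) (hα : α ∈ Ioo (0 : ℝ) 1)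
    (hτ₀ : 0 < τ₀) (hτ : 0 < τ)
    (hS : τ < α * (2 * Real.pi / (κ ^ 2 * (1 + τ₀) ^ 2)) * τ₀ ^ 2) {s : ℕ} (hs : 3 ≤ s) :
    ∀ l ∈ lowModes τ₀, ∀ k ∈ lowModes τ₀, wt κ l * ‖midPhase κ τ l k‖
      ≤ Real.pi / (4 * (1 - α)) * τ ^ 2 * (wt κ (l - k) + wt κ k) ^ s * ‖phase κ τ l k - 1‖ := by
  intro l hl k hk
  have hπ := Real.pi_pos
  obtain ⟨hα0, hα1⟩ := id hα
  have h1α : 0 < 1 - α := by linarith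
  have hw1 : 1 ≤ wt κ (l - k) + wt κ k := by linarith [one_le_wt κ (l - k), wt_pos κ k]
  by_cases hδ : mismatch κ l k = 0
  · rw [midPhase_of_mismatch_eq_zero τ hδ, norm_zero, mul_zero]
    positivity
  have hδ0 : 0 < |mismatch κ l k| := abs_pos.2 hδ
  have hle := abs_mismatch_le κ l k
  have hbd : |mismatch κ l k| ≤ κ ^ 2 * (1 / τ₀) ^ 2 := by
    rw [abs_mismatch_eq]
    have h1 := abs_sq_sub_sq_le (abs_le_of_mem_lowModes hl) (abs_le_of_mem_lowModes hk)
    have h2 : ((|l ^ 2 - k ^ 2| : ℤ) : ℝ) ≤ (⌊1 / τ₀⌋ : ℝ) ^ 2 := by exact_mod_cast h1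
    have h3 : (0 : ℝ) ≤ (⌊1 / τ₀⌋ : ℝ) := by
      exact_mod_cast Int.floor_nonneg.2 (by positivity : 0 ≤ 1 / τ₀)
    gcongr
    exact h2.trans (pow_le_pow_left₀ h3 (Int.floor_le _) 2)
  rw [norm_midPhase τ hδ, norm_phase_sub_one]
  set δ := mismatch κ l k
  set x := τ * δ / 2 with hx
  have hxa : |x| = τ * |δ| / 2 := by rw [hx, abs_div, abs_mul, abs_of_pos hτ]; norm_num
  have hxα : |x| ≤ α * Real.pi := by
    have h1 : (1 : ℝ) ≤ (1 + τ₀) ^ 2 := by nlinarith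
    calc |x| ≤ τ * (κ ^ 2 * (1 / τ₀) ^ 2) / 2 := by rw [hxa]; gcongr
      _ ≤ (α * (2 * Real.pi / (κ ^ 2 * (1 + τ₀) ^ 2)) * τ₀ ^ 2) * (κ ^ 2 * (1 / τ₀) ^ 2) / 2 := by
          gcongr
      _ = α * Real.pi / (1 + τ₀) ^ 2 := by field_simp
      _ ≤ α * Real.pi := div_le_self (by positivity) h1
  have h1 := mul_abs_le_abs_sin_of_abs_le hα hxα
  have h2 := abs_sin_sub_self_le_cube x
  have h3 : |x| ≤ Real.pi / (2 * (1 - α)) * |Real.sin x| := by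
    calc |x| = Real.pi / (2 * (1 - α)) * (2 * (1 - α) / Real.pi * |x|) := by field_simp
      _ ≤ _ := by gcongr
  have h4 : 2 * |Real.sin x - x| / |δ| ≤ τ ^ 2 * |δ| * (Real.pi / (2 * (1 - α)) * |Real.sin x|) := by
    calc 2 * |Real.sin x - x| / |δ| ≤ 2 * (2 * |x| ^ 3) / |δ| := by gcongr
      _ = (4 * |x| ^ 2 / |δ|) * |x| := by ring
      _ = τ ^ 2 * |δ| * |x| := by rw [hxa]; field_simp; norm_num
      _ ≤ _ := by gcongr
  calc wt κ l * (2 * |Real.sin x - x| / |δ|)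
      ≤ (wt κ (l - k) + wt κ k) * (τ ^ 2 * (wt κ (l - k) + wt κ k) ^ 2
        * (Real.pi / (2 * (1 - α)) * |Real.sin x|)) := by
        have hw0 := (wt_pos κ l).le
        refine mul_le_mul (wt_le_sub_add κ l k) (h4.trans ?_) (by positivity) (by linarith)
        gcongr
    _ = Real.pi / (4 * (1 - α)) * τ ^ 2 * (wt κ (l - k) + wt κ k) ^ 3 * (2 * |Real.sin x|) := by
        field_simp; ring
    _ ≤ _ := by gcongr

/-- The distance from `|x|` to the nearest multiple `qπ` is `|δ|/2` times the distance from `τ` to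
the resonant step `2qπ/|δ|`. So (D) gives `1/|sin x| ≤ (π/d)|δ|^(1+ν)`. Together with the quadratic
bound `τ²|δ|` and one `H¹` weight, the cost is `1 + 2(2 + ν) = 5 + 2ν` weights. -/
theorem midPhase_kernel_of_diophantine {κ ν d τ₀ τ : ℝ} (hν : 0 < ν) (hd : 0 < d)
    (hτ : 0 < τ)
    (hD : ∀ K l : ℤ, 0 < |K| → |K| ≤ ⌈1 / τ₀⌉ ^ 2 → 0 ≤ l →
      d / |κ ^ 2 * (K : ℝ)| ^ (2 + ν) ≤ |τ - 2 * l * Real.pi / (κ ^ 2 * (K : ℝ))|)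
    {s : ℕ} (hs : 5 + 2 * ν ≤ s) :
    ∀ l ∈ lowModes τ₀, ∀ k ∈ lowModes τ₀, wt κ l * ‖midPhase κ τ l k‖
      ≤ Real.pi / (2 * d) * τ ^ 2 * (wt κ (l - k) + wt κ k) ^ s * ‖phase κ τ l k - 1‖ := by
  intro l hl k hk
  have hπ := Real.pi_pos
  have hw1 : 1 ≤ wt κ (l - k) + wt κ k := by linarith [one_le_wt κ (l - k), wt_pos κ k]
  by_cases hδ : mismatch κ l k = 0
  · rw [midPhase_of_mismatch_eq_zero τ hδ, norm_zero, mul_zero]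
    positivity
  have hδ0 : 0 < |mismatch κ l k| := abs_pos.2 hδ
  have hle := abs_mismatch_le κ l k
  have heq := abs_mismatch_eq κ l k
  rw [norm_midPhase τ hδ, norm_phase_sub_one]
  set δ := mismatch κ l k
  set x := τ * δ / 2 with hx
  have hxa : |x| = τ * |δ| / 2 := by rw [hx, abs_div, abs_mul, abs_of_pos hτ]; norm_num
  -- the small divisor bound
  have hsin : d / (Real.pi * |δ| ^ (1 + ν)) ≤ |Real.sin x| := by
    have hK0 : 0 < |l ^ 2 - k ^ 2| := by
      have : 0 < κ ^ 2 * ((|l ^ 2 - k ^ 2| : ℤ) : ℝ) := heq ▸ hδ0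
      exact_mod_cast pos_of_mul_pos_right this (sq_nonneg κ)
    have hKle : |l ^ 2 - k ^ 2| ≤ ⌈1 / τ₀⌉ ^ 2 :=
      abs_sq_sub_sq_le ((abs_le_of_mem_lowModes hl).trans (Int.floor_le_ceil _))
        ((abs_le_of_mem_lowModes hk).trans (Int.floor_le_ceil _))
    -- The step condition covers only nonnegative numerators, so it is applied to `|x|` and `|l ^ 2
    -- - k ^ 2|`.
    have hq : 0 ≤ round (|x| / Real.pi) := by
      rw [round_eq]
      exact Int.floor_nonneg.2 (by positivity)
    have h1 := hD |l ^ 2 - k ^ 2| (round (|x| / Real.pi)) (by rwa [abs_abs]) (by rwa [abs_abs]) hq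
    have h2 := mul_abs_sub_round_le_abs_sin |x|
    rw [← heq, abs_abs] at h1
    set q := round (|x| / Real.pi)
    have h3 : |x| - q * Real.pi = |δ| / 2 * (τ - 2 * q * Real.pi / |δ|) := by
      rw [hxa]; field_simp
    rw [← abs_sin_abs]
    refine le_trans ?_ h2
    rw [h3, abs_mul, abs_of_pos (half_pos hδ0)]
    have h4 : |δ| ^ (2 + ν) = |δ| * |δ| ^ (1 + ν) := by
      rw [show 2 + ν = 1 + (1 + ν) by ring, Real.rpow_add hδ0, Real.rpow_one]
    have h5 : 0 < |δ| ^ (1 + ν) := Real.rpow_pos_of_pos hδ0 _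
    calc d / (Real.pi * |δ| ^ (1 + ν)) = 2 / Real.pi * (|δ| / 2 * (d / |δ| ^ (2 + ν))) := by
          rw [h4]; field_simp
      _ ≤ _ := by gcongr
  have h5 : 0 < |δ| ^ (1 + ν) := Real.rpow_pos_of_pos hδ0 _
  have h6 : 1 ≤ Real.pi / d * |δ| ^ (1 + ν) * |Real.sin x| := by
    calc (1 : ℝ) = Real.pi / d * |δ| ^ (1 + ν) * (d / (Real.pi * |δ| ^ (1 + ν))) := by field_simp
      _ ≤ _ := by gcongr
  have h2 := abs_sin_sub_self_le_sq x
  set Wt := wt κ (l - k) + wt κ k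
  have h7 : Wt * (|δ| * |δ| ^ (1 + ν)) ≤ Wt ^ s := by
    have hW : 0 < Wt := by linarith
    have h8 : |δ| ^ (2 + ν) = |δ| * |δ| ^ (1 + ν) := by
      rw [show 2 + ν = 1 + (1 + ν) by ring, Real.rpow_add hδ0, Real.rpow_one]
    have h9 : |δ| ^ (2 + ν) ≤ Wt ^ (2 * (2 + ν)) := by
      rw [Real.rpow_mul hW.le, Real.rpow_two]
      exact Real.rpow_le_rpow hδ0.le hle (by linarith)
    calc Wt * (|δ| * |δ| ^ (1 + ν)) ≤ Wt * Wt ^ (2 * (2 + ν)) := by rw [← h8]; gcongr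
      _ = Wt ^ (5 + 2 * ν) := by
          rw [show 5 + 2 * ν = 1 + 2 * (2 + ν) by ring, Real.rpow_add hW, Real.rpow_one]
      _ ≤ Wt ^ (s : ℝ) := Real.rpow_le_rpow_of_exponent_le hw1 hs
      _ = Wt ^ s := Real.rpow_natCast _ _
  have h4 : 2 * |Real.sin x - x| / |δ| ≤ τ ^ 2 * |δ| := by
    calc 2 * |Real.sin x - x| / |δ| ≤ 2 * (2 * |x| ^ 2) / |δ| := by gcongr
      _ = τ ^ 2 * |δ| := by rw [hxa]; field_simp
  calc wt κ l * (2 * |Real.sin x - x| / |δ|)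
      ≤ Wt * (τ ^ 2 * |δ|) :=
        mul_le_mul (wt_le_sub_add κ l k) h4 (by positivity) (by linarith)
    _ ≤ Wt * (τ ^ 2 * |δ|) * (Real.pi / d * |δ| ^ (1 + ν) * |Real.sin x|) :=
        le_mul_of_one_le_right (by positivity) h6
    _ = Real.pi / (2 * d) * τ ^ 2 * (Wt * (|δ| * |δ| ^ (1 + ν))) * (2 * |Real.sin x|) := by
        field_simp
    _ ≤ _ := by gcongr

theorem diophantineConst_pos {a b α ν : ℝ} (hab : a < b) (hα : 0 < α) (hν : 0 < ν) :
    0 < diophantineConst a b α ν := by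
  have hπ := Real.pi_pos
  have hf : 0 < freq a b 1 := by
    unfold freq; have := sub_pos.2 hab; push_cast; positivity
  have hs : Summable fun k : ℕ => 1 / ((k : ℝ) + 1) ^ (1 + ν) := by
    have := (summable_nat_add_iff 1).2 (Real.summable_one_div_nat_rpow.2 (by linarith : 1 < 1 + ν))
    exact_mod_cast this
  have ht : 0 < ∑' k : ℕ, 1 / ((k : ℝ) + 1) ^ (1 + ν) :=
    hs.tsum_pos (fun k => by positivity) 0 (by positivity)
  unfold diophantineConst
  positivity

/-! ### Aliasing -/

/-- Restriction of a sequence to the modes of the grid. -/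
def modeProj (N : ℕ) (u : ℤ → ℂ) (l : ℤ) : ℂ := if l ∈ modeSet N then u l else 0

/-- The discrete Fourier coefficients of the function with Fourier coefficients `u`. -/
def aliasOp (N : ℕ) (u : ℤ → ℂ) (l : ℤ) : ℂ :=
  if l ∈ modeSet N then ∑' q : ℤ, u (l + q * N) else 0

section modes

variable {N : ℕ}

theorem modeSet_bounds (hN : Even N) {l : ℤ} (hl : l ∈ modeSet N) :
    -(N : ℤ) ≤ 2 * l ∧ 2 * l < N := by
  obtain ⟨m, rfl⟩ := hN
  rw [modeSet, Finset.mem_Ico] at hl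
  push_cast at hl ⊢
  omega

theorem not_mem_modeSet (hN : Even N) {l : ℤ} (hl : l ∉ modeSet N) : (N : ℤ) ≤ 2 * |l| := by
  obtain ⟨m, rfl⟩ := hN
  rw [modeSet, Finset.mem_Ico] at hl
  push_cast at hl ⊢
  rcases abs_cases l with h | h <;> omega

theorem shift_not_mem_modeSet (hN0 : 0 < N) (hN : Even N) {l q : ℤ} (hl : l ∈ modeSet N)
    (hq : q ≠ 0) : l + q * N ∉ modeSet N := by
  intro h
  have h1 := modeSet_bounds hN hl
  have h2 := modeSet_bounds hN h
  have hN' : (0 : ℤ) < N := by exact_mod_cast hN0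
  rcases lt_or_gt_of_ne hq with h3 | h3
  · nlinarith
  · nlinarith

theorem shift_injOn (hN0 : 0 < N) (hN : Even N) {l l' q q' : ℤ} (hl : l ∈ modeSet N)
    (hl' : l' ∈ modeSet N) (h : l + q * N = l' + q' * N) : l = l' ∧ q = q' := by
  have h1 : q = q' := by
    by_contra hne
    apply shift_not_mem_modeSet hN0 hN hl (sub_ne_zero.2 hne)
    have : l + (q - q') * N = l' := by linarith
    rwa [this]
  subst h1
  exact ⟨by linarith, rfl⟩

/-- A grid mode has `|l| ≤ N/2`, while for `q ≠ 0` its alias `l + qN` has modulus at least `|q|N/2`.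
So the alias weight dominates that of `l` with a factor of order `|q|` to spare, uniformly in `N`.
The summand `1/κ` absorbs the `1` in the weight, since `N/2 ≥ 1`. -/
theorem wt_mul_wt_le_shift {κ : ℝ} (hκ : 0 < κ) (hN0 : 0 < N) (hN : Even N) {l : ℤ}
    (hl : l ∈ modeSet N) (q : ℤ) :
    wt κ l * wt 1 q ≤ 2 * (1 + 1 / κ) * wt κ (l + q * N) := by
  have hκ' : 0 < 1 / κ := by positivity
  rcases eq_or_ne q 0 with rfl | hq
  · have : wt 1 0 = 1 := by simp [wt]
    rw [this, zero_mul, add_zero, mul_one]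
    exact le_mul_of_one_le_left (wt_pos κ l).le (by linarith)
  obtain ⟨h1, h2⟩ := modeSet_bounds hN hl
  have h1' : -(N : ℝ) ≤ 2 * l := by exact_mod_cast h1
  have h2' : 2 * (l : ℝ) < N := by exact_mod_cast h2
  have hN2 : (2 : ℝ) ≤ N := by
    obtain ⟨m, rfl⟩ := hN
    have : 1 ≤ m := by omega
    push_cast
    have : (1 : ℝ) ≤ m := by exact_mod_cast this
    linarith
  have hq1 : (1 : ℝ) ≤ |(q : ℝ)| := by exact_mod_cast Int.one_le_abs hq
  have hwl : wt κ l ≤ 1 + κ * (N / 2) := by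
    refine le_of_sq_le_sq ?_ (by positivity)
    rw [wt_sq]
    have : (l : ℝ) ^ 2 ≤ ((N : ℝ) / 2) ^ 2 := sq_le_sq' (by linarith) (by linarith)
    nlinarith [mul_le_mul_of_nonneg_left this (sq_nonneg κ), mul_pos hκ (by linarith : (0 : ℝ) < N)]
  have hwq : wt 1 q ≤ 2 * |(q : ℝ)| := by
    refine le_of_sq_le_sq ?_ (by positivity)
    rw [wt_sq, one_mul, mul_pow, sq_abs]
    have : (1 : ℝ) ≤ (q : ℝ) ^ 2 := by rw [← sq_abs (q : ℝ)]; nlinarith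
    linarith
  have hsh : |(q : ℝ)| * (N / 2) ≤ |((l + q * N : ℤ) : ℝ)| := by
    push_cast
    have h3 : |(q : ℝ) * N| ≤ |(l : ℝ) + q * N| + |(l : ℝ)| := by
      have := abs_sub ((l : ℝ) + q * N) l
      rwa [add_sub_cancel_left] at this
    rw [abs_mul, abs_of_nonneg (by linarith : (0 : ℝ) ≤ N)] at h3
    have h4 : |(l : ℝ)| ≤ N / 2 := abs_le.2 ⟨by linarith, by linarith⟩
    nlinarith
  have h5 := abs_le_wt κ (l + q * N)
  rw [abs_mul, abs_of_pos hκ] at h5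
  calc wt κ l * wt 1 q ≤ (1 + κ * (N / 2)) * (2 * |(q : ℝ)|) :=
        mul_le_mul hwl hwq (wt_pos _ _).le (by positivity)
    _ ≤ ((1 + 1 / κ) * (κ * (N / 2))) * (2 * |(q : ℝ)|) := by
        gcongr
        have : (1 + 1 / κ) * (κ * (N / 2)) = κ * (N / 2) + N / 2 := by field_simp
        linarith
    _ = 2 * (1 + 1 / κ) * (κ * (|(q : ℝ)| * (N / 2))) := by ring
    _ ≤ 2 * (1 + 1 / κ) * (κ * |((l + q * N : ℤ) : ℝ)|) := by gcongr
    _ ≤ _ := by gcongr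

/-- The norm bound of the aliasing operator on `H¹`. -/
def aliasConst (κ : ℝ) : ℝ := 2 * (1 + 1 / κ) * embConst 1

theorem aliasConst_nonneg {κ : ℝ} (hκ : 0 < κ) : 0 ≤ aliasConst κ :=
  mul_nonneg (by positivity) (embConst_nonneg 1)

theorem summable_shift (hN0 : 0 < N) {u : ℤ → ℂ} (hu : Summable fun l => ‖u l‖) (l : ℤ) :
    Summable fun q : ℤ => u (l + q * N) := by
  have hinj : Function.Injective fun q : ℤ => l + q * N := fun q q' h => by
    simpa [hN0.ne'] using h
  exact hu.of_norm.comp_injective hinj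

/-- Cauchy-Schwarz over the aliases spends the spare weight in `q`. The pairs `(l, q)` with `l` a
grid mode give distinct frequencies `l + qN`, so the remaining double sum is part of the `H¹` norm
of `u`. -/
theorem HBound.aliasOp_bound {κ : ℝ} (hκ : 0 < κ) (hN0 : 0 < N) (hN : Even N) {u : ℤ → ℂ} {B : ℝ}
    (hu : HBound κ 1 u B) : HBound κ 1 (aliasOp N u) (aliasConst κ * B) := by
  have hC : 0 < 2 * (1 + 1 / κ) := by positivity
  have key : ∀ G : Finset ℤ, L2Bound (fun l => ∑ q ∈ G,
      if l ∈ modeSet N then wt κ l * ‖u (l + q * N)‖ else 0) (aliasConst κ * B) := by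
    intro G
    refine ⟨mul_nonneg (aliasConst_nonneg hκ) hu.nonneg, fun F => ?_⟩
    have h1 : ∀ l, (∑ q ∈ G, if l ∈ modeSet N then wt κ l * ‖u (l + q * N)‖ else 0) ^ 2
        ≤ aliasConst κ ^ 2 * ∑ q ∈ G,
          if l ∈ modeSet N then (wt κ (l + q * N) * ‖u (l + q * N)‖) ^ 2 else 0 := by
      intro l
      by_cases hl : l ∈ modeSet N
      swap
      · simp [hl]
      simp only [hl, if_true]
      have h2 : ∑ q ∈ G, wt κ l * ‖u (l + q * N)‖ ≤ 2 * (1 + 1 / κ) *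
          ∑ q ∈ G, (wt 1 q)⁻¹ * (wt κ (l + q * N) * ‖u (l + q * N)‖) := by
        rw [Finset.mul_sum]
        refine Finset.sum_le_sum fun q _ => ?_
        have h3 := wt_mul_wt_le_shift hκ hN0 hN hl q
        have h4 : wt κ l ≤ (wt 1 q)⁻¹ * (2 * (1 + 1 / κ) * wt κ (l + q * N)) := by
          rw [inv_mul_eq_div, le_div_iff₀ (wt_pos 1 q)]
          exact h3
        refine (mul_le_mul_of_nonneg_right h4 (norm_nonneg _)).trans (le_of_eq (by ring))
      have h3 := Finset.sum_mul_sq_le_sq_mul_sq G (fun q => (wt 1 q)⁻¹)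
        (fun q => wt κ (l + q * N) * ‖u (l + q * N)‖)
      have h4 : ∑ q ∈ G, (wt 1 q)⁻¹ ^ 2 ≤ embConst 1 ^ 2 := by
        rw [embConst, Real.sq_sqrt (tsum_nonneg fun l => by positivity)]
        simp only [inv_pow]
        exact (summable_inv_wt_sq one_pos).sum_le_tsum G fun l _ => by positivity
      refine (pow_le_pow_left₀ (Finset.sum_nonneg fun q _ =>
        mul_nonneg (wt_pos _ _).le (norm_nonneg _)) h2 2).trans ?_
      rw [mul_pow (2 * (1 + 1 / κ)), aliasConst, mul_pow (2 * (1 + 1 / κ)), mul_assoc]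
      refine mul_le_mul_of_nonneg_left (h3.trans ?_) (sq_nonneg _)
      exact mul_le_mul_of_nonneg_right h4 (Finset.sum_nonneg fun _ _ => sq_nonneg _)
    refine (Finset.sum_le_sum fun l _ => h1 l).trans ?_
    rw [← Finset.mul_sum, mul_pow]
    refine mul_le_mul_of_nonneg_left ?_ (sq_nonneg _)
    classical
    have h5 : ∑ l ∈ F, ∑ q ∈ G,
        (if l ∈ modeSet N then (wt κ (l + q * N) * ‖u (l + q * N)‖) ^ 2 else 0)
        = ∑ x ∈ (F.filter (· ∈ modeSet N)) ×ˢ G,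
          (wt κ (x.1 + x.2 * N) * ‖u (x.1 + x.2 * N)‖) ^ 2 := by
      rw [Finset.sum_product, Finset.sum_filter]
      refine Finset.sum_congr rfl fun l _ => ?_
      split_ifs <;> simp
    have h6 : Set.InjOn (fun x : ℤ × ℤ => x.1 + x.2 * (N : ℤ))
        ((F.filter (· ∈ modeSet N)) ×ˢ G : Finset (ℤ × ℤ)) := by
      rintro ⟨l, q⟩ hx ⟨l', q'⟩ hx' h
      simp only [Finset.coe_product, Set.mem_prod, Finset.mem_coe, Finset.mem_filter] at hx hx'
      obtain ⟨e1, e2⟩ := shift_injOn hN0 hN hx.1.2 hx'.1.2 h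
      exact Prod.ext e1 e2
    rw [h5, ← Finset.sum_image (f := fun p => (wt κ p * ‖u p‖) ^ 2) h6]
    simpa using hu.2 _
  obtain ⟨hs, hL⟩ := L2Bound.tsum (fun l q => by
    split_ifs
    · exact mul_nonneg (wt_pos _ _).le (norm_nonneg _)
    · exact le_rfl) key
  refine HBound.of_le hL fun l => ?_
  unfold aliasOp
  by_cases hl : l ∈ modeSet N
  · simp only [hl, if_true, pow_one]
    rw [tsum_mul_left]
    refine mul_le_mul_of_nonneg_left (norm_tsum_le_tsum_norm ?_) (wt_pos _ _).le
    exact (summable_shift hN0 (hu.summable hκ le_rfl) l).norm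
  · simp [hl]

theorem aliasOp_sub {κ : ℝ} (hκ : 0 < κ) (hN0 : 0 < N) {u u' : ℤ → ℂ} {B B' : ℝ}
    (hu : HBound κ 1 u B) (hu' : HBound κ 1 u' B') (l : ℤ) :
    aliasOp N (fun k => u k - u' k) l = aliasOp N u l - aliasOp N u' l := by
  unfold aliasOp
  split_ifs
  · exact (summable_shift hN0 (hu.summable hκ le_rfl) l).tsum_sub
      (summable_shift hN0 (hu'.summable hκ le_rfl) l)
  · simp

theorem aliasOp_of_support (hN0 : 0 < N) (hN : Even N) {u : ℤ → ℂ}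
    (hu : ∀ l, l ∉ modeSet N → u l = 0) : aliasOp N u = u := by
  funext l
  unfold aliasOp
  split_ifs with hl
  · rw [tsum_eq_single 0 fun q hq => hu _ (shift_not_mem_modeSet hN0 hN hl hq)]
    simp
  · exact (hu l hl).symm

/-- High-frequency cut-off of the grid. -/
def gridTail (κ : ℝ) (N : ℕ) : ℝ := 2 / (κ * N)

theorem gridTail_nonneg {κ : ℝ} (hκ : 0 < κ) (N : ℕ) : 0 ≤ gridTail κ N := by
  unfold gridTail; positivity

theorem one_le_gridTail_mul_wt {κ : ℝ} (hκ : 0 < κ) (hN0 : 0 < N) (hN : Even N) {l : ℤ}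
    (hl : l ∉ modeSet N) : 1 ≤ gridTail κ N * wt κ l := by
  have h1 : (N : ℝ) ≤ 2 * |(l : ℝ)| := by exact_mod_cast not_mem_modeSet hN hl
  have h2 := abs_le_wt κ l
  rw [abs_mul, abs_of_pos hκ] at h2
  have hN' : (0 : ℝ) < N := by exact_mod_cast hN0
  unfold gridTail
  rw [div_mul_eq_mul_div, le_div_iff₀ (by positivity), one_mul]
  nlinarith

variable {κ : ℝ} {r : ℕ} {u : ℤ → ℂ} {B : ℝ}

theorem HBound.modeProj_bound {s : ℕ} (hu : HBound κ s u B) : HBound κ s (modeProj N u) B :=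
  hu.of_norm_le fun l => by unfold modeProj; split_ifs <;> simp

theorem HBound.sub_modeProj (hκ : 0 < κ) (hN0 : 0 < N) (hN : Even N) (hu : HBound κ (r + 1) u B) :
    HBound κ 1 (fun l => u l - modeProj N u l) (gridTail κ N ^ r * B) := by
  refine HBound.tail (hu.of_norm_le fun l => ?_) (fun l hl => ?_) (gridTail_nonneg hκ N)
  · unfold modeProj; split_ifs <;> simp
  · refine one_le_gridTail_mul_wt hκ hN0 hN fun h => hl ?_
    simp [modeProj, h]

/-- Aliasing fixes sequences supported on the grid modes. The difference is therefore the aliasing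
operator applied to the high-frequency part, which is small in `H¹`. -/
theorem HBound.aliasOp_sub_modeProj (hκ : 0 < κ) (hN0 : 0 < N) (hN : Even N)
    (hu : HBound κ (r + 1) u B) :
    HBound κ 1 (fun l => aliasOp N u l - modeProj N u l)
      (aliasConst κ * (gridTail κ N ^ r * B)) := by
  refine ((hu.sub_modeProj hκ hN0 hN).aliasOp_bound hκ hN0 hN).of_norm_le fun l => le_of_eq ?_
  have hu1 : HBound κ 1 u B := hu.mono_index (by omega)
  rw [aliasOp_sub hκ hN0 hu1 hu1.modeProj_bound,
    aliasOp_of_support hN0 hN (u := modeProj N u) fun l hl => by simp [modeProj, hl]]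

end modes

/-! ### The splitting scheme in Fourier space -/

/-- The increment of one step of the scheme in the interaction picture. -/
def stepOp (κ : ℝ) (N : ℕ) (W : ℤ → ℂ) (c : ℝ) (u : ℤ → ℂ) (l : ℤ) : ℂ :=
  phase κ c l 0 * aliasOp N (seqConv W fun k => phase κ (-c) k 0 * u k) l

section scheme

variable {κ : ℝ} {N r : ℕ} {W u u' : ℤ → ℂ} {ω B B' : ℝ}

theorem HBound.phase_mul {s : ℕ} (hu : HBound κ s u B) (c : ℝ) :
    HBound κ s (fun k => phase κ c k 0 * u k) B :=
  hu.of_norm_le fun l => by simp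

theorem HBound.stepOp_bound (hκ : 0 < κ) (hN0 : 0 < N) (hN : Even N) (hW : HBound κ 1 W ω)
    (hu : HBound κ 1 u B) (c : ℝ) :
    HBound κ 1 (stepOp κ N W c u) (aliasConst κ * (convConst κ 1 * (ω * B))) :=
  ((hW.conv hκ le_rfl (hu.phase_mul (-c))).aliasOp_bound hκ hN0 hN).phase_mul c

theorem seqConv_sub (hκ : 0 < κ) (hW : HBound κ 1 W ω) (hu : HBound κ 1 u B)
    (hu' : HBound κ 1 u' B') (l : ℤ) :
    seqConv W (fun k => u k - u' k) l = seqConv W u l - seqConv W u' l := by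
  have hsum : ∀ {w : ℤ → ℂ} {D : ℝ}, HBound κ 1 w D → Summable fun k => W (l - k) * w k :=
    fun {w D} hw => by
      have h := (HBound.kernel hκ le_rfl (r := 1) zero_le_one hW hw (K := fun _ _ => 1)
        fun l k => by
          rw [norm_one, mul_one, one_mul]
          exact pow_le_pow_left₀ (wt_pos κ l).le (wt_le_sub_add κ l k) 1).1 l
      simpa only [one_mul] using h.of_norm
  unfold seqConv
  rw [← (hsum hu).tsum_sub (hsum hu')]
  exact tsum_congr fun k => by ring

theorem stepOp_sub (hκ : 0 < κ) (hN0 : 0 < N) (hW : HBound κ 1 W ω) (hu : HBound κ 1 u B)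
    (hu' : HBound κ 1 u' B') (c : ℝ) (l : ℤ) :
    stepOp κ N W c (fun k => u k - u' k) l = stepOp κ N W c u l - stepOp κ N W c u' l := by
  unfold stepOp
  rw [← mul_sub, ← aliasOp_sub hκ hN0 (hW.conv hκ le_rfl (hu.phase_mul (-c)))
    (hW.conv hκ le_rfl (hu'.phase_mul (-c)))]
  congr 2
  funext k
  rw [← seqConv_sub hκ hW (hu.phase_mul (-c)) (hu'.phase_mul (-c))]
  congr 1
  funext k
  ring

/-- Replacing interpolation by projection in a step costs an aliasing error. -/
theorem HBound.stepOp_sub_twist (hκ : 0 < κ) (hN0 : 0 < N) (hN : Even N)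
    (hW : HBound κ (r + 1) W ω) (hu : HBound κ (r + 1) u B) (c : ℝ) :
    HBound κ 1 (fun l => stepOp κ N W c u l - modeProj N (twist κ W c u) l)
      (aliasConst κ * (gridTail κ N ^ r * (convConst κ (r + 1) * (ω * B)))) := by
  have h := ((hW.conv hκ (by omega) (hu.phase_mul (-c))).aliasOp_sub_modeProj hκ hN0 hN).phase_mul c
  refine h.of_norm_le fun l => le_of_eq ?_
  congr 1
  unfold stepOp modeProj
  split_ifs
  · rw [twist_eq_conv]; ring
  · ring

/-- The exponential-type constant of the stability estimate. -/
def growthConst (κ : ℝ) (s : ℕ) (A T : ℝ) : ℝ :=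
  powRate κ s A * Real.exp (T * powRate κ s A)

/-- The accumulated consistency error of the scheme. -/
def consistencyConst (κ : ℝ) (r : ℕ) (A M T : ℝ) : ℝ :=
  aliasConst κ * M
    + T * (aliasConst κ * (convConst κ (r + 1) * (growthConst κ (r + 1) A T * M))
      + aliasConst κ * (convConst κ 1 * (growthConst κ (r + 1) A T * M)))
    + T * stepConst κ (r + 1) A M T + oscConst κ (r + 1) A M T

theorem one_add_pow_le_exp {c T : ℝ} (hc : 0 ≤ c) (n : ℕ) (h : n * c ≤ T) :
    (1 + c) ^ n ≤ Real.exp T := by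
  calc (1 + c) ^ n ≤ Real.exp c ^ n :=
        pow_le_pow_left₀ (by linarith) (by linarith [Real.add_one_le_exp c]) n
    _ = Real.exp (n * c) := (Real.exp_nat_mul c n).symm
    _ ≤ _ := Real.exp_le_exp.2 h

set_option maxHeartbeats 800000 in
/-- Discrete Gronwall estimate for the scheme in the interaction picture. -/
theorem InteractionFlow.scheme_error {ε S M T A τ Γ θ : ℝ} {v : ℤ → ℂ} {φ : ℝ → ℤ → ℂ}
    (h : InteractionFlow κ (r + 1) ε S M v φ) (hκ : 0 < κ) (hr : 2 ≤ r) (hε : 0 ≤ ε) (hε1 : ε ≤ 1)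
    (hτ : 0 ≤ τ) (hv : HBound κ (r + 1) v A) {Λ : Finset ℤ} (hΓ : 0 ≤ Γ) (hθ : 0 ≤ θ)
    (hΛ : ∀ l ∈ Λ, ∀ k ∈ Λ, wt κ l * ‖midPhase κ τ l k‖
      ≤ Γ * (wt κ (l - k) + wt κ k) ^ (r + 1) * ‖phase κ τ l k - 1‖)
    (hΛθ : ∀ l, l ∉ Λ → 1 ≤ θ * wt κ l) (hN0 : 0 < N) (hN : Even N) {η : ℕ → ℤ → ℂ}
    (hη0 : η 0 = aliasOp N (φ 0))
    (hη : ∀ n l, η (n + 1) l = η n l +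
      stepOp κ N (expTail v (-(Complex.I * ε) * τ) 0) (n * τ + τ / 2) (η n) l)
    {n : ℕ} (hnS : n * τ ≤ S) (hnT : n * (ε * τ) ≤ T) :
    HBound κ 1 (fun l => φ (n * τ) l - η n l)
      (consistencyConst κ r A M T * (gridTail κ N ^ r + ε * τ ^ 2 + ε * Γ + θ ^ r)
        * Real.exp (aliasConst κ * convConst κ 1 * growthConst κ (r + 1) A T * T)
        + gridTail κ N ^ r * M) := by
  have hs1 : 1 ≤ r + 1 := by omega
  have hA := hv.nonneg
  have hS : 0 ≤ S := (mul_nonneg n.cast_nonneg hτ).trans hnS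
  have hT : 0 ≤ T := (mul_nonneg n.cast_nonneg (mul_nonneg hε hτ)).trans hnT
  have hM := (h.bound 0 ⟨le_rfl, hS⟩).nonneg
  have hR := powRate_nonneg κ (r + 1) hA
  have hKa := aliasConst_nonneg hκ
  have hK1 := convConst_nonneg κ 1
  have hKs := convConst_nonneg κ (r + 1)
  have hG : 0 ≤ growthConst κ (r + 1) A T := mul_nonneg hR (Real.exp_pos _).le
  have hgt := pow_nonneg (gridTail_nonneg hκ N) r
  have hθr := pow_nonneg hθ r
  have hO := oscConst_nonneg (κ := κ) (s := r + 1) hA hM hT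
  have hL := stepConst_nonneg (κ := κ) (s := r + 1) (T := T) hA hM
  set W := expTail v (-(Complex.I * ε) * τ) 0 with hWdef
  set g := gridTail κ N ^ r with hg
  set X := g + ε * τ ^ 2 + ε * Γ + θ ^ r with hX
  set G := growthConst κ (r + 1) A T with hGdef
  set c := aliasConst κ * convConst κ 1 * G * (ε * τ) with hc
  have hετ : 0 ≤ ε * τ := mul_nonneg hε hτ
  have hc0 : 0 ≤ c := by positivity
  set a := consistencyConst κ r A M T * X with ha
  have hX0 : 0 ≤ X := by positivity
  have hCC : 0 ≤ consistencyConst κ r A M T := by unfold consistencyConst; positivity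
  have ha0 : 0 ≤ a := mul_nonneg hCC hX0
  set e : ℕ → ℤ → ℂ := fun i l => modeProj N (φ (i * τ)) l - η i l with he
  have hmem : ∀ i : ℕ, i ≤ n → (i * τ) ∈ Icc 0 S := fun i hi =>
    ⟨by positivity, le_trans (by gcongr) hnS⟩
  have hb : ∀ i : ℕ, i ≤ n → HBound κ (r + 1) (φ (i * τ)) M := fun i hi => h.bound _ (hmem i hi)
  -- The induction concerns the projected error; the discarded modes of the exact solution
  -- contribute `g * M`, added back whenever the full error is needed.
  have hfull : ∀ i : ℕ, i ≤ n → ∀ D, HBound κ 1 (e i) D →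
      HBound κ 1 (fun l => φ (i * τ) l - η i l) (D + g * M) := fun i hi D hD =>
    (hD.add ((hb i hi).sub_modeProj hκ hN0 hN)).of_norm_le fun l => le_of_eq (by
      congr 1; simp only [he]; ring)
  have hmain : ∀ i : ℕ, i ≤ n → HBound κ 1 (e i) (a * (1 + c) ^ i) := by
    intro i
    -- All earlier errors enter at once: the recursion must be summed from time zero before
    -- estimating, or the cancellation among the quadrature errors would be lost.
    induction i using Nat.strong_induction_on with
    | _ i ih =>
    intro hi
    have hiT : (i : ℝ) * (ε * τ) ≤ T := le_trans (by gcongr) hnT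
    -- decomposition of the error
    set D : ℕ → ℤ → ℂ := fun j l => φ (j * τ) l - η j l with hD
    set al : ℕ → ℤ → ℂ := fun j l => stepOp κ N W (j * τ + τ / 2) (φ (j * τ)) l
      - modeProj N (twist κ W (j * τ + τ / 2) (φ (j * τ))) l with hal
    set rem : ℕ → ℤ → ℂ := fun j l => φ (j * τ + τ) l - φ (j * τ) l
        - twist κ W (j * τ + τ / 2) (φ (j * τ)) l - midError κ ε τ v (j * τ) (φ (j * τ)) l with hrem
    have hlt : ∀ j ∈ Finset.range i, j < i := fun j hj => Finset.mem_range.1 hj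
    have hWb : ∀ j ∈ Finset.range i, HBound κ (r + 1) W (G * (ε * τ)) := fun j hj => by
      refine (hv.expTail_bound hκ hs1 _ 0).weaken ?_
      have hz : ‖-(Complex.I * ε) * (τ : ℂ)‖ = ε * τ := by
        rw [norm_mul, norm_neg_I_mul hε, Complex.norm_real, Real.norm_of_nonneg hτ]
      have h1 : ε * τ ≤ T := by
        refine le_trans (le_mul_of_one_le_left hετ ?_) hiT
        exact_mod_cast (Nat.zero_le j).trans_lt (hlt j hj)
      rw [hz, zero_add, pow_one]
      calc ε * τ * powRate κ (r + 1) A * Real.exp (ε * τ * powRate κ (r + 1) A)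
          ≤ ε * τ * powRate κ (r + 1) A * Real.exp (T * powRate κ (r + 1) A) := by gcongr
        _ = _ := by rw [hGdef, growthConst]; ring
    have hDb : ∀ j ∈ Finset.range i, HBound κ 1 (D j) (a * (1 + c) ^ j + g * M) := fun j hj =>
      hfull j ((hlt j hj).le.trans hi) _ (ih j (hlt j hj) ((hlt j hj).le.trans hi))
    have hφb : ∀ j ∈ Finset.range i, HBound κ (r + 1) (φ (j * τ)) M := fun j hj =>
      hb j ((hlt j hj).le.trans hi)
    -- Telescoping splits the error into the initial aliasing error, the propagation of previous
    -- errors, the aliasing error of each step, the `ε²τ³` remainders and the accumulated quadrature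
    -- errors.
    have hdecomp : ∀ l, e i l = e 0 l
        + ((∑ j ∈ Finset.range i, stepOp κ N W (j * τ + τ / 2) (D j) l)
          - (∑ j ∈ Finset.range i, al j l)
          + modeProj N (fun l => ∑ j ∈ Finset.range i, rem j l) l
          + modeProj N (fun l => ∑ j ∈ Finset.range i,
              midError κ ε τ v (j * τ) (φ (j * τ)) l) l) := by
      intro l
      have h1 : ∀ j ∈ Finset.range i, e (j + 1) l - e j l
          = stepOp κ N W (j * τ + τ / 2) (D j) l - al j l + modeProj N (rem j) l
            + modeProj N (midError κ ε τ v (j * τ) (φ (j * τ))) l := by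
        intro j hj
        have hφ1 := (hφb j hj).mono_index hs1
        have hη1 : HBound κ 1 (η j) (M + (a * (1 + c) ^ j + g * M)) :=
          (hφ1.sub (hDb j hj)).of_norm_le fun l => le_of_eq (by congr 1; simp only [hD]; ring)
        simp only [he, hη, hD, hal]
        rw [stepOp_sub hκ hN0 ((hWb j hj).mono_index hs1) hφ1 hη1]
        have hj1 : ((j + 1 : ℕ) : ℝ) * τ = j * τ + τ := by push_cast; ring
        rw [hj1]
        unfold modeProj
        split_ifs
        · simp only [hrem]; ring
        · ring
      have h2 := Finset.sum_range_sub (fun j => e j l) i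
      rw [Finset.sum_congr rfl h1] at h2
      simp only [Finset.sum_add_distrib, Finset.sum_sub_distrib] at h2
      have h3 : ∀ f : ℕ → ℤ → ℂ, modeProj N (fun l => ∑ j ∈ Finset.range i, f j l) l
          = ∑ j ∈ Finset.range i, modeProj N (f j) l := fun f => by
        unfold modeProj; split_ifs <;> simp
      rw [h3 rem, h3 fun j => midError κ ε τ v (j * τ) (φ (j * τ)), h2]
      ring
    -- bounds for the pieces
    have b0 : HBound κ 1 (e 0) (aliasConst κ * (g * M)) := by
      have h1 := (hb 0 (Nat.zero_le n)).aliasOp_sub_modeProj hκ hN0 hN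
      refine h1.of_norm_le fun l => le_of_eq ?_
      simp only [he, hη0, Nat.cast_zero, zero_mul]
      rw [norm_sub_rev]
    have b1 := HBound.finset_sum (Finset.range i) fun j hj =>
      HBound.stepOp_bound hκ hN0 hN ((hWb j hj).mono_index hs1) (hDb j hj) (j * τ + τ / 2)
    have b2 := HBound.finset_sum (u := al) (Finset.range i) fun j hj =>
      HBound.stepOp_sub_twist hκ hN0 hN (hWb j hj) (hφb j hj) (j * τ + τ / 2)
    have b3 := HBound.finset_sum (u := rem) (Finset.range i) fun j hj =>
      h.local_error hκ (by omega) hε hε1 hv (p := j * τ) (τ := τ) (T := T) (by positivity) hτ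
        (by
          have := (hmem (j + 1) ((hlt j hj).trans_le hi)).2
          push_cast at this; linarith)
        (by
          refine le_trans (le_mul_of_one_le_left hετ ?_) hiT
          exact_mod_cast (Nat.zero_le j).trans_lt (hlt j hj))
    have b4 := h.sum_midError hκ hε hτ hv hΓ hθ hΛ hΛθ (hmem i hi).2 hiT
    refine ((b0.add (((b1.sub b2).add b3.modeProj_bound).add b4.modeProj_bound)).weaken ?_).of_norm_le
      fun l => le_of_eq (by rw [hdecomp])
    -- The propagated errors reproduce the claimed bound minus `a`, which leaves exactly `a` for all
    -- the consistency errors.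
    have hgeom : ∑ j ∈ Finset.range i, c * (a * (1 + c) ^ j) = a * (1 + c) ^ i - a := by
      have := geom_sum_mul (1 + c) i
      rw [add_sub_cancel_left] at this
      rw [← Finset.mul_sum, ← Finset.mul_sum]
      linear_combination a * this
    have s1 : ∑ j ∈ Finset.range i, aliasConst κ * (convConst κ 1 *
          (G * (ε * τ) * (a * (1 + c) ^ j + g * M)))
        = a * (1 + c) ^ i - a + i * (ε * τ) * (aliasConst κ * (convConst κ 1 * (G * M)) * g) := by
      rw [← hgeom, ← nsmul_eq_mul, smul_mul_assoc, ← Finset.card_range i, ← Finset.sum_const,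
        Finset.card_range, ← Finset.sum_add_distrib]
      exact Finset.sum_congr rfl fun j _ => by rw [hc]; ring
    rw [s1]
    simp only [Finset.sum_const, Finset.card_range, nsmul_eq_mul]
    have p1 : 0 ≤ ε * τ ^ 2 := mul_nonneg hε (sq_nonneg τ)
    have p2 : 0 ≤ ε * Γ := mul_nonneg hε hΓ
    have hgX : g ≤ X := by linarith only [hX, p1, p2, hθr]
    have hτX : ε * τ ^ 2 ≤ X := by linarith only [hX, hgt, p2, hθr]
    have hΓX : ε * Γ + θ ^ r ≤ X := by linarith only [hX, hgt, p1]
    have t0 : aliasConst κ * (g * M) ≤ aliasConst κ * M * X := by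
      calc aliasConst κ * (g * M) = aliasConst κ * M * g := by ring
        _ ≤ _ := by gcongr
    have t1 : i * (ε * τ) * (aliasConst κ * (convConst κ 1 * (G * M)) * g)
        ≤ T * (aliasConst κ * (convConst κ 1 * (G * M)) * X) := by gcongr
    have t2 : (i : ℝ) * (aliasConst κ * (g * (convConst κ (r + 1) * (G * (ε * τ) * M))))
        ≤ T * (aliasConst κ * (convConst κ (r + 1) * (G * M)) * X) := by
      calc _ = i * (ε * τ) * (aliasConst κ * (convConst κ (r + 1) * (G * M)) * g) := by ring
        _ ≤ _ := by gcongr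
    have t3 : (i : ℝ) * (ε ^ 2 * τ ^ 3 * stepConst κ (r + 1) A M T)
        ≤ T * (stepConst κ (r + 1) A M T * X) := by
      calc _ = i * (ε * τ) * (stepConst κ (r + 1) A M T * (ε * τ ^ 2)) := by ring
        _ ≤ _ := by gcongr
    have t4 : oscConst κ (r + 1) A M T * (ε * Γ + θ ^ r) ≤ oscConst κ (r + 1) A M T * X := by
      gcongr
    -- `consistencyConst` is the sum of the constants in `t0` to `t4`.
    have hsplit : a = aliasConst κ * M * X
        + (T * (aliasConst κ * (convConst κ (r + 1) * (G * M)) * X)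
          + T * (aliasConst κ * (convConst κ 1 * (G * M)) * X))
        + T * (stepConst κ (r + 1) A M T * X) + oscConst κ (r + 1) A M T * X := by
      rw [ha, consistencyConst]; ring
    linarith only [hsplit, t0, t1, t2, t3, t4]
  refine (hfull n le_rfl _ (hmain n le_rfl)).weaken ?_
  gcongr
  refine one_add_pow_le_exp hc0 n ?_
  calc (n : ℝ) * c = aliasConst κ * convConst κ 1 * G * (n * (ε * τ)) := by rw [hc]; ring
    _ ≤ _ := by gcongr

end scheme

/-! ### Fourier coefficients on an interval -/

section fourier

variable {a b : ℝ}

theorem freq_eq (a b : ℝ) (l : ℤ) : freq a b l = freq a b 1 * l := by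
  unfold freq; push_cast; ring

theorem freq_one_pos (hab : a < b) : 0 < freq a b 1 := by
  have := sub_pos.2 hab
  have := Real.pi_pos
  unfold freq; push_cast; positivity

theorem freq_mul_sub (hab : a < b) (l : ℤ) : freq a b l * (b - a) = l * (2 * Real.pi) := by
  have := (sub_pos.2 hab).ne'
  unfold freq; field_simp

theorem wt_freq_sq (a b : ℝ) (l : ℤ) : wt (freq a b 1) l ^ 2 = 1 + freq a b l ^ 2 := by
  rw [wt_sq, ← freq_eq]

@[simp] theorem norm_fourierMode (a b : ℝ) (l : ℤ) (x : ℝ) : ‖fourierMode a b l x‖ = 1 :=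
  Complex.norm_exp_I_mul_ofReal _

theorem fourierMode_add (a b : ℝ) (j k : ℤ) (x : ℝ) :
    fourierMode a b (j + k) x = fourierMode a b j x * fourierMode a b k x := by
  unfold fourierMode
  rw [← Complex.exp_add, freq_eq a b (j + k), freq_eq a b j, freq_eq a b k]
  congr 1; push_cast; ring

theorem exp_neg_eq_fourierMode (a b : ℝ) (l : ℤ) (x : ℝ) :
    Complex.exp (-(Complex.I * ((freq a b l * (x - a) : ℝ) : ℂ))) = fourierMode a b (-l) x := by
  unfold fourierMode
  rw [freq_eq a b (-l), freq_eq a b l]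
  congr 1; push_cast; ring

@[simp] theorem fourierMode_left (a b : ℝ) (l : ℤ) : fourierMode a b l a = 1 := by
  simp [fourierMode]

theorem fourierMode_right (hab : a < b) (l : ℤ) : fourierMode a b l b = 1 := by
  unfold fourierMode
  rw [freq_mul_sub hab, Complex.exp_eq_one_iff]
  exact ⟨l, by push_cast; ring⟩

@[simp] theorem fourierMode_zero (a b x : ℝ) : fourierMode a b 0 x = 1 := by
  simp [fourierMode, freq]

theorem hasDerivAt_fourierMode (a b : ℝ) (l : ℤ) (x : ℝ) :
    HasDerivAt (fourierMode a b l) (Complex.I * (freq a b l : ℂ) * fourierMode a b l x) x := by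
  have h1 : HasDerivAt (fun y : ℝ => ((freq a b l * (y - a) : ℝ) : ℂ)) (freq a b l : ℂ) x := by
    have := (((hasDerivAt_id x).sub_const a).const_mul (freq a b l)).ofReal_comp
    simpa using this
  have h2 := (h1.const_mul Complex.I).cexp
  unfold fourierMode
  rw [mul_comm]
  exact h2

theorem continuous_fourierMode (a b : ℝ) (l : ℤ) : Continuous (fourierMode a b l) := by
  unfold fourierMode; fun_prop

theorem fourierCoef_eq (a b : ℝ) (u : ℝ → ℂ) (l : ℤ) :
    fourierCoef a b u l = ((1 / (b - a) : ℝ) : ℂ) * ∫ x in a..b, u x * fourierMode a b (-l) x := by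
  unfold fourierCoef
  simp only [exp_neg_eq_fourierMode]

theorem fourierCoef_congr (hab : a < b) {u v : ℝ → ℂ} (h : ∀ x ∈ Ioo a b, u x = v x) (l : ℤ) :
    fourierCoef a b u l = fourierCoef a b v l := by
  rw [fourierCoef_eq, fourierCoef_eq]
  congr 1
  exact intervalIntegral.integral_congr_Ioo_of_le hab.le fun x hx => by simp only [h x hx]

theorem integral_fourierMode (hab : a < b) (l : ℤ) :
    ∫ x in a..b, fourierMode a b l x = if l = 0 then ((b - a : ℝ) : ℂ) else 0 := by
  split_ifs with hl
  · subst hl; simp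
  · have hf : (freq a b l : ℂ) ≠ 0 := by
      rw [freq_eq]
      have := (freq_one_pos hab).ne'
      exact_mod_cast mul_ne_zero this (by exact_mod_cast hl)
    have hc : Complex.I * (freq a b l : ℂ) ≠ 0 := mul_ne_zero Complex.I_ne_zero hf
    have h1 : ∫ x in a..b, Complex.I * (freq a b l : ℂ) * fourierMode a b l x
        = fourierMode a b l b - fourierMode a b l a :=
      intervalIntegral.integral_eq_sub_of_hasDerivAt (fun x _ => hasDerivAt_fourierMode a b l x)
        ((continuous_const.mul (continuous_fourierMode a b l)).intervalIntegrable _ _)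
    rw [intervalIntegral.integral_const_mul, fourierMode_right hab, fourierMode_left, sub_self] at h1
    exact (mul_eq_zero.1 h1).resolve_left hc

/-- The Fourier coefficients of an absolutely convergent Fourier series. -/
theorem fourierCoef_of_series (hab : a < b) {u : ℝ → ℂ} {c : ℤ → ℂ} (hc : Summable fun l => ‖c l‖)
    (hu : ∀ x ∈ Ioo a b, u x = ∑' p, c p * fourierMode a b p x) (l : ℤ) :
    fourierCoef a b u l = c l := by
  rw [fourierCoef_congr hab hu, fourierCoef_eq]
  have h1 : HasSum (fun p => ∫ x in a..b, c p * fourierMode a b p x * fourierMode a b (-l) x)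
      (∫ x in a..b, (∑' p, c p * fourierMode a b p x) * fourierMode a b (-l) x) := by
    refine intervalIntegral.hasSum_integral_of_dominated_convergence (fun p _ => ‖c p‖)
      (fun p => ?_) (fun p => ?_) ?_ ?_ ?_
    · exact ((continuous_const.mul (continuous_fourierMode a b p)).mul
        (continuous_fourierMode a b (-l))).aestronglyMeasurable
    · exact Filter.Eventually.of_forall fun x _ => by simp
    · exact Filter.Eventually.of_forall fun x _ => hc
    · exact intervalIntegrable_const
    · refine Filter.Eventually.of_forall fun x _ => HasSum.mul_right _ (Summable.hasSum ?_)
      exact Summable.of_norm (by simpa using hc)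
  have h2 : ∀ p, ∫ x in a..b, c p * fourierMode a b p x * fourierMode a b (-l) x
      = if p = l then ((b - a : ℝ) : ℂ) * c l else 0 := by
    intro p
    simp only [mul_assoc, ← fourierMode_add]
    rw [intervalIntegral.integral_const_mul, integral_fourierMode hab]
    by_cases h : p = l
    · subst h; simp [mul_comm]
    · rw [if_neg h, if_neg (by omega), mul_zero]
  simp only [h2] at h1
  rw [← h1.tsum_eq, tsum_ite_eq]
  have : ((b - a : ℝ) : ℂ) ≠ 0 := by exact_mod_cast (sub_pos.2 hab).ne'
  push_cast at this ⊢
  field_simp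

theorem fourierCoef_eq_fourierCoeffOn (hab : a < b) (u : ℝ → ℂ) (l : ℤ) :
    fourierCoef a b u l = fourierCoeffOn (sub_pos.2 hab) (fun y => u (y + a)) l := by
  rw [fourierCoeffOn_eq_integral, fourierCoef_eq, Complex.real_smul, sub_zero]
  congr 1
  have h := intervalIntegral.integral_comp_add_right (a := 0) (b := b - a)
    (fun x => u x * fourierMode a b (-l) x) a
  rw [zero_add, sub_add_cancel] at h
  rw [← h]
  refine intervalIntegral.integral_congr fun y _ => ?_
  simp only [smul_eq_mul]
  rw [mul_comm]
  congr 1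
  rw [fourier_coe_apply, fourierMode]
  congr 1
  unfold freq
  push_cast
  ring

/-- Bessel's inequality in qualitative form. -/
theorem summable_norm_fourierCoef_sq (hab : a < b) {u : ℝ → ℂ}
    (hu : MemLp u 2 (volume.restrict (Ioc a b))) :
    Summable fun l => ‖fourierCoef a b u l‖ ^ 2 := by
  simp only [fourierCoef_eq_fourierCoeffOn hab]
  refine (hasSum_sq_fourierCoeffOn (sub_pos.2 hab) ?_).summable
  have hmp := (measurePreserving_add_right volume a).restrict_preimage
    (measurableSet_Ioc (a := a) (b := b))
  rw [Set.preimage_add_const_Ioc, sub_self] at hmp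
  exact hu.comp_measurePreserving hmp

/-- Periodicity makes the lift to the circle continuous, and summable coefficients then give
pointwise convergence of its Fourier series. -/
theorem hasSum_fourierCoef (hab : a < b) {u : ℝ → ℂ} (hc : ContinuousOn u (Icc a b))
    (hper : u a = u b) (hs : Summable fun l => ‖fourierCoef a b u l‖) {x : ℝ} (hx : x ∈ Icc a b) :
    HasSum (fun l => fourierCoef a b u l * fourierMode a b l x) (u x) := by
  have hL : 0 < b - a := sub_pos.2 hab
  have := Fact.mk hL
  set f : ℝ → ℂ := fun y => u (y + a) with hf
  have hfc : Continuous (AddCircle.liftIco (b - a) 0 f) := by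
    refine AddCircle.liftIco_zero_continuous (by simp [hf, hper]) ?_
    exact hc.comp (continuous_add_const a).continuousOn fun y hy =>
      ⟨by linarith [hy.1], by linarith [hy.2]⟩
  let F : C(AddCircle (b - a), ℂ) := ⟨_, hfc⟩
  have hco : ∀ l, fourierCoeff F l = fourierCoef a b u l := fun l => by
    rw [fourierCoef_eq_fourierCoeffOn hab]
    have := fourierCoeff_liftIco_eq (T := b - a) (a := 0) f l
    simp only [zero_add] at this
    exact this
  have hsum : Summable (fourierCoeff F) := by
    rw [funext hco]; exact hs.of_norm
  have hpt : ∀ y ∈ Ico (0 : ℝ) (b - a),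
      HasSum (fun l => fourierCoef a b u l * fourierMode a b l (y + a)) (u (y + a)) := by
    intro y hy
    have h := has_pointwise_sum_fourier_series_of_summable hsum (y : AddCircle (b - a))
    have h1 : F (y : AddCircle (b - a)) = u (y + a) := AddCircle.liftIco_zero_coe_apply (f := f) hy
    rw [h1] at h
    refine h.congr_fun fun l => ?_
    rw [hco, smul_eq_mul, fourier_coe_apply, fourierMode]
    congr 2
    unfold freq
    push_cast
    ring
  rcases hx.2.lt_or_eq with h | h
  · have := hpt (x - a) ⟨by linarith [hx.1], by linarith⟩
    simpa using this
  -- The circle is parametrised by a half-open interval, so the value at `b` is read off at `a`.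
  · have := hpt 0 ⟨le_rfl, hL⟩
    simp only [zero_add, fourierMode_left] at this
    rw [h, ← hper]
    simpa only [fourierMode_right hab] using this

/-- Fourier coefficients of a weak derivative. -/
theorem fourierCoef_of_primitive (hab : a < b) {g g' : ℝ → ℂ}
    (hg' : IntegrableOn g' (Ioc a b))
    (hprim : ∀ x ∈ Icc a b, g x = g a + ∫ y in a..x, g' y) (hper : g a = g b) (l : ℤ) :
    fourierCoef a b g' l = Complex.I * (freq a b l : ℂ) * fourierCoef a b g l := by
  set E := fourierMode a b (-l) with hE
  set E' : ℝ → ℂ := fun x => Complex.I * (freq a b (-l) : ℂ) * E x with hE'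
  have hEd : ∀ x, HasDerivAt E (E' x) x := hasDerivAt_fourierMode a b (-l)
  have hEc : Continuous E := continuous_fourierMode a b (-l)
  have hE'c : Continuous E' := continuous_const.mul hEc
  have hEb : E b = 1 := fourierMode_right hab _
  have hEa : E a = 1 := fourierMode_left _ _ _
  -- `g'` is merely integrable, so integration by parts is done by writing `E y` as `1` minus the
  -- integral of `E'` over `[y, b]` and exchanging integrals.
  have hftc : ∀ y, ∫ x in y..b, E' x = 1 - E y := fun y => by
    rw [intervalIntegral.integral_eq_sub_of_hasDerivAt (fun x _ => hEd x)
      (hE'c.intervalIntegrable _ _), hEb]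
  have hg'i : IntervalIntegrable g' volume a b :=
    (intervalIntegrable_iff_integrableOn_Ioc_of_le hab.le).2 hg'
  -- Fubini on the triangle
  have hF : Integrable (Function.uncurry fun x y => {z : ℝ × ℝ | z.2 ≤ z.1}.indicator
      (fun z => E' z.1 * g' z.2) (x, y))
      ((volume.restrict (Ioc a b)).prod (volume.restrict (Ioc a b))) := by
    have h1 : Integrable (fun z : ℝ × ℝ => E' z.1 * g' z.2)
        ((volume.restrict (Ioc a b)).prod (volume.restrict (Ioc a b))) :=
      Integrable.mul_prod ((hE'c.integrableOn_Icc).mono_set Ioc_subset_Icc_self) hg'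
    exact h1.indicator (measurableSet_le measurable_snd measurable_fst)
  have hswap := integral_integral_swap hF
  have hl : ∀ x ∈ Ioc a b, ∫ y in Ioc a b, {z : ℝ × ℝ | z.2 ≤ z.1}.indicator
      (fun z => E' z.1 * g' z.2) (x, y) = E' x * (g x - g a) := by
    intro x hx
    have h1 : (fun y => {z : ℝ × ℝ | z.2 ≤ z.1}.indicator (fun z => E' z.1 * g' z.2) (x, y))
        = (Iic x).indicator fun y => E' x * g' y := by
      funext y; simp [Set.indicator, mem_Iic]
    rw [h1, setIntegral_indicator measurableSet_Iic, Ioc_inter_Iic, min_eq_right hx.2,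
      integral_const_mul, hprim x ⟨hx.1.le, hx.2⟩, intervalIntegral.integral_of_le hx.1.le,
      add_sub_cancel_left]
  have hr : ∀ y ∈ Ioc a b, ∫ x in Ioc a b, {z : ℝ × ℝ | z.2 ≤ z.1}.indicator
      (fun z => E' z.1 * g' z.2) (x, y) = g' y - g' y * E y := by
    intro y hy
    have h1 : (fun x => {z : ℝ × ℝ | z.2 ≤ z.1}.indicator (fun z => E' z.1 * g' z.2) (x, y))
        = (Ici y).indicator fun x => E' x * g' y := by
      funext x; simp [Set.indicator, mem_Ici]
    have h2 : Ioc a b ∩ Ici y = Icc y b := by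
      ext x; simp only [mem_inter_iff, mem_Ioc, mem_Ici, mem_Icc]
      exact ⟨fun h => ⟨h.2, h.1.2⟩, fun h => ⟨⟨hy.1.trans_le h.1, h.2⟩, h.1⟩⟩
    rw [h1, setIntegral_indicator measurableSet_Ici, h2, integral_mul_const,
      integral_Icc_eq_integral_Ioc, ← intervalIntegral.integral_of_le hy.2, hftc]
    ring
  rw [setIntegral_congr_fun measurableSet_Ioc hl, setIntegral_congr_fun measurableSet_Ioc hr,
    ← intervalIntegral.integral_of_le hab.le, ← intervalIntegral.integral_of_le hab.le] at hswap
  have hgc : ContinuousOn g (Icc a b) := by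
    have h1 : ContinuousOn (fun x => g a + ∫ y in a..x, g' y) (Icc a b) := by
      have := intervalIntegral.continuousOn_primitive_interval' hg'i left_mem_uIcc
      rw [uIcc_of_le hab.le] at this
      exact continuousOn_const.add this
    exact h1.congr hprim
  have hgi : IntervalIntegrable (fun x => E' x * g x) volume a b :=
    (hE'c.continuousOn.mul hgc).intervalIntegrable_of_Icc hab.le
  have hg'E : IntervalIntegrable (fun x => g' x * E x) volume a b :=
    hg'i.mul_continuousOn hEc.continuousOn
  have h3 : ∫ x in a..b, E' x * (g x - g a) = ∫ x in a..b, E' x * g x := by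
    simp only [mul_sub]
    have hi : IntervalIntegrable (fun x => E' x * g a) volume a b :=
      (hE'c.mul continuous_const).intervalIntegrable _ _
    rw [intervalIntegral.integral_sub hgi hi, intervalIntegral.integral_mul_const,
      hftc, hEa]
    simp
  have h4 : ∫ x in a..b, g' x = 0 := by
    have := hprim b (right_mem_Icc.2 hab.le)
    rw [← hper] at this
    simpa using this.symm
  rw [h3, intervalIntegral.integral_sub hg'i hg'E, h4, zero_sub] at hswap
  have h5 : ∫ x in a..b, E' x * g x
      = Complex.I * (freq a b (-l) : ℂ) * ∫ x in a..b, g x * E x := by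
    rw [← intervalIntegral.integral_const_mul]
    refine intervalIntegral.integral_congr fun x _ => ?_
    simp only [hE']; ring
  rw [h5] at hswap
  rw [fourierCoef_eq, fourierCoef_eq, ← hE]
  have h6 : (freq a b (-l) : ℂ) = -(freq a b l : ℂ) := by
    rw [freq_eq a b (-l), freq_eq a b l]; push_cast; ring
  rw [h6] at hswap
  linear_combination ((1 / (b - a) : ℝ) : ℂ) * hswap

end fourier

/-! ### Periodic Sobolev functions -/

section sobolev

variable {a b : ℝ} {m : ℕ} {u : ℝ → ℂ}

theorem MemLp.integrableOn_Ioc {g : ℝ → ℂ} (h : MemLp g 2 (volume.restrict (Ioc a b))) :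
    IntegrableOn g (Ioc a b) := h.integrable one_le_two

theorem continuousOn_of_primitive (hab : a < b) {g g' : ℝ → ℂ} (hg' : IntegrableOn g' (Ioc a b))
    (hprim : ∀ x ∈ Icc a b, g x = g a + ∫ y in a..x, g' y) : ContinuousOn g (Icc a b) := by
  have h := intervalIntegral.continuousOn_primitive_interval'
    ((intervalIntegrable_iff_integrableOn_Ioc_of_le (μ := volume) hab.le).2 hg') left_mem_uIcc
  rw [uIcc_of_le hab.le] at h
  exact (continuousOn_const.add h).congr hprim

theorem hasDerivAt_of_primitive {g g' : ℝ → ℂ} (hc : ContinuousOn g' (Icc a b))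
    (hprim : ∀ x ∈ Icc a b, g x = g a + ∫ y in a..x, g' y) {x : ℝ} (hx : x ∈ Ioo a b) :
    HasDerivAt g (g' x) x := by
  have hnhds : Icc a b ∈ nhds x := Icc_mem_nhds hx.1 hx.2
  have hi : IntervalIntegrable g' volume a x :=
    (hc.mono (Icc_subset_Icc_right hx.2.le)).intervalIntegrable_of_Icc hx.1.le
  have h1 := intervalIntegral.integral_hasDerivAt_right hi
    (hc.stronglyMeasurableAtFilter_nhdsWithin measurableSet_Icc x |>.filter_mono
      (by rw [nhdsWithin_eq_nhds.2 hnhds])) (hc.continuousAt hnhds)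
  refine (h1.const_add (g a)).congr_of_eventuallyEq ?_
  filter_upwards [hnhds] with y hy using hprim y hy

theorem MemHper.continuousOn (hab : a < b) (hm : 1 ≤ m) (h : MemHper a b m u) :
    ContinuousOn u (Icc a b) := by
  obtain ⟨g, h0, hL, hp, -⟩ := h
  exact (continuousOn_of_primitive hab (MemLp.integrableOn_Ioc (hL 1 hm)) (hp 0 hm)).congr
    fun x hx => (h0 x hx).symm

theorem MemHper.periodic (hab : a < b) (hm : 1 ≤ m) (h : MemHper a b m u) : u a = u b := by
  obtain ⟨g, h0, -, -, hper⟩ := h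
  rw [← h0 a (left_mem_Icc.2 hab.le), ← h0 b (right_mem_Icc.2 hab.le)]
  exact hper 0 hm

theorem fourierCoef_iterate (hab : a < b) {g : ℕ → ℝ → ℂ}
    (hL : ∀ k ≤ m, MemLp (g k) 2 (volume.restrict (Ioc a b)))
    (hp : ∀ k < m, ∀ x ∈ Icc a b, g k x = g k a + ∫ y in a..x, g (k + 1) y)
    (hper : ∀ k < m, g k a = g k b) (l : ℤ) :
    ∀ k ≤ m, fourierCoef a b (g k) l
      = (Complex.I * (freq a b l : ℂ)) ^ k * fourierCoef a b (g 0) l := by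
  intro k
  induction k with
  | zero => simp
  | succ k ih =>
    intro hk
    rw [fourierCoef_of_primitive hab (MemLp.integrableOn_Ioc (hL (k + 1) hk)) (hp k hk)
      (hper k hk), ih (by omega), pow_succ]
    ring

/-- Bessel is needed only for the function and its top derivative, because `(1 + μ²)^m ≤ 2^m (1 +
μ^(2m))`. -/
theorem MemHper.summable (hab : a < b) (h : MemHper a b m u) :
    Summable fun l => (wt (freq a b 1) l ^ m * ‖fourierCoef a b u l‖) ^ 2 := by
  obtain ⟨g, h0, hL, hp, hper⟩ := h
  have hu : ∀ l, fourierCoef a b u l = fourierCoef a b (g 0) l :=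
    fourierCoef_congr hab fun x hx => (h0 x (Ioo_subset_Icc_self hx)).symm
  have h1 := summable_norm_fourierCoef_sq hab (hL 0 (Nat.zero_le m))
  have h2 := summable_norm_fourierCoef_sq hab (hL m le_rfl)
  refine Summable.of_nonneg_of_le (fun _ => sq_nonneg _) (fun l => ?_)
    ((h1.add h2).mul_left (2 ^ m))
  rw [fourierCoef_iterate hab hL hp hper l m le_rfl, hu, norm_mul, norm_pow, norm_mul,
    Complex.norm_I, one_mul, Complex.norm_real, mul_pow, mul_pow, ← pow_mul, ← pow_mul, mul_comm m 2,
    pow_mul, pow_mul, wt_freq_sq, Real.norm_eq_abs, sq_abs]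
  have h3 := add_pow_le_two_pow_mul zero_le_one (sq_nonneg (freq a b l)) m
  rw [one_pow] at h3
  calc (1 + freq a b l ^ 2) ^ m * ‖fourierCoef a b (g 0) l‖ ^ 2
      ≤ (2 ^ m * (1 + (freq a b l ^ 2) ^ m)) * ‖fourierCoef a b (g 0) l‖ ^ 2 := by gcongr
    _ = _ := by ring

theorem wt_mul_sq (u : ℝ → ℂ) (l : ℤ) : (wt (freq a b 1) l ^ m * ‖fourierCoef a b u l‖) ^ 2
    = (1 + freq a b l ^ 2) ^ m * ‖fourierCoef a b u l‖ ^ 2 := by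
  rw [mul_pow, ← pow_mul, mul_comm m 2, pow_mul, wt_freq_sq]

/-- Membership matters: a divergent sum inside `hperNorm` would take the default value `0` and bound
nothing. Summability makes the norm dominate every partial sum. -/
theorem MemHper.hBound (hab : a < b) (h : MemHper a b m u) :
    HBound (freq a b 1) m (fourierCoef a b u) (hperNorm a b m u) := by
  have hs := h.summable hab
  refine ⟨Real.sqrt_nonneg _, fun F => ?_⟩
  have h1 := hs.sum_le_tsum F fun l _ => sq_nonneg _
  simp only [wt_mul_sq] at h1 ⊢
  rw [hperNorm, Real.sq_sqrt (tsum_nonneg fun l => by positivity)]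
  exact h1

theorem HBound.hperNorm_le {B : ℝ} (h : HBound (freq a b 1) m (fourierCoef a b u) B) :
    hperNorm a b m u ≤ B := by
  refine Real.sqrt_le_iff.2 ⟨h.nonneg, ?_⟩
  refine Real.tsum_le_of_sum_le (fun l => by positivity) fun F => ?_
  have := h.2 F
  simp only [wt_mul_sq] at this
  exact this

theorem MemHper.hasSum (hab : a < b) (hm : 1 ≤ m) (h : MemHper a b m u) {x : ℝ}
    (hx : x ∈ Icc a b) : HasSum (fun l => fourierCoef a b u l * fourierMode a b l x) (u x) :=
  hasSum_fourierCoef hab (h.continuousOn hab hm) (h.periodic hab hm)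
    ((h.hBound hab).summable (freq_one_pos hab) hm) hx

theorem MemHper.norm_le (hab : a < b) (hm : 1 ≤ m) (h : MemHper a b m u) {x : ℝ}
    (hx : x ∈ Icc a b) : ‖u x‖ ≤ embConst (freq a b 1) * hperNorm a b m u := by
  have h1 := h.hBound hab
  have hs := h1.summable (freq_one_pos hab) hm
  rw [← (h.hasSum hab hm hx).tsum_eq]
  refine (norm_tsum_le_tsum_norm (by simpa using hs)).trans ?_
  simpa using h1.tsum_norm_le (freq_one_pos hab) hm

/-- The Fourier coefficients of a product. -/
theorem fourierCoef_mul (hab : a < b) {v : ℝ → ℂ} {m' : ℕ} (hm : 1 ≤ m) (hm' : 1 ≤ m')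
    (hv : MemHper a b m' v) (hu : MemHper a b m u) (l : ℤ) :
    fourierCoef a b (fun x => v x * u x) l
      = seqConv (fourierCoef a b v) (fourierCoef a b u) l := by
  have hκ := freq_one_pos hab
  have hv1 := (hv.hBound hab).summable hκ hm'
  have hu1 := (hu.hBound hab).summable hκ hm
  refine fourierCoef_of_series hab ?_ (fun x hx => ?_) l
  · simpa using (summable_mul_seqConv hv1 hu1 (G := fun _ => 1) (C := 1) (by simp)).norm
  · have hx' := Ioo_subset_Icc_self hx
    have h1 := tsum_character_seqConv hv1 hu1 (χ := fun l => fourierMode a b l x) (by simp)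
      (fun j k => fourierMode_add a b j k x)
    have h2 := (hv.hasSum hab hm' hx').tsum_eq
    have h3 := (hu.hasSum hab hm hx').tsum_eq
    simp only [mul_comm (fourierCoef _ _ _ _)] at h2 h3
    rw [h2, h3] at h1
    rw [← h1]
    exact tsum_congr fun p => mul_comm _ _

end sobolev

/-! ### The Schrödinger flow in the interaction picture -/

section solution

variable {a b : ℝ} {m : ℕ} {V : ℝ → ℝ} {ε S M : ℝ} {ψ₀ : ℝ → ℂ} {ψ : ℝ → ℝ → ℂ}

theorem RegularityBound.hBound (hab : a < b) (h : RegularityBound a b S m M ψ) {t : ℝ}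
    (ht : t ∈ Icc 0 S) : HBound (freq a b 1) m (fourierCoef a b (ψ t)) M :=
  ((h.mem t ht).hBound hab).weaken (h.norm_le t ht)

theorem RegularityBound.nonneg (h : RegularityBound a b S m M ψ) (hS : 0 ≤ S) : 0 ≤ M :=
  (Real.sqrt_nonneg _).trans (h.norm_le 0 ⟨le_rfl, hS⟩)

theorem RegularityBound.norm_le_const (hab : a < b) (hm : 1 ≤ m) (h : RegularityBound a b S m M ψ)
    {t x : ℝ} (ht : t ∈ Icc 0 S) (hx : x ∈ Icc a b) : ‖ψ t x‖ ≤ embConst (freq a b 1) * M :=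
  ((h.mem t ht).norm_le hab hm hx).trans
    (mul_le_mul_of_nonneg_left (h.norm_le t ht) (embConst_nonneg _))

theorem continuousOn_fourierCoef (hab : a < b) (hm : 1 ≤ m)
    (hψ : IsSchrodingerSolution a b V ε S ψ₀ ψ) (h : RegularityBound a b S m M ψ) (l : ℤ) :
    ContinuousOn (fun t => fourierCoef a b (ψ t) l) (Icc 0 S) := by
  simp only [fourierCoef_eq]
  refine continuousOn_const.mul fun t ht => ?_
  refine intervalIntegral.continuousWithinAt_of_dominated_interval
    (bound := fun _ => embConst (freq a b 1) * M) ?_ ?_ intervalIntegrable_const ?_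
  · filter_upwards [self_mem_nhdsWithin] with r hr
    rw [uIoc_of_le hab.le]
    refine ContinuousOn.aestronglyMeasurable ?_ measurableSet_Ioc
    exact (((h.mem r hr).continuousOn hab hm).mono Ioc_subset_Icc_self).mul
      (continuous_fourierMode a b (-l)).continuousOn
  · filter_upwards [self_mem_nhdsWithin] with r hr
    refine Filter.Eventually.of_forall fun x hx => ?_
    rw [uIoc_of_le hab.le] at hx
    rw [norm_mul, norm_fourierMode, mul_one]
    exact h.norm_le_const hab hm hr (Ioc_subset_Icc_self hx)
  · refine Filter.Eventually.of_forall fun x hx => ?_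
    rw [uIoc_of_le hab.le] at hx
    exact (hψ.continuous_time x (Ioc_subset_Icc_self hx) t ht).mul continuousWithinAt_const

/-- Differentiation under the integral. The dominating constant is the sup bound on `∂_t ψ` obtained
by embedding `H^(m-2)`, which requires `m - 2 ≥ 1`. The equation holds only inside the interval, and
the endpoint `b` is a null set. -/
theorem hasDerivAt_fourierCoef (hab : a < b) (hm : 3 ≤ m)
    (hψ : IsSchrodingerSolution a b V ε S ψ₀ ψ) (h : RegularityBound a b S m M ψ) (l : ℤ)
    {t : ℝ} (ht : t ∈ Ioo 0 S) :
    HasDerivAt (fun t => fourierCoef a b (ψ t) l)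
      (fourierCoef a b (fun x => deriv (fun s => ψ s x) t) l) t := by
  have hm2 : 1 ≤ m - 2 := by omega
  simp only [fourierCoef_eq]
  refine HasDerivAt.const_mul _ ?_
  have hnhds : Ioo 0 S ∈ nhds t := Ioo_mem_nhds ht.1 ht.2
  have hI : ∀ᵐ x : ℝ, x ∈ uIoc a b → x ∈ Ioo a b := by
    have h1 : ∀ᵐ x : ℝ, x ≠ b := by simp [ae_iff, measure_singleton]
    filter_upwards [h1] with x hx hx'
    rw [uIoc_of_le hab.le] at hx'
    exact ⟨hx'.1, lt_of_le_of_ne hx'.2 hx⟩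
  refine (intervalIntegral.hasDerivAt_integral_of_dominated_loc_of_deriv_le
    (F := fun t x => ψ t x * fourierMode a b (-l) x)
    (F' := fun t x => deriv (fun s => ψ s x) t * fourierMode a b (-l) x)
    (bound := fun _ => embConst (freq a b 1) * M) hnhds ?_ ?_ ?_ ?_
    intervalIntegrable_const ?_).2
  · filter_upwards [hnhds] with r hr
    rw [uIoc_of_le hab.le]
    refine ContinuousOn.aestronglyMeasurable ?_ measurableSet_Ioc
    exact (((h.mem r (Ioo_subset_Icc_self hr)).continuousOn hab (by omega)).mono
      Ioc_subset_Icc_self).mul (continuous_fourierMode a b (-l)).continuousOn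
  · exact (((h.mem t (Ioo_subset_Icc_self ht)).continuousOn hab (by omega)).mul
      (continuous_fourierMode a b (-l)).continuousOn).intervalIntegrable_of_Icc hab.le
  · rw [uIoc_of_le hab.le]
    refine ContinuousOn.aestronglyMeasurable ?_ measurableSet_Ioc
    exact (((h.mem_deriv t ht).continuousOn hab hm2).mono Ioc_subset_Icc_self).mul
      (continuous_fourierMode a b (-l)).continuousOn
  · refine Filter.Eventually.of_forall fun x hx r hr => ?_
    rw [uIoc_of_le hab.le] at hx
    rw [norm_mul, norm_fourierMode, mul_one]
    exact ((h.mem_deriv r hr).norm_le hab hm2 (Ioc_subset_Icc_self hx)).trans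
      (mul_le_mul_of_nonneg_left (h.norm_deriv_le r hr) (embConst_nonneg _))
  · filter_upwards [hI] with x hx hx' r hr
    exact (hψ.differentiable_time r hr x (hx hx')).hasDerivAt.mul_const _

/-- For `m ≥ 3` the second weak derivative is continuous and agrees with the classical one inside
the interval. The equation thus passes to Fourier coefficients, with the potential acting by
convolution. -/
theorem fourierCoef_deriv (hab : a < b) (hm : 3 ≤ m) {m' : ℕ} (hm' : 1 ≤ m')
    (hV : MemHper a b m' fun x => (V x : ℂ))
    (hψ : IsSchrodingerSolution a b V ε S ψ₀ ψ) (h : RegularityBound a b S m M ψ) (l : ℤ)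
    {t : ℝ} (ht : t ∈ Ioo 0 S) :
    fourierCoef a b (fun x => deriv (fun s => ψ s x) t) l
      = -(Complex.I * (freq a b l : ℂ) ^ 2) * fourierCoef a b (ψ t) l
        - Complex.I * ε * seqConv (fourierCoef a b fun x => (V x : ℂ))
            (fourierCoef a b (ψ t)) l := by
  have htS := Ioo_subset_Icc_self ht
  have hmem := h.mem t htS
  obtain ⟨g, h0, hL, hp, hper⟩ := id hmem
  have hu : fourierCoef a b (ψ t) l = fourierCoef a b (g 0) l :=
    fourierCoef_congr hab (fun x hx => (h0 x (Ioo_subset_Icc_self hx)).symm) l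
  have hc : ∀ k < m, ContinuousOn (g k) (Icc a b) := fun k hk =>
    continuousOn_of_primitive hab (MemLp.integrableOn_Ioc (hL (k + 1) hk)) (hp k hk)
  have hd0 : ∀ x ∈ Ioo a b, HasDerivAt (ψ t) (g 1 x) x := fun x hx => by
    refine (hasDerivAt_of_primitive (hc 1 (by omega)) (hp 0 (by omega)) hx).congr_of_eventuallyEq ?_
    filter_upwards [Icc_mem_nhds hx.1 hx.2] with y hy using (h0 y hy).symm
  have hd2 : ∀ x ∈ Ioo a b, iteratedDeriv 2 (ψ t) x = g 2 x := fun x hx => by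
    rw [iteratedDeriv_succ, iteratedDeriv_one]
    have h1 : deriv (ψ t) =ᶠ[nhds x] g 1 := by
      filter_upwards [Ioo_mem_nhds hx.1 hx.2] with y hy using (hd0 y hy).deriv
    rw [h1.deriv_eq]
    exact (hasDerivAt_of_primitive (hc 2 (by omega)) (hp 1 (by omega)) hx).deriv
  have heq : ∀ x ∈ Ioo a b, deriv (fun s => ψ s x) t
      = Complex.I * g 2 x - Complex.I * ε * ((V x : ℂ) * ψ t x) := fun x hx => by
    have h1 := hψ.equation t ht x hx
    rw [hd2 x hx] at h1
    linear_combination (-Complex.I) * h1 + deriv (fun s => ψ s x) t * Complex.I_mul_I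
  rw [fourierCoef_congr hab heq]
  have hcE : Continuous (fourierMode a b (-l)) := continuous_fourierMode a b (-l)
  have i1 : IntervalIntegrable (fun x => g 2 x * fourierMode a b (-l) x) volume a b :=
    ((hc 2 (by omega)).mul hcE.continuousOn).intervalIntegrable_of_Icc hab.le
  have i2 : IntervalIntegrable (fun x => (V x : ℂ) * ψ t x * fourierMode a b (-l) x) volume a b :=
    (((hV.continuousOn hab hm').mul (hmem.continuousOn hab (by omega))).mul
      hcE.continuousOn).intervalIntegrable_of_Icc hab.le
  have hlin : fourierCoef a b
      (fun x => Complex.I * g 2 x - Complex.I * ε * ((V x : ℂ) * ψ t x)) l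
      = Complex.I * fourierCoef a b (g 2) l
        - Complex.I * ε * fourierCoef a b (fun x => (V x : ℂ) * ψ t x) l := by
    simp only [fourierCoef_eq]
    have h1 : ∀ x, (Complex.I * g 2 x - Complex.I * ε * ((V x : ℂ) * ψ t x))
        * fourierMode a b (-l) x = Complex.I * (g 2 x * fourierMode a b (-l) x)
          - Complex.I * ε * ((V x : ℂ) * ψ t x * fourierMode a b (-l) x) := fun x => by ring
    simp only [h1]
    rw [intervalIntegral.integral_sub (i1.const_mul _) (i2.const_mul _),
      intervalIntegral.integral_const_mul, intervalIntegral.integral_const_mul]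
    ring
  rw [hlin, fourierCoef_iterate hab hL hp hper l 2 (by omega), ← hu,
    fourierCoef_mul hab (by omega) hm' hV hmem, mul_pow, Complex.I_sq]
  ring

/-- The Fourier coefficients of the solution in the interaction picture. -/
def interaction (a b : ℝ) (ψ : ℝ → ℝ → ℂ) (t : ℝ) (l : ℤ) : ℂ :=
  phase (freq a b 1) t l 0 * fourierCoef a b (ψ t) l

theorem hasDerivAt_phase_zero (κ : ℝ) (l : ℤ) (t : ℝ) :
    HasDerivAt (fun t => phase κ t l 0) (Complex.I * ((κ * l : ℝ) : ℂ) ^ 2 * phase κ t l 0) t := by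
  have h1 : HasDerivAt (fun t : ℝ => Complex.I * ((t * mismatch κ l 0 : ℝ) : ℂ))
      (Complex.I * (mismatch κ l 0 : ℂ)) t := by
    have := (((hasDerivAt_id t).mul_const (mismatch κ l 0)).ofReal_comp).const_mul Complex.I
    simpa using this
  have h2 := h1.cexp
  have h3 : (mismatch κ l 0 : ℂ) = ((κ * l : ℝ) : ℂ) ^ 2 := by
    unfold mismatch; push_cast; ring
  rw [h3] at h2
  unfold phase
  rw [mul_comm]
  exact h2

/-- A regular solution gives a flow in the interaction picture. -/
theorem interactionFlow_of_solution (hab : a < b) (hm : 3 ≤ m) {m' : ℕ} (hm' : 1 ≤ m')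
    (hV : MemHper a b m' fun x => (V x : ℂ))
    (hψ : IsSchrodingerSolution a b V ε S ψ₀ ψ) (h : RegularityBound a b S m M ψ) :
    InteractionFlow (freq a b 1) m ε S M (fourierCoef a b fun x => (V x : ℂ))
      (interaction a b ψ) := by
  have hκ := freq_one_pos hab
  have hb : ∀ t ∈ Icc 0 S, HBound (freq a b 1) m (interaction a b ψ t) M := fun t ht =>
    (h.hBound hab ht).phase_mul t
  have hc : ∀ l, ContinuousOn (fun t => interaction a b ψ t l) (Icc 0 S) := fun l =>
    (continuous_phase _ l 0).continuousOn.mul (continuousOn_fourierCoef hab (by omega) hψ h l)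
  refine ⟨hb, hc, fun p q hp hpq hq l => ?_⟩
  have hsub : Icc p q ⊆ Icc 0 S := Icc_subset_Icc hp hq
  have hct : ContinuousOn (fun r => twist (freq a b 1) (fourierCoef a b fun x => (V x : ℂ)) r
      (interaction a b ψ r) l) (Icc p q) :=
    continuousOn_twist hκ ((hV.hBound hab).mono_index hm')
      (fun r hr => (hb r (hsub hr)).mono_index (by omega)) (fun l => (hc l).mono hsub) l
  rw [← intervalIntegral.integral_const_mul]
  refine (intervalIntegral.integral_eq_sub_of_hasDerivAt_of_le hpq ((hc l).mono hsub)
    (fun t ht => ?_) ((continuousOn_const.mul hct).intervalIntegrable_of_Icc hpq)).symm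
  have ht' : t ∈ Ioo 0 S := ⟨hp.trans_lt ht.1, ht.2.trans_le hq⟩
  -- In the product rule the derivative of the phase cancels the term with `μ_l²` and leaves only
  -- the potential.
  have hd := (hasDerivAt_phase_zero (freq a b 1) l t).mul (hasDerivAt_fourierCoef hab hm hψ h l ht')
  rw [fourierCoef_deriv hab hm hm' hV hψ h l ht'] at hd
  refine hd.congr_deriv ?_
  simp only [Pi.mul_apply]
  rw [twist_eq_conv]
  have h1 : (fun k => phase (freq a b 1) (-t) k 0 * interaction a b ψ t k)
      = fourierCoef a b (ψ t) := by
    funext k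
    unfold interaction
    rw [← mul_assoc, phase_mul_neg, one_mul]
  rw [h1, ← freq_eq]
  ring

end solution

/-! ### The discrete Fourier transform -/

section discrete

variable {a b : ℝ} {N : ℕ}

theorem gridPoint_mem_Icc (hab : a < b) (hN0 : 0 < N) (j : Fin (N + 1)) :
    gridPoint a b N j ∈ Icc a b := by
  have hN : (0 : ℝ) < N := by exact_mod_cast hN0
  have hL := sub_pos.2 hab
  have hj : ((j : ℕ) : ℝ) ≤ N := by exact_mod_cast Nat.lt_succ_iff.1 j.2
  unfold gridPoint meshSize
  refine ⟨le_add_of_nonneg_right (by positivity), ?_⟩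
  have : ((j : ℕ) : ℝ) * ((b - a) / N) ≤ N * ((b - a) / N) := by gcongr
  rw [mul_div_cancel₀ _ hN.ne'] at this
  linarith

theorem fourierMode_gridPoint (hab : a < b) (k : ℤ) (j : Fin (N + 1)) :
    fourierMode a b k (gridPoint a b N j)
      = Complex.exp (2 * Real.pi * Complex.I * k / N) ^ (j : ℕ) := by
  have hL : ((b : ℂ) - a) ≠ 0 := by exact_mod_cast (sub_pos.2 hab).ne'
  rw [← Complex.exp_nat_mul]
  unfold fourierMode gridPoint meshSize freq
  congr 1
  push_cast
  field_simp
  ring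

/-- Discrete orthogonality of the Fourier modes. -/
theorem sum_fourierMode_gridPoint (hab : a < b) (hN0 : 0 < N) (k : ℤ) :
    1 / (N : ℂ) * ∑ j : Fin N, fourierMode a b k (gridPoint a b N j.castSucc)
      = if (N : ℤ) ∣ k then 1 else 0 := by
  have hN : (N : ℂ) ≠ 0 := by exact_mod_cast hN0.ne'
  have hπ : (2 * Real.pi * Complex.I : ℂ) ≠ 0 := Complex.two_pi_I_ne_zero
  simp only [fourierMode_gridPoint hab, Fin.val_castSucc]
  rw [Fin.sum_univ_eq_sum_range
    (fun j => Complex.exp (2 * Real.pi * Complex.I * k / N) ^ j) N]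
  set ζ := Complex.exp (2 * Real.pi * Complex.I * k / N) with hζ
  have hone : ζ = 1 ↔ (N : ℤ) ∣ k := by
    rw [hζ, Complex.exp_eq_one_iff]
    constructor
    · rintro ⟨n, hn⟩
      refine ⟨n, ?_⟩
      have h1 : (2 * Real.pi * Complex.I : ℂ) * k = (2 * Real.pi * Complex.I) * (N * n) := by
        rw [div_eq_iff hN] at hn
        rw [hn]; ring
      exact_mod_cast mul_left_cancel₀ hπ h1
    · rintro ⟨n, rfl⟩
      exact ⟨n, by push_cast; field_simp⟩
  have hpow : ζ ^ N = 1 := by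
    rw [hζ, ← Complex.exp_nat_mul, Complex.exp_eq_one_iff]
    exact ⟨k, by field_simp⟩
  split_ifs with h
  · rw [hone.2 h]
    simp [hN]
  · have h1 := mul_geom_sum ζ N
    rw [hpow, sub_self] at h1
    rw [(mul_eq_zero.1 h1).resolve_left (sub_ne_zero.2 fun h' => h (hone.1 h')), mul_zero]

/-- The aliasing formula. -/
theorem discreteCoef_of_series (hab : a < b) (hN0 : 0 < N) {u : Fin (N + 1) → ℂ} {c : ℤ → ℂ}
    (hc : Summable fun l => ‖c l‖)
    (hu : ∀ j, u j = ∑' p, c p * fourierMode a b p (gridPoint a b N j)) (l : ℤ) :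
    discreteCoef a b N u l = ∑' q : ℤ, c (l + q * N) := by
  have hs : ∀ j : Fin N, Summable fun p =>
      c p * fourierMode a b (p - l) (gridPoint a b N j.castSucc) := fun j =>
    Summable.of_norm (by simpa using hc)
  have h1 : discreteCoef a b N u l
      = 1 / (N : ℂ) * ∑ j : Fin N, ∑' p, c p * fourierMode a b (p - l) (gridPoint a b N j.castSucc) := by
    unfold discreteCoef
    congr 1
    refine Finset.sum_congr rfl fun j _ => ?_
    rw [exp_neg_eq_fourierMode, hu, ← tsum_mul_right]
    refine tsum_congr fun p => ?_
    rw [mul_assoc, ← fourierMode_add, sub_eq_add_neg]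
  rw [h1, ← Summable.tsum_finsetSum fun j _ => hs j, ← tsum_mul_left]
  have h2 : ∀ p, 1 / (N : ℂ) * ∑ j : Fin N, c p * fourierMode a b (p - l) (gridPoint a b N j.castSucc)
      = if (N : ℤ) ∣ p - l then c p else 0 := fun p => by
    rw [← Finset.mul_sum, mul_left_comm, sum_fourierMode_gridPoint hab hN0, mul_ite, mul_one, mul_zero]
  simp only [h2]
  have hinj : Function.Injective fun q : ℤ => l + q * N := fun q q' h => by
    simpa [hN0.ne'] using h
  rw [← hinj.tsum_eq (f := fun p => if (N : ℤ) ∣ p - l then c p else 0)]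
  · simp
  · intro p hp
    rw [Function.mem_support] at hp
    obtain ⟨q, hq⟩ : (N : ℤ) ∣ p - l := by
      by_contra h
      exact hp (if_neg h)
    exact ⟨q, by simp only; linarith⟩

theorem discreteCoef_eq_aliasOp (hab : a < b) (hN0 : 0 < N) {u : Fin (N + 1) → ℂ} {c : ℤ → ℂ}
    (hc : Summable fun l => ‖c l‖)
    (hu : ∀ j, u j = ∑' p, c p * fourierMode a b p (gridPoint a b N j)) :
    modeProj N (discreteCoef a b N u) = aliasOp N c := by
  funext l
  simp only [modeProj, aliasOp, discreteCoef_of_series hab hN0 hc hu]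

theorem summable_modeProj (u : ℤ → ℂ) : Summable fun l => ‖modeProj N u l‖ :=
  summable_of_ne_finset_zero (s := modeSet N) fun l hl => by simp [modeProj, hl]

theorem tsum_modeProj_mul (u χ : ℤ → ℂ) :
    ∑' l, modeProj N u l * χ l = ∑ l ∈ modeSet N, u l * χ l := by
  rw [tsum_eq_sum (s := modeSet N) fun l hl => by simp [modeProj, hl]]
  exact Finset.sum_congr rfl fun l hl => by simp [modeProj, hl]

end discrete

/-! ### The scheme in Fourier variables -/

section scheme

variable {a b : ℝ} {V : ℝ → ℝ} {ε τ : ℝ} {N : ℕ}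

theorem exp_eq_phase (a b τ : ℝ) (l : ℤ) :
    Complex.exp (-(Complex.I * ((τ * freq a b l ^ 2 / 2 : ℝ) : ℂ)))
      = phase (freq a b 1) (-(τ / 2)) l 0 := by
  unfold phase mismatch
  rw [← freq_eq]
  congr 1
  push_cast
  ring

theorem halfFreeStep_apply (u : Fin (N + 1) → ℂ) (j : Fin (N + 1)) :
    halfFreeStep a b N τ u j
      = ∑' l, (phase (freq a b 1) (-(τ / 2)) l 0 * modeProj N (discreteCoef a b N u) l)
        * fourierMode a b l (gridPoint a b N j) := by
  have h : ∀ l, phase (freq a b 1) (-(τ / 2)) l 0 * modeProj N (discreteCoef a b N u) l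
      = modeProj N (fun l => phase (freq a b 1) (-(τ / 2)) l 0 * discreteCoef a b N u l) l :=
    fun l => by simp [modeProj]
  simp only [h]
  rw [tsum_modeProj_mul]
  simp only [halfFreeStep, exp_eq_phase]

/-- The output contains grid modes only, so resampling creates no aliasing and the free half step is
an exact Fourier multiplier. -/
theorem modeProj_halfFreeStep (hab : a < b) (hN0 : 0 < N) (hN : Even N) (u : Fin (N + 1) → ℂ) :
    modeProj N (discreteCoef a b N (halfFreeStep a b N τ u))
      = fun l => phase (freq a b 1) (-(τ / 2)) l 0 * modeProj N (discreteCoef a b N u) l := by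
  rw [discreteCoef_eq_aliasOp hab hN0 (c := fun l =>
      phase (freq a b 1) (-(τ / 2)) l 0 * modeProj N (discreteCoef a b N u) l)
    (by simpa using summable_modeProj (discreteCoef a b N u)) (halfFreeStep_apply u)]
  exact aliasOp_of_support hN0 hN fun l hl => by simp [modeProj, hl]

/-- At every grid point the product with `exp(-iετV)` is the value of the Fourier series of `y + W *
y`, where `W` represents `exp(-iετV) - 1`. Sampling aliases this series, and `y` itself is
unaffected because it is supported on the grid modes. -/
theorem modeProj_potentialStep (hab : a < b) (hN0 : 0 < N) (hN : Even N) {m' : ℕ} (hm' : 1 ≤ m')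
    (hV : MemHper a b m' fun x => (V x : ℂ)) (y : ℤ → ℂ) (hy : ∀ l, l ∉ modeSet N → y l = 0)
    {u : Fin (N + 1) → ℂ}
    (hu : ∀ j, u j = ∑' l, y l * fourierMode a b l (gridPoint a b N j)) (l : ℤ) :
    modeProj N (discreteCoef a b N (potentialStep a b V ε N τ u)) l
      = y l + aliasOp N (seqConv (expTail (fourierCoef a b fun x => (V x : ℂ))
          (-(Complex.I * ε) * τ) 0) y) l := by
  have hκ := freq_one_pos hab
  set v := fourierCoef a b fun x => (V x : ℂ) with hv
  set W := expTail v (-(Complex.I * ε) * τ) 0 with hW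
  have hv1 : HBound (freq a b 1) 1 v (hperNorm a b m' fun x => (V x : ℂ)) :=
    (hV.hBound hab).mono_index hm'
  have hWs : Summable fun l => ‖W l‖ := (hv1.expTail_bound hκ le_rfl _ 0).summable hκ le_rfl
  have hys : Summable fun l => ‖y l‖ :=
    summable_of_ne_finset_zero (s := modeSet N) fun l hl => by simp [hy l hl]
  have hχ : ∀ (x : ℝ) (l : ℤ), ‖fourierMode a b l x‖ ≤ 1 := fun x l => (norm_fourierMode a b l x).le
  have hWy : ∀ G : ℤ → ℂ, (∀ l, ‖G l‖ ≤ 1) → Summable fun p => G p * seqConv W y p :=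
    fun G hG => summable_mul_seqConv hWs hys hG
  have hWyn : Summable fun l => ‖seqConv W y l‖ :=
    (by simpa using hWy (fun _ => 1) (by simp) : Summable fun p => seqConv W y p).norm
  have hsum : Summable fun l => ‖y l + seqConv W y l‖ :=
    (hys.of_norm.add hWyn.of_norm).norm
  have hval : ∀ j, potentialStep a b V ε N τ u j
      = ∑' p, (y p + seqConv W y p) * fourierMode a b p (gridPoint a b N j) := by
    intro j
    set x := gridPoint a b N j with hx
    have hxI : x ∈ Icc a b := gridPoint_mem_Icc hab hN0 j
    have h1 := tsum_character_expTail hκ hv1 (χ := fun p => fourierMode a b p x) (hχ x)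
      (fun j k => fourierMode_add a b j k x) (-(Complex.I * ε) * τ)
    have h2 : ∑' p, fourierMode a b p x * v p = V x := by
      rw [← (hV.hasSum hab hm' hxI).tsum_eq]
      exact tsum_congr fun p => mul_comm _ _
    rw [h2] at h1
    have h3 := tsum_character_seqConv hWs hys (χ := fun p => fourierMode a b p x) (hχ x)
      (fun j k => fourierMode_add a b j k x)
    have h4 : ∑' k, fourierMode a b k x * y k = u j := by
      rw [hu]; exact tsum_congr fun p => mul_comm _ _
    have hs1 : Summable fun p => y p * fourierMode a b p x := Summable.of_norm (by simpa using hys)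
    have hs2 : Summable fun p => seqConv W y p * fourierMode a b p x :=
      Summable.of_norm (by simpa using hWyn)
    simp only [add_mul]
    rw [hs1.tsum_add hs2, ← hu]
    have h5 : ∑' p, seqConv W y p * fourierMode a b p x = (∑' p, fourierMode a b p x * W p) * u j := by
      rw [← h4, ← h3]; exact tsum_congr fun p => mul_comm _ _
    rw [h5]
    have h6 : Complex.exp (-(Complex.I * ((ε * τ * V x : ℝ) : ℂ)))
        = Complex.exp (-(Complex.I * ε) * τ * V x) := by
      congr 1; push_cast; ring
    simp only [potentialStep]
    rw [← hx, h6, ← h1]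
    ring
  rw [discreteCoef_eq_aliasOp hab hN0 hsum hval]
  by_cases hl : l ∈ modeSet N
  · have hs1 := summable_shift hN0 hys l
    have hs2 := summable_shift hN0 hWyn l
    have h1 := congrFun (aliasOp_of_support hN0 hN hy) l
    simp only [aliasOp, if_pos hl] at h1 ⊢
    rw [hs1.tsum_add hs2, h1]
  · simp [aliasOp, hl, hy l hl]

/-- The discrete solution in Fourier variables and in the interaction picture. -/
def discreteInteraction (a b : ℝ) (V : ℝ → ℝ) (ε : ℝ) (ψ₀ : ℝ → ℂ) (N : ℕ) (τ : ℝ) (n : ℕ)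
    (l : ℤ) : ℂ :=
  phase (freq a b 1) (n * τ) l 0 * modeProj N (discreteCoef a b N (tsfp a b V ε ψ₀ N τ n)) l

/-- The first half step brings the phases from `nτ` to the midpoint and the second brings them on to
`(n+1)τ`. Hence the potential acts conjugated at `nτ + τ/2`, the same time at which `midError`
freezes the flow. -/
theorem discreteInteraction_succ (hab : a < b) (hN0 : 0 < N) (hN : Even N) {m' : ℕ} (hm' : 1 ≤ m')
    (hV : MemHper a b m' fun x => (V x : ℂ)) (ψ₀ : ℝ → ℂ) (n : ℕ) (l : ℤ) :
    discreteInteraction a b V ε ψ₀ N τ (n + 1) l = discreteInteraction a b V ε ψ₀ N τ n l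
      + stepOp (freq a b 1) N (expTail (fourierCoef a b fun x => (V x : ℂ))
          (-(Complex.I * ε) * τ) 0) (n * τ + τ / 2) (discreteInteraction a b V ε ψ₀ N τ n) l := by
  set κ := freq a b 1 with hκ
  set d := modeProj N (discreteCoef a b N (tsfp a b V ε ψ₀ N τ n)) with hd
  have hph : ∀ k, phase κ (-(n * τ + τ / 2)) k 0 * phase κ (n * τ) k 0 = phase κ (-(τ / 2)) k 0 :=
    fun k => by rw [← phase_add]; congr 1; ring
  have hstep := modeProj_potentialStep (ε := ε) (τ := τ) hab hN0 hN hm' hV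
    (fun l => phase κ (-(τ / 2)) l 0 * d l) (fun l hl => by simp [hd, modeProj, hl])
    (fun j => halfFreeStep_apply (τ := τ) (tsfp a b V ε ψ₀ N τ n) j) l
  simp only [discreteInteraction, stepOp]
  simp only [← hκ, ← hd, ← mul_assoc, hph]
  rw [tsfp, modeProj_halfFreeStep hab hN0 hN]
  simp only [hstep, ← hκ]
  have h1 : phase κ ((n + 1 : ℕ) * τ) l 0 * phase κ (-(τ / 2)) l 0 = phase κ (n * τ + τ / 2) l 0 := by
    rw [← phase_add]; congr 1; push_cast; ring
  have h2 : phase κ (n * τ + τ / 2) l 0 * phase κ (-(τ / 2)) l 0 = phase κ (n * τ) l 0 := by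
    rw [← phase_add]; congr 1; ring
  rw [← mul_assoc (phase κ ((n + 1 : ℕ) * τ) l 0), h1, mul_add, ← mul_assoc, h2]

theorem phase_zero (κ : ℝ) (l k : ℤ) : phase κ 0 l k = 1 := by simp [phase]

theorem discreteInteraction_zero (hab : a < b) (hN0 : 0 < N) {m : ℕ} (hm : 1 ≤ m) {ψ₀ : ℝ → ℂ}
    {ψ : ℝ → ℝ → ℂ} (hψ : MemHper a b m (ψ 0)) (h0 : ∀ x ∈ Icc a b, ψ 0 x = ψ₀ x) :
    discreteInteraction a b V ε ψ₀ N τ 0 = aliasOp N (interaction a b ψ 0) := by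
  have h1 : interaction a b ψ 0 = fourierCoef a b (ψ 0) := by
    funext l; simp [interaction, phase_zero]
  rw [h1, ← discreteCoef_eq_aliasOp hab hN0 ((hψ.hBound hab).summable (freq_one_pos hab) hm)
    (u := tsfp a b V ε ψ₀ N τ 0) fun j => ?_]
  · funext l
    simp [discreteInteraction, phase_zero]
  · have hx := gridPoint_mem_Icc hab hN0 j
    rw [(hψ.hasSum hab hm hx).tsum_eq, h0 _ hx, tsfp]

theorem trigInterp_eq (u : Fin (N + 1) → ℂ) (x : ℝ) :
    trigInterp a b N u x = ∑' l, modeProj N (discreteCoef a b N u) l * fourierMode a b l x := by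
  rw [tsum_modeProj_mul]; rfl

theorem memHper_trigInterp (hab : a < b) (u : Fin (N + 1) → ℂ) (m : ℕ) :
    MemHper a b m (trigInterp a b N u) := by
  set g : ℕ → ℝ → ℂ := fun k x => ∑ l ∈ modeSet N,
    discreteCoef a b N u l * ((Complex.I * (freq a b l : ℂ)) ^ k * fourierMode a b l x) with hg
  have hc : ∀ k, Continuous (g k) := fun k => continuous_finsetSum _ fun l _ =>
    continuous_const.mul (continuous_const.mul (continuous_fourierMode a b l))
  have hd : ∀ k x, HasDerivAt (g k) (g (k + 1) x) x := fun k x => by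
    refine (HasDerivAt.fun_sum fun l _ =>
      ((hasDerivAt_fourierMode a b l x).const_mul _).const_mul _).congr_deriv ?_
    refine Finset.sum_congr rfl fun l _ => ?_
    rw [pow_succ]; ring
  refine ⟨g, fun x _ => by simp [hg, trigInterp], fun k _ => ?_, fun k _ x _ => ?_, fun k _ => ?_⟩
  · obtain ⟨B, hB⟩ := isCompact_Icc.exists_bound_of_continuousOn (hc k).continuousOn (s := Icc a b)
    refine MemLp.of_bound (hc k).aestronglyMeasurable B ?_
    filter_upwards [ae_restrict_mem measurableSet_Ioc] with x hx
    exact hB x ⟨hx.1.le, hx.2⟩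
  · rw [intervalIntegral.integral_eq_sub_of_hasDerivAt (fun y _ => hd k y)
      ((hc (k + 1)).intervalIntegrable _ _)]
    ring
  · simp only [hg, fourierMode_left, fourierMode_right hab]

theorem MemHper.sub {m : ℕ} {u w : ℝ → ℂ} (hu : MemHper a b m u)
    (hw : MemHper a b m w) : MemHper a b m fun x => u x - w x := by
  obtain ⟨g, h0, hL, hp, hper⟩ := hu
  obtain ⟨f, f0, fL, fp, fper⟩ := hw
  refine ⟨fun k x => g k x - f k x, fun x hx => by simp only [h0 x hx, f0 x hx],
    fun k hk => (hL k hk).sub (fL k hk), fun k hk x hx => ?_,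
    fun k hk => by simp only [hper k hk, fper k hk]⟩
  have hi : ∀ q : ℝ → ℂ, MemLp q 2 (volume.restrict (Ioc a b)) → IntervalIntegrable q volume a x :=
    fun q hq => (intervalIntegrable_iff_integrableOn_Ioc_of_le hx.1).2
      ((MemLp.integrableOn_Ioc hq).mono_set (Ioc_subset_Ioc_right hx.2))
  rw [intervalIntegral.integral_sub (hi _ (hL (k + 1) hk)) (hi _ (fL (k + 1) hk))]
  simp only [hp k hk x hx, fp k hk x hx]
  ring

theorem MemHper.mono_index {m k : ℕ} (hk : k ≤ m) {u : ℝ → ℂ} (hu : MemHper a b m u) :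
    MemHper a b k u := by
  obtain ⟨g, h0, hL, hp, hper⟩ := hu
  exact ⟨g, h0, fun j hj => hL j (hj.trans hk), fun j hj => hp j (hj.trans_le hk),
    fun j hj => hper j (hj.trans_le hk)⟩

theorem fourierCoef_tsfpError (hab : a < b) {m : ℕ} (hm : 1 ≤ m) {ψ₀ : ℝ → ℂ} {ψ : ℝ → ℝ → ℂ}
    {n : ℕ} (hψ : MemHper a b m (ψ (n * τ))) (l : ℤ) :
    fourierCoef a b (tsfpError a b V ε ψ₀ ψ N τ n) l = fourierCoef a b (ψ (n * τ)) l
      - modeProj N (discreteCoef a b N (tsfp a b V ε ψ₀ N τ n)) l := by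
  have h1 := (hψ.hBound hab).summable (freq_one_pos hab) hm
  have h2 := summable_modeProj (N := N) (discreteCoef a b N (tsfp a b V ε ψ₀ N τ n))
  refine fourierCoef_of_series hab
    (c := fun l => fourierCoef a b (ψ (n * τ)) l
      - modeProj N (discreteCoef a b N (tsfp a b V ε ψ₀ N τ n)) l)
    ((h1.of_norm.sub h2.of_norm).norm) (fun x hx => ?_) l
  have hs1 : Summable fun p => fourierCoef a b (ψ (n * τ)) p * fourierMode a b p x :=
    Summable.of_norm (by simpa using h1)
  have hs2 : Summable fun p => modeProj N (discreteCoef a b N (tsfp a b V ε ψ₀ N τ n)) p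
      * fourierMode a b p x := Summable.of_norm (by simpa using h2)
  simp only [sub_mul]
  rw [hs1.tsum_sub hs2, (hψ.hasSum hab hm ⟨hx.1.le, hx.2.le⟩).tsum_eq, ← trigInterp_eq]
  rfl

/-- The error estimate under an abstract non-resonance condition. -/
theorem tsfp_error (hab : a < b) {r : ℕ} (hr : 2 ≤ r) {m' : ℕ} (hm' : r + 1 ≤ m')
    (hV : MemHper a b m' fun x => (V x : ℂ)) {T M Γ θ : ℝ} (hε : ε ∈ Ioc (0 : ℝ) 1)
    (hτ : 0 < τ) {ψ₀ : ℝ → ℂ} {ψ : ℝ → ℝ → ℂ}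
    (hψ : IsSchrodingerSolution a b V ε (T / ε) ψ₀ ψ)
    (hreg : RegularityBound a b (T / ε) (r + 1) M ψ) {Λ : Finset ℤ} (hΓ : 0 ≤ Γ) (hθ : 0 ≤ θ)
    (hΛ : ∀ l ∈ Λ, ∀ k ∈ Λ, wt (freq a b 1) l * ‖midPhase (freq a b 1) τ l k‖
      ≤ Γ * (wt (freq a b 1) (l - k) + wt (freq a b 1) k) ^ (r + 1)
        * ‖phase (freq a b 1) τ l k - 1‖)
    (hΛθ : ∀ l, l ∉ Λ → 1 ≤ θ * wt (freq a b 1) l) (hN0 : 0 < N) (hN : Even N) {n : ℕ}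
    (hn : (n : ℝ) ≤ T / ε / τ) :
    MemHper a b 1 (tsfpError a b V ε ψ₀ ψ N τ n) ∧
    hperNorm a b 1 (tsfpError a b V ε ψ₀ ψ N τ n) ≤
      consistencyConst (freq a b 1) r (hperNorm a b m' fun x => (V x : ℂ)) M T
        * (gridTail (freq a b 1) N ^ r + ε * τ ^ 2 + ε * Γ + θ ^ r)
        * Real.exp (aliasConst (freq a b 1) * convConst (freq a b 1) 1
          * growthConst (freq a b 1) (r + 1) (hperNorm a b m' fun x => (V x : ℂ)) T * T)
        + gridTail (freq a b 1) N ^ r * M := by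
  obtain ⟨hε0, hε1⟩ := hε
  have hnS : n * τ ≤ T / ε := (le_div_iff₀ hτ).1 hn
  have hnT : n * (ε * τ) ≤ T := by
    have := (le_div_iff₀ hε0).1 hnS
    linarith
  have h0n : 0 ≤ n * τ := by positivity
  have hmem := hreg.mem (n * τ) ⟨h0n, hnS⟩
  refine ⟨(hmem.mono_index (by omega)).sub (memHper_trigInterp hab _ 1), ?_⟩
  have hflow := interactionFlow_of_solution hab (by omega) (by omega) hV hψ hreg
  have h := hflow.scheme_error (freq_one_pos hab) hr hε0.le hε1 hτ.le
    ((hV.hBound hab).mono_index hm') hΓ hθ hΛ hΛθ hN0 hN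
    (discreteInteraction_zero (V := V) (ε := ε) (τ := τ) hab hN0 (by omega)
      (hreg.mem 0 ⟨le_rfl, h0n.trans hnS⟩) hψ.initial)
    (discreteInteraction_succ hab hN0 hN (by omega) hV ψ₀) hnS hnT
  -- The phases are unimodular, so the error has the same `H¹` norm in the interaction picture and
  -- in the original variables.
  refine HBound.hperNorm_le (h.of_norm_le fun l => le_of_eq ?_)
  rw [fourierCoef_tsfpError hab (by omega) hmem]
  simp only [interaction, discreteInteraction]
  rw [← mul_sub, norm_mul, norm_phase, one_mul]

end scheme

/-! ### Non-resonance under the step conditions and the final error bounds. -/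

section estimates

variable {a b α ν : ℝ}

theorem gridTail_freq_le_meshSize (hab : a < b) (N : ℕ) :
    gridTail (freq a b 1) N ≤ meshSize a b N := by
  have hL := sub_pos.2 hab
  have h1 : gridTail (freq a b 1) N = meshSize a b N / Real.pi := by
    have := Real.pi_ne_zero
    unfold gridTail meshSize freq
    push_cast
    field_simp
  rw [h1]
  refine div_le_self (by unfold meshSize; positivity) ?_
  linarith [Real.pi_gt_three]

/-- The constant of the non-resonance estimate under either of the step conditions. -/
def resonanceConst (a b α ν : ℝ) : ℝ :=
  Real.pi / (4 * (1 - α)) + Real.pi / (2 * diophantineConst a b α ν)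

theorem resonanceConst_summands_pos (hab : a < b) (hα : α ∈ Ioo (0 : ℝ) 1) (hν : 0 < ν) :
    0 < Real.pi / (4 * (1 - α)) ∧ 0 < Real.pi / (2 * diophantineConst a b α ν) := by
  have hπ := Real.pi_pos
  have h1 := sub_pos.2 hα.2
  have h2 := diophantineConst_pos hab hα.1 hν
  exact ⟨by positivity, by positivity⟩

theorem midPhase_kernel (hab : a < b) (hα : α ∈ Ioo (0 : ℝ) 1) (hν : 0 < ν) {τ₀ τ : ℝ}
    (hτ₀ : 0 < τ₀) {s : ℕ} (hs : 3 ≤ s)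
    (h : SmallStep a b α τ₀ τ ∨ (DiophantineStep a b α ν τ₀ τ ∧ 5 + 2 * ν ≤ (s : ℝ))) :
    ∀ l ∈ lowModes τ₀, ∀ k ∈ lowModes τ₀, wt (freq a b 1) l * ‖midPhase (freq a b 1) τ l k‖
      ≤ resonanceConst a b α ν * τ ^ 2 * (wt (freq a b 1) (l - k) + wt (freq a b 1) k) ^ s
        * ‖phase (freq a b 1) τ l k - 1‖ := by
  intro l hl k hk
  obtain ⟨h1, h2⟩ := resonanceConst_summands_pos hab hα hν
  have hw : 0 ≤ wt (freq a b 1) (l - k) + wt (freq a b 1) k :=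
    add_nonneg (wt_pos _ _).le (wt_pos _ _).le
  rcases h with ⟨hτ, hS⟩ | ⟨⟨hτ, hD⟩, hs'⟩
  · refine (midPhase_kernel_of_small (freq_one_pos hab) hα hτ₀ hτ hS hs l hl k hk).trans ?_
    gcongr
    exact le_add_of_nonneg_right h2.le
  · refine (midPhase_kernel_of_diophantine hν (diophantineConst_pos hab hα.1 hν) hτ hD hs'
      l hl k hk).trans ?_
    gcongr
    exact le_add_of_nonneg_left h1.le

/-- The uniform error bound for solutions of finite regularity. -/
theorem tsfp_uniform_error (hab : a < b) {V : ℝ → ℝ} (T : ℝ) (hα : α ∈ Ioo (0 : ℝ) 1) (hν : 0 < ν)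
    {m : ℕ} (hm : 3 ≤ m) {m' : ℕ} (hm' : m ≤ m') (hV : MemHper a b m' fun x => (V x : ℂ)) (M : ℝ) :
    ∃ C : ℝ, 0 < C ∧
      ∀ ε ∈ Ioc (0 : ℝ) 1, ∀ (ψ₀ : ℝ → ℂ) (ψ : ℝ → ℝ → ℂ),
        IsSchrodingerSolution a b V ε (T / ε) ψ₀ ψ →
        RegularityBound a b (T / ε) m M ψ →
        ∀ τ₀ ∈ Ioo (0 : ℝ) 1, ∀ τ : ℝ,
          (SmallStep a b α τ₀ τ ∨ (DiophantineStep a b α ν τ₀ τ ∧ 5 + 2 * ν ≤ (m : ℝ))) →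
          ∀ N : ℕ, 0 < N → Even N → ∀ n : ℕ, (n : ℝ) ≤ T / ε / τ →
            MemHper a b 1 (tsfpError a b V ε ψ₀ ψ N τ n) ∧
            hperNorm a b 1 (tsfpError a b V ε ψ₀ ψ N τ n) ≤
              C * (meshSize a b N ^ (m - 1) + ε * τ ^ 2 + τ₀ ^ (m - 1)) := by
  obtain ⟨r, rfl⟩ : ∃ r, m = r + 1 := ⟨m - 1, by omega⟩
  rw [Nat.add_sub_cancel]
  set κ := freq a b 1 with hκdef
  have hκ : 0 < κ := freq_one_pos hab
  set A := hperNorm a b m' fun x => (V x : ℂ)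
  set E := Real.exp (aliasConst κ * convConst κ 1 * growthConst κ (r + 1) A T * T)
  set K := |consistencyConst κ r A M T| * E with hK
  set c := resonanceConst a b α ν with hc
  have hE : 0 < E := Real.exp_pos _
  have hK0 : 0 ≤ K := by positivity
  have hc0 : 0 ≤ c := by
    obtain ⟨h1, h2⟩ := resonanceConst_summands_pos hab hα hν
    exact (add_pos h1 h2).le
  have hκr : 0 ≤ (1 / κ) ^ r := by positivity
  -- The constant is fixed before any solution is given, so the sign of `M` is not yet known. This
  -- accounts for the absolute values, and `+ 1` ensures positivity.
  refine ⟨K * (1 + c + (1 / κ) ^ r) + |M| + 1, by positivity, ?_⟩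
  intro ε hε ψ₀ ψ hψ hreg τ₀ hτ₀ τ hstep N hN0 hN n hn
  have hτ : 0 < τ := hstep.elim (fun h => h.1) fun h => h.1.1
  -- With `Γ = c τ²` the term `ε Γ` has the order of the remainder `ετ²`, and `θ = τ₀/κ` gives
  -- `τ₀^(m-1)` up to a constant.
  obtain ⟨h1, h2⟩ := tsfp_error (Γ := c * τ ^ 2) hab (by omega) hm' hV hε hτ hψ hreg
    (by positivity) (div_nonneg hτ₀.1.le hκ.le) (midPhase_kernel hab hα hν hτ₀.1 hm hstep)
    (fun l hl => one_le_mul_wt_of_not_mem_lowModes hκ hτ₀.1 hl) hN0 hN hn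
  refine ⟨h1, h2.trans ?_⟩
  have hε0 := hε.1
  have hM : 0 ≤ M := hreg.nonneg ((mul_nonneg n.cast_nonneg hτ.le).trans ((le_div_iff₀ hτ).1 hn))
  have hg : gridTail κ N ^ r ≤ meshSize a b N ^ r :=
    pow_le_pow_left₀ (gridTail_nonneg hκ N) (gridTail_freq_le_meshSize hab N) r
  have hg0 : 0 ≤ gridTail κ N ^ r := pow_nonneg (gridTail_nonneg hκ N) r
  have hθ : (τ₀ / κ) ^ r = (1 / κ) ^ r * τ₀ ^ r := by rw [← mul_pow]; ring
  have hτr : 0 ≤ τ₀ ^ r := pow_nonneg hτ₀.1.le r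
  rw [hθ]
  generalize gridTail κ N ^ r = g at *
  generalize meshSize a b N ^ r = x at *
  generalize τ₀ ^ r = z at *
  generalize (1 / κ) ^ r = q at *
  have hy : 0 ≤ ε * τ ^ 2 := by positivity
  have hy' : ε * (c * τ ^ 2) = c * (ε * τ ^ 2) := by ring
  rw [hy']
  generalize ε * τ ^ 2 = y at *
  calc consistencyConst κ r A M T * (g + y + c * y + q * z) * E + g * M
      ≤ |consistencyConst κ r A M T| * (g + y + c * y + q * z) * E + x * |M| := by
        gcongr
        · exact le_abs_self _
        · exact hg0.trans hg
        · exact le_abs_self M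
    _ = K * (g + y + c * y + q * z) + x * |M| := by rw [hK]; ring
    _ ≤ K * ((1 + c + q) * (x + y + z)) + (x + y + z) * |M| := by
        gcongr
        · nlinarith [mul_nonneg hc0 (hg0.trans hg), mul_nonneg hκr (hg0.trans hg),
            mul_nonneg hc0 hτr, mul_nonneg hκr hy]
        · linarith
    _ ≤ (K * (1 + c + q) + |M| + 1) * (x + y + z) := by linarith [hg0.trans hg]

theorem meshSize_pow_le (hab : a < b) {k m : ℕ} (hkm : k ≤ m) {N : ℕ} (hN0 : 0 < N) :
    meshSize a b N ^ m ≤ (b - a) ^ (m - k) * meshSize a b N ^ k := by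
  have hL := sub_pos.2 hab
  have h0 : 0 ≤ meshSize a b N := by unfold meshSize; positivity
  have h1 : meshSize a b N ≤ b - a := div_le_self hL.le (by exact_mod_cast hN0)
  rw [← pow_sub_mul_pow _ hkm]
  gcongr

/-- The error bound for smooth solutions. -/
theorem tsfp_smooth_error (hab : a < b) {V : ℝ → ℝ} (T : ℝ) (hα : α ∈ Ioo (0 : ℝ) 1) (hν : 0 < ν)
    (hV : ∀ k : ℕ, MemHper a b k fun x => (V x : ℂ)) (M : ℕ → ℝ) (m p : ℕ) :
    ∃ C : ℝ, 0 < C ∧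
      ∀ ε ∈ Ioc (0 : ℝ) 1, ∀ (ψ₀ : ℝ → ℂ) (ψ : ℝ → ℝ → ℂ),
        IsSchrodingerSolution a b V ε (T / ε) ψ₀ ψ →
        (∀ k : ℕ, 3 ≤ k → RegularityBound a b (T / ε) k (M k) ψ) →
        ∀ τ₀ ∈ Ioo (0 : ℝ) 1, ∀ τ : ℝ,
          (SmallStep a b α τ₀ τ ∨ DiophantineStep a b α ν τ₀ τ) →
          ∀ N : ℕ, 0 < N → Even N → ∀ n : ℕ, (n : ℝ) ≤ T / ε / τ →
            MemHper a b 1 (tsfpError a b V ε ψ₀ ψ N τ n) ∧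
            hperNorm a b 1 (tsfpError a b V ε ψ₀ ψ N τ n) ≤
              C * (meshSize a b N ^ (m - 1) + ε * τ ^ 2 + τ₀ ^ p) := by
  -- The index `k` is large enough to give at least the powers `m - 1` of `h` and `p` of `τ₀`, and
  -- to meet the regularity demand `5 + 2ν` of the Diophantine case. Surplus powers of `h ≤ b - a`
  -- and `τ₀ < 1` are discarded.
  set k := max (max m (p + 1)) (max 3 ⌈5 + 2 * ν⌉₊) with hk
  have hkm : m ≤ k := (le_max_left _ _).trans (le_max_left _ _)
  have hkp : p + 1 ≤ k := (le_max_right _ _).trans (le_max_left _ _)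
  have hk3 : 3 ≤ k := (le_max_left _ _).trans (le_max_right _ _)
  have hkν : 5 + 2 * ν ≤ (k : ℝ) := (Nat.le_ceil _).trans
    (by exact_mod_cast (le_max_right _ _).trans (le_max_right _ _))
  obtain ⟨C, hC, h⟩ := tsfp_uniform_error hab T hα hν hk3 le_rfl (hV k) (M k)
  have hL := sub_pos.2 hab
  set D := (b - a) ^ (k - 1 - (m - 1)) with hD
  have hD0 : 0 ≤ D := by positivity
  refine ⟨C * (D + 1), by positivity, ?_⟩
  intro ε hε ψ₀ ψ hψ hreg τ₀ hτ₀ τ hstep N hN0 hN n hn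
  obtain ⟨h1, h2⟩ := h ε hε ψ₀ ψ hψ (hreg k hk3) τ₀ hτ₀ τ
    (hstep.imp_right fun h => ⟨h, hkν⟩) N hN0 hN n hn
  refine ⟨h1, h2.trans ?_⟩
  rw [mul_assoc]
  have hx := meshSize_pow_le hab (k := m - 1) (m := k - 1) (by omega) hN0
  have hz : τ₀ ^ (k - 1) ≤ τ₀ ^ p := pow_le_pow_of_le_one hτ₀.1.le hτ₀.2.le (by omega)
  have hx0 : 0 ≤ meshSize a b N ^ (m - 1) := pow_nonneg (by unfold meshSize; positivity) _
  have hy0 : 0 ≤ ε * τ ^ 2 := mul_nonneg hε.1.le (sq_nonneg τ)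
  have hz0 : 0 ≤ τ₀ ^ p := pow_nonneg hτ₀.1.le p
  refine mul_le_mul_of_nonneg_left ?_ hC.le
  rw [← hD] at hx
  nlinarith [mul_nonneg hD0 hy0, mul_nonneg hD0 hz0]

end estimates

end

theorem mainTheorem2 (a b : ℝ) (hab : a < b) (V : ℝ → ℝ) (T : ℝ) (hT : 0 < T)
    (α : ℝ) (hα : α ∈ Set.Ioo (0 : ℝ) 1) (ν₃ : ℝ) (hν₃ : 0 < ν₃) :
    -- solutions of finite regularity
    (∀ m : ℕ, 3 ≤ m → MemHper a b (max m 5) (fun x => (V x : ℂ)) → ∀ M : ℝ,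
      ∃ C : ℝ, 0 < C ∧
        ∀ ε ∈ Set.Ioc (0 : ℝ) 1, ∀ (ψ₀ : ℝ → ℂ) (ψ : ℝ → ℝ → ℂ),
          IsSchrodingerSolution a b V ε (T / ε) ψ₀ ψ →
          RegularityBound a b (T / ε) m M ψ →
          ∀ τ₀ ∈ Set.Ioo (0 : ℝ) 1, ∀ τ : ℝ,
            (SmallStep a b α τ₀ τ ∨ (DiophantineStep a b α ν₃ τ₀ τ ∧ 5 + 2 * ν₃ ≤ (m : ℝ))) →
            ∀ N : ℕ, 0 < N → Even N → ∀ n : ℕ, (n : ℝ) ≤ T / ε / τ →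
              MemHper a b 1 (tsfpError a b V ε ψ₀ ψ N τ n) ∧
              hperNorm a b 1 (tsfpError a b V ε ψ₀ ψ N τ n) ≤
                C * (meshSize a b N ^ (m - 1) + ε * τ ^ 2 + τ₀ ^ (m - 1))) ∧
    -- smooth solutions
    ((∀ k : ℕ, MemHper a b k (fun x => (V x : ℂ))) → ∀ M : ℕ → ℝ, ∀ m : ℕ, 3 ≤ m →
      -- the cut-off error decays faster than any power of `τ₀`
      (∀ p : ℕ, ∃ C : ℝ, 0 < C ∧
        ∀ ε ∈ Set.Ioc (0 : ℝ) 1, ∀ (ψ₀ : ℝ → ℂ) (ψ : ℝ → ℝ → ℂ),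
          IsSchrodingerSolution a b V ε (T / ε) ψ₀ ψ →
          (∀ k : ℕ, 3 ≤ k → RegularityBound a b (T / ε) k (M k) ψ) →
          ∀ τ₀ ∈ Set.Ioo (0 : ℝ) 1, ∀ τ : ℝ,
            (SmallStep a b α τ₀ τ ∨ DiophantineStep a b α ν₃ τ₀ τ) →
            ∀ N : ℕ, 0 < N → Even N → ∀ n : ℕ, (n : ℝ) ≤ T / ε / τ →
              MemHper a b 1 (tsfpError a b V ε ψ₀ ψ N τ n) ∧
              hperNorm a b 1 (tsfpError a b V ε ψ₀ ψ N τ n) ≤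
                C * (meshSize a b N ^ (m - 1) + ε * τ ^ 2 + τ₀ ^ p)) ∧
      -- up to a prescribed precision `δ` the cut-off error can be dropped
      (∃ C : ℝ, 0 < C ∧ ∀ δ : ℝ, 0 < δ → ∃ τ₀ ∈ Set.Ioo (0 : ℝ) 1,
        ∀ ε ∈ Set.Ioc (0 : ℝ) 1, ∀ (ψ₀ : ℝ → ℂ) (ψ : ℝ → ℝ → ℂ),
          IsSchrodingerSolution a b V ε (T / ε) ψ₀ ψ →
          (∀ k : ℕ, 3 ≤ k → RegularityBound a b (T / ε) k (M k) ψ) →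
          ∀ τ : ℝ, (SmallStep a b α τ₀ τ ∨ DiophantineStep a b α ν₃ τ₀ τ) →
            ∀ N : ℕ, 0 < N → Even N → ∀ n : ℕ, (n : ℝ) ≤ T / ε / τ →
              MemHper a b 1 (tsfpError a b V ε ψ₀ ψ N τ n) ∧
              hperNorm a b 1 (tsfpError a b V ε ψ₀ ψ N τ n) ≤
                C * (meshSize a b N ^ (m - 1) + ε * τ ^ 2) + δ)) := by
  refine ⟨fun m hm hV M => tsfp_uniform_error hab T hα hν₃ hm (le_max_left m 5) hV M,
    fun hV M m _ => ⟨fun p => tsfp_smooth_error hab T hα hν₃ hV M m p, ?_⟩⟩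
  -- The first power of `τ₀` suffices. Since `C` does not depend on `δ`, the cut-off can be chosen
  -- afterwards with `C τ₀ ≤ δ`; the value `1/2` only keeps it below `1`.
  obtain ⟨C, hC, h⟩ := tsfp_smooth_error hab T hα hν₃ hV M m 1
  refine ⟨C, hC, fun δ hδ => ?_⟩
  have hτ₀ : min (1 / 2) (δ / C) ∈ Set.Ioo (0 : ℝ) 1 :=
    ⟨lt_min (by norm_num) (div_pos hδ hC), (min_le_left _ _).trans_lt (by norm_num)⟩
  refine ⟨_, hτ₀, fun ε hε ψ₀ ψ hψ hreg τ hstep N hN0 hN n hn => ?_⟩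
  obtain ⟨h1, h2⟩ := h ε hε ψ₀ ψ hψ hreg _ hτ₀ τ hstep N hN0 hN n hn
  refine ⟨h1, h2.trans ?_⟩
  have h3 : C * min (1 / 2) (δ / C) ≤ δ :=
    (mul_le_mul_of_nonneg_left (min_le_right _ _) hC.le).trans_eq (mul_div_cancel₀ _ hC.ne')
  rw [pow_one]
  linarith
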